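/- Let $H$ be a complex Hilbert space with inner product $(\cdot,\cdot)$ and norm $\|\cdot\|$, and let $a$ be a closed, Hermitian, positive-definite sesquilinear form in $H$ with dense domain $V\subset H$; equip $V$ with $(u,v)_V:=a(u,v)$ and $\|u\|_V^2:=a(u,u)$. Let $A$ be the self-adjoint operator in $H$ associated with $a$, and assume that $H$ has an orthonormal basis $\{\psi_k\}_{k\ge1}$ of eigenvectors of $A$, $A\psi_k=\mu_k\psi_k$. Suppose that there are $\gamma>0$, $\kappa>0$, $N_0>0$ with $$\mu_{k+1}-\mu_k\ \ge\ \kappa\,k^{\gamma-1}\qquad\text{for all } k\ge N_0 .$$ Let $b\colon V\times V\to\mathbb C$ be a sesquilinear form that is separately continuous with respect to $\|\cdot\|_V$, and suppose that there are $\alpha\in\mathbb R$ with $2\alpha+\gamma>1$ and $M_b>0$ with $$|b(\psi_m,\psi_n)|\ \le\ \frac{M_b}{m^{\alpha}n^{\alpha}}\qquad\text{for all } m,n\ge 1 .$$ Let $T$ be the operator in $H$ associated with $t:=a+b$, i.e. $u\in D(T)$ and $Tu=w$ if and only if $u\in V$ and $a(u,v)+b(u,v)=(w,v)$ for all $v\in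 V$. For $n\geq 1$ let $\Gamma_n$ be the counterclockwise boundary of the rectangle $$\Pi_n=\Big\{z:\ \mu_n-\tfrac\kappa2(n-1)^{\gamma-1}<\operatorname{Re}z<\mu_n+\tfrac\kappa2n^{\gamma-1},\ |\operatorname{Im}z|<\tfrac\kappa2n^{\gamma-1}\Big\}.$$ Call $\{(\lambda_n,\phi_n)\}_{n\ge1}\subset\mathbb C\times V$ an *admissible root system* of $T$ if * $\{\lambda_n : n\ge 1\}$ is the spectrum of $T$; for every $m$ the root space $\bigcup_k\ker(T-\lambda_m)^k$ is finite-dimensional, and the vectors $\phi_n$ with $\lambda_n=\lambda_m$ form a basis of it (eigenvalues are repeated according to algebraic multiplicity); * for all sufficiently large $n$, $\Gamma_n$ lies in the resolvent set of $T$ and $$\phi_n=\frac1{2\pi i}\int_{\Gamma_n}(z-T)^{-1}\psi_n\,dz .$$ Then admissible root systems exist, and for every admissible root system both $\{\mu_n^{-1/2}\phi_n\}_{n\ge1}$ and $\{\|\phi_n\|_V^{-1}\phi_n\}_{n\ge1}$ are Riesz bases of the Hilbert space $(V,(\cdot,\cdot)_V)$, i.e. images of an orthonormal basis of $V$ under a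 bounded operator on $V$ with bounded inverse. -/

import Mathlib

open Filter Topology

open scoped ComplexConjugate

noncomputable section

/-- A densely defined, closed, Hermitian positive-definite sesquilinear form in the complex Hilbert
space `H`. Forms are linear in the first and antilinear in the second argument. Closedness is the
usual one: if `u n` is a sequence in the form domain that converges in `H` and is Cauchy with
respect to the form, then its limit is in the form domain and the convergence is also with respect
to the form. -/
structure EnergyForm (H : Type*) [NormedAddCommGroup H] [InnerProductSpace ℂ H] where
  /-- the form domain -/
  dom : Submodule ℂ H
  /-- the form `(u, v) ↦ a(u, v)` -/
  form : dom →ₗ[ℂ] dom →ₗ⋆[ℂ] ℂ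
  dense : Dense (dom : Set H)
  hermitian : ∀ u v, conj (form v u) = form u v
  pos : ∀ u, u ≠ 0 → 0 < (form u u).re
  closed : ∀ (u : ℕ → dom) (x : H), Tendsto (fun n => (u n : H)) atTop (𝓝 x) →
    (∀ ε > 0, ∃ N, ∀ m ≥ N, ∀ n ≥ N, (form (u m - u n) (u m - u n)).re < ε) →
    ∃ y : dom, (y : H) = x ∧ Tendsto (fun n => (form (u n - y) (u n - y)).re) atTop (𝓝 0)

namespace EnergyForm

variable {H : Type*} [NormedAddCommGroup H] [InnerProductSpace ℂ H] (a : EnergyForm H)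

/-- The energy space: the form domain with the energy inner product `(u, v)_V = a(u, v)`
(a type synonym, so that it does not carry the norm of `H`). -/
def V : Type _ := a.dom

instance : AddCommGroup a.V := inferInstanceAs (AddCommGroup a.dom)

instance : Module ℂ a.V := inferInstanceAs (Module ℂ a.dom)

/-- The inclusion of the energy space `V` into `H`. -/
def incl : a.V →ₗ[ℂ] H := a.dom.subtype

/-- The form `a`, as a sesquilinear form on `V`. -/
def energy : a.V →ₗ[ℂ] a.V →ₗ⋆[ℂ] ℂ := a.form

/-- Mathlib's inner product is linear in the second argument, so it is `⟪u, v⟫ = a(v, u)`. -/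
@[reducible]
def core : InnerProductSpace.Core ℂ a.V where
  inner u v := a.energy v u
  conj_inner_symm u v := a.hermitian v u
  re_inner_nonneg u := by
    by_cases h : u = 0
    · simp [h]
    · exact (a.pos u h).le
  add_left u v w := by simp
  smul_left u v r := by simp
  definite u h := by
    by_contra hu
    have := a.pos u hu
    have h' : a.form u u = 0 := h
    simp [h'] at this

instance : NormedAddCommGroup a.V := a.core.toNormedAddCommGroup

instance : InnerProductSpace ℂ a.V := InnerProductSpace.ofCore a.core.toCore

theorem inner_def (u v : a.V) : inner ℂ u v = a.energy v u := rfl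

theorem norm_sq_eq (u : a.V) : ‖u‖ ^ 2 = (a.energy u u).re := by
  rw [@norm_sq_eq_re_inner ℂ]; rfl

/-- The graph of the operator associated with a form `t` on `V`: all pairs `(u, w)` in `H × H`
with `u ∈ V` and `t(u, v) = (w, v)` for all `v ∈ V`. -/
def operatorGraph (t : a.V →ₗ[ℂ] a.V →ₗ⋆[ℂ] ℂ) : Submodule ℂ (H × H) where
  carrier := {p | ∃ u : a.V, a.incl u = p.1 ∧ ∀ v : a.V, t u v = inner ℂ (a.incl v) p.2}
  zero_mem' := ⟨0, by simp, by simp⟩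
  add_mem' := by
    rintro p q ⟨u, hu, hu'⟩ ⟨v, hv, hv'⟩
    exact ⟨u + v, by simp [hu, hv], fun w => by simp [hu', hv']⟩
  smul_mem' := by
    rintro c p ⟨u, hu, hu'⟩
    exact ⟨c • u, by simp [hu], fun w => by simp [hu']⟩

/-- The (unbounded) operator in `H` associated with a form `t` on `V`. -/
def operator (t : a.V →ₗ[ℂ] a.V →ₗ⋆[ℂ] ℂ) : H →ₗ.[ℂ] H := (a.operatorGraph t).toLinearPMap

theorem graph_operator (t : a.V →ₗ[ℂ] a.V →ₗ⋆[ℂ] ℂ) :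
    (a.operator t).graph = a.operatorGraph t := by
  refine Submodule.toLinearPMap_graph_eq _ ?_
  rintro ⟨x, w⟩ ⟨u, hu, hw⟩ hx
  have hx' : x = 0 := hx
  have hu0 : u = 0 := by
    apply Subtype.ext
    exact hu.trans hx
  refine a.dense.eq_zero_of_mem_orthogonal ?_
  intro v hv
  have h : t u (⟨v, hv⟩ : a.dom) = inner ℂ v w := hw ⟨v, hv⟩
  rw [hu0, map_zero] at h
  exact h.symm

end EnergyForm

variable {H : Type*} [NormedAddCommGroup H] [InnerProductSpace ℂ H]

/-- A sequence is a Riesz basis if it is the image of an orthonormal basis under a bounded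
operator with bounded inverse. -/
def IsRieszBasis {E : Type*} [NormedAddCommGroup E] [InnerProductSpace ℂ E] (f : ℕ → E) : Prop :=
  ∃ (e : HilbertBasis ℕ ℂ E) (S : E ≃L[ℂ] E), ∀ n, f n = S (e n)

namespace LinearPMap

/-- `R` is the bounded, everywhere defined inverse of `z - T`. -/
def IsResolventAt (T : H →ₗ.[ℂ] H) (z : ℂ) (R : H →L[ℂ] H) : Prop :=
  (∀ x : H, ∃ h : R x ∈ T.domain, z • R x - T ⟨R x, h⟩ = x) ∧
    ∀ u : T.domain, R (z • (u : H) - T u) = u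

/-- The resolvent set of an unbounded operator. -/
def resolventSet (T : H →ₗ.[ℂ] H) : Set ℂ := {z | ∃ R, T.IsResolventAt z R}

/-- The spectrum of an unbounded operator. -/
def spectrum (T : H →ₗ.[ℂ] H) : Set ℂ := (T.resolventSet)ᶜ

open Classical in
/-- The resolvent `(z - T)⁻¹` (and `0` for `z` in the spectrum). -/
def resolvent (T : H →ₗ.[ℂ] H) (z : ℂ) : H →L[ℂ] H :=
  if h : ∃ R, T.IsResolventAt z R then h.choose else 0

/-- The kernel of `(T - l) ^ k`, with the natural domain of `(T - l) ^ k`. -/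
def kerPow (T : H →ₗ.[ℂ] H) (l : ℂ) : ℕ → Submodule ℂ H
  | 0 => ⊥
  | k + 1 => ((kerPow T l k).comap (T.toFun - l • T.domain.subtype)).map T.domain.subtype

/-- The root space (generalized eigenspace) of `T` for `l`. -/
def rootSpace (T : H →ₗ.[ℂ] H) (l : ℂ) : Submodule ℂ H := ⨆ k, T.kerPow l k

/-- `(x, l)` is an eigenpair of `T` up to `x = 0`: `x` is in the domain of `T` and `T x = l x`. -/
def SolvesEigen (T : H →ₗ.[ℂ] H) (l : ℂ) (x : H) : Prop := ∃ h : x ∈ T.domain, T ⟨x, h⟩ = l • x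

/-- `l` enumerates the spectrum of `T`, every point of which is an eigenvalue of finite algebraic
multiplicity and is repeated according to that multiplicity, and the `x n` with `l n = z` form a
basis of the root space of each eigenvalue `z`. -/
structure IsRootSystem (T : H →ₗ.[ℂ] H) (l : ℕ → ℂ) (x : ℕ → H) : Prop where
  range_eq : Set.range l = T.spectrum
  finiteDimensional : ∀ m, FiniteDimensional ℂ (T.rootSpace (l m))
  linearIndependent : ∀ m, LinearIndependent ℂ (fun n : {n // l n = l m} => x n)
  span_eq : ∀ m, Submodule.span ℂ (x '' {n | l n = l m}) = T.rootSpace (l m)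

end LinearPMap

/-- The open rectangle `p < Re z < q`, `|Im z| < r`. -/
def rectangle (p q r : ℝ) : Set ℂ := {z | p < z.re ∧ z.re < q ∧ |z.im| < r}

/-- The integral of `f` along the boundary of `rectangle p q r`, counterclockwise: lower, right,
upper and left edge. -/
def rectangleIntegral (f : ℂ → H) (p q r : ℝ) : H :=
  (∫ x : ℝ in p..q, f (x - r * Complex.I)) + Complex.I • (∫ y : ℝ in (-r)..r, f (q + y * Complex.I))
    - (∫ x : ℝ in p..q, f (x + r * Complex.I))
    - Complex.I • (∫ y : ℝ in (-r)..r, f (p + y * Complex.I))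

/-- The Riesz projection `(2πi)⁻¹ ∮ (z - T)⁻¹ x dz` over the boundary of `rectangle p q r`, applied
to `x`. -/
def rieszProjection (T : H →ₗ.[ℂ] H) (p q r : ℝ) (x : H) : H :=
  (2 * Real.pi * Complex.I)⁻¹ • rectangleIntegral (fun z => T.resolvent z x) p q r

/-- For all large `n`, `φ n` is the Riesz projection of `T` applied to `ψ n`, for the rectangle
around `μ n` whose horizontal extent is `κ / 2` times the bound `k ^ (γ - 1)` of the adjacent gaps;
the boundary of that rectangle does not meet the spectrum. Sequences are indexed from `0`: the
entry `n` of the code is the entry `k = n + 1` in a numbering from `1`. -/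
def EventuallyRieszProjected (T : H →ₗ.[ℂ] H) (μ : ℕ → ℝ) (γ κ : ℝ) (ψ φ : ℕ → H) : Prop :=
  ∃ N : ℕ, ∀ n ≥ N,
    frontier (rectangle (μ n - κ / 2 * (n : ℝ) ^ (γ - 1))
        (μ n + κ / 2 * ((n : ℝ) + 1) ^ (γ - 1)) (κ / 2 * ((n : ℝ) + 1) ^ (γ - 1)))
      ⊆ T.resolventSet ∧
    φ n = rieszProjection T (μ n - κ / 2 * (n : ℝ) ^ (γ - 1))
        (μ n + κ / 2 * ((n : ℝ) + 1) ^ (γ - 1)) (κ / 2 * ((n : ℝ) + 1) ^ (γ - 1)) (ψ n)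

/-- `φ` is a system of root vectors of `T`, with eigenvalues `l`, numbered and scaled such that for
all large `n` the vector `φ n` is the Riesz projection of `ψ n`. The finitely many other `φ n` may
be arbitrary bases of the remaining root spaces. -/
def IsPerturbedRootSystem (T : H →ₗ.[ℂ] H) (μ : ℕ → ℝ) (γ κ : ℝ) (ψ : ℕ → H) (l : ℕ → ℂ)
    (φ : ℕ → H) : Prop :=
  T.IsRootSystem l φ ∧ EventuallyRieszProjected T μ γ κ ψ φ

end

/-! The problem is moved to the energy space, where `e n = μ_n^{-1/2} ψ_n` is an orthonormal basis.
There `a + b` is represented by `1 + K`, and `z - T` becomes the pencil `1 + K - z J`, up to sign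
and the embedding `ι`, with `J = ι* ι` diagonal with entries `1/μ_n`. Subordination says that the
matrix of `K` is bounded by `M w_m w_n` with `w_n = p_n/√μ_n`, where `p_n = n^{-α}` in the numbering
from 1. The separation hypothesis gives `|μ_m - μ_n| ≥ c |m - n| max(m, n)^{γ-1}` for a large larger
index, and with `2α + γ > 1` the sums `∑_{n ≠ m} p_n² / |μ_m - μ_n|` become uniformly small
(`tsum_div_gap_le`). All later smallness rests on this and on `p_n²` being small relative to the
width of the rectangle.

For large `n` and `z` in the closed rectangle, all coordinate equations except the `n`-th can be
solved with `n`-th coordinate 1; the solution `u(z)` is analytic (`exists_solution`). The remaining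
equation is scalar, `F(z) = z - μ_n - G(z) = 0`, where `G` is `O(p_n²)`. A contraction argument
gives exactly one zero, and it is simple (`exists_localEigen`). The residue theorem then identifies
the Riesz projection of `ψ_n` as `√μ_n F'(l)⁻¹ ι(u(l))`, where `|F'(l)|` lies between 3/4 and 5/4.

The coordinates of `u(l)` are dominated by kernels to which Schur's test applies. Hence the tail
`u_n` is a small perturbation of `e` in `V`, and `√μ_n ι u_n` of `ψ` in `H`. The same holds for the
adjoint pencil, whose solutions are left eigenvectors of `T`.

Existence: the left eigenvectors with index at least `N` have a common kernel of dimension exactly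
`N`. It is invariant under the resolvent, so its generalized eigenvectors fill precisely the missing
places.

Basis property: a small perturbation of a basis on the tail, altered in finitely many places, is the
image of the basis under an invertible operator plus a finite-rank one. By the Fredholm alternative
injectivity suffices. Pairing a vanishing series with left eigenvectors kills all late coefficients,
and linear independence of root vectors kills the rest. -/

open scoped ENNReal

/-! ### Schur's test -/

/-- The matrix `k` with nonnegative entries is bounded on `ℓ²`, with squared norm at most `B`. -/
def KernelBound (k : ℕ → ℕ → ℝ≥0∞) (B : ℝ≥0∞) : Prop :=
  ∀ x : ℕ → ℝ≥0∞, ∑' m, (∑' n, k m n * x n) ^ 2 ≤ B * ∑' n, x n ^ 2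

theorem ENNReal.two_mul_mul_le_sq_add_sq (a b : ℝ≥0∞) : 2 * (a * b) ≤ a ^ 2 + b ^ 2 := by
  wlog h : a ≤ b generalizing a b
  · rw [mul_comm a b, add_comm]
    exact this b a (le_of_not_ge h)
  · obtain ⟨c, rfl⟩ := exists_add_of_le h
    calc 2 * (a * (a + c)) ≤ 2 * (a * (a + c)) + c ^ 2 := le_self_add
      _ = a ^ 2 + (a + c) ^ 2 := by ring

theorem ENNReal.add_sq_le_two_mul (a b : ℝ≥0∞) : (a + b) ^ 2 ≤ 2 * (a ^ 2 + b ^ 2) := by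
  calc (a + b) ^ 2 = a ^ 2 + b ^ 2 + 2 * (a * b) := by ring
    _ ≤ a ^ 2 + b ^ 2 + (a ^ 2 + b ^ 2) := by
      gcongr; exact ENNReal.two_mul_mul_le_sq_add_sq a b
    _ = 2 * (a ^ 2 + b ^ 2) := by ring

/-- The Cauchy-Schwarz inequality with weights. -/
theorem ENNReal.sq_tsum_mul_le (w u : ℕ → ℝ≥0∞) :
    (∑' n, w n * u n) ^ 2 ≤ (∑' n, w n) * ∑' n, w n * u n ^ 2 := by
  have hprod : ∀ f g : ℕ → ℝ≥0∞, (∑' n, f n) * ∑' n, g n = ∑' i, ∑' j, f i * g j := by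
    intro f g
    rw [← ENNReal.tsum_mul_right]
    exact tsum_congr fun i => ENNReal.tsum_mul_left.symm
  -- Expanding the square as a double sum and using `2 u_i u_j ≤ u_i² + u_j²` avoids square roots
  -- and subtraction in `ℝ≥0∞`; the factor 2 is cancelled at the end.
  have h : 2 * (∑' n, w n * u n) ^ 2 ≤ 2 * ((∑' n, w n) * ∑' n, w n * u n ^ 2) := by
    calc 2 * (∑' n, w n * u n) ^ 2
        = ∑' i, ∑' j, w i * w j * (2 * (u i * u j)) := by
          rw [sq, hprod, ← ENNReal.tsum_mul_left]
          refine tsum_congr fun i => ?_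
          rw [← ENNReal.tsum_mul_left]
          exact tsum_congr fun j => by ring
      _ ≤ ∑' i, ∑' j, (w j * (w i * u i ^ 2) + w i * (w j * u j ^ 2)) := by
          refine ENNReal.tsum_le_tsum fun i => ENNReal.tsum_le_tsum fun j => ?_
          calc w i * w j * (2 * (u i * u j)) ≤ w i * w j * (u i ^ 2 + u j ^ 2) := by
                gcongr; exact ENNReal.two_mul_mul_le_sq_add_sq _ _
            _ = _ := by ring
      _ = 2 * ((∑' n, w n) * ∑' n, w n * u n ^ 2) := by
          simp_rw [ENNReal.tsum_add]
          rw [← hprod, ENNReal.tsum_comm, ← hprod]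
          ring
  exact (ENNReal.mul_le_mul_iff_right two_ne_zero ENNReal.ofNat_ne_top).1 h

/-- Schur's test. -/
theorem KernelBound.of_weight {k : ℕ → ℕ → ℝ≥0∞} {p : ℕ → ℝ≥0∞} {A B : ℝ≥0∞}
    (hp0 : ∀ n, p n ≠ 0) (hp : ∀ n, p n ≠ ⊤)
    (hrow : ∀ m, ∑' n, k m n * p n ≤ A * p m) (hcol : ∀ n, ∑' m, k m n * p m ≤ B * p n) :
    KernelBound k (A * B) := by
  intro x
  calc ∑' m, (∑' n, k m n * x n) ^ 2
      ≤ ∑' m, A * p m * ∑' n, k m n * p n * (x n / p n) ^ 2 := by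
        refine ENNReal.tsum_le_tsum fun m => ?_
        have := ENNReal.sq_tsum_mul_le (fun n => k m n * p n) (fun n => x n / p n)
        have h2 : ∀ n, k m n * p n * (x n / p n) = k m n * x n := fun n => by
          rw [mul_assoc, ENNReal.mul_div_cancel (hp0 n) (hp n)]
        simp only [h2] at this
        exact this.trans (mul_le_mul_left (hrow m) _)
    _ = A * ∑' n, (p n * (x n / p n) ^ 2) * ∑' m, k m n * p m := by
        rw [← ENNReal.tsum_mul_left]
        simp_rw [← ENNReal.tsum_mul_left]
        rw [ENNReal.tsum_comm]
        exact tsum_congr fun n => tsum_congr fun m => by ring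
    _ ≤ A * ∑' n, (p n * (x n / p n) ^ 2) * (B * p n) := by
        gcongr with n
        exact hcol n
    _ = A * B * ∑' n, x n ^ 2 := by
        rw [mul_assoc, ← ENNReal.tsum_mul_left (a := B)]
        congr 1
        refine tsum_congr fun n => ?_
        calc p n * (x n / p n) ^ 2 * (B * p n) = B * (p n * (x n / p n)) ^ 2 := by ring
          _ = _ := by rw [ENNReal.mul_div_cancel (hp0 n) (hp n)]

theorem KernelBound.mono {k k' : ℕ → ℕ → ℝ≥0∞} {B B' : ℝ≥0∞} (h : KernelBound k B)
    (hk : ∀ m n, k' m n ≤ k m n) (hB : B ≤ B') : KernelBound k' B' := fun x =>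
  calc ∑' m, (∑' n, k' m n * x n) ^ 2 ≤ ∑' m, (∑' n, k m n * x n) ^ 2 := by
        gcongr with m n; exact hk m n
    _ ≤ B * ∑' n, x n ^ 2 := h x
    _ ≤ B' * ∑' n, x n ^ 2 := by gcongr

theorem KernelBound.add {k k' : ℕ → ℕ → ℝ≥0∞} {B B' : ℝ≥0∞} (h : KernelBound k B)
    (h' : KernelBound k' B') : KernelBound (fun m n => k m n + k' m n) (2 * (B + B')) := fun x =>
  calc ∑' m, (∑' n, (k m n + k' m n) * x n) ^ 2
      = ∑' m, (∑' n, k m n * x n + ∑' n, k' m n * x n) ^ 2 := by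
        simp_rw [add_mul, ENNReal.tsum_add]
    _ ≤ ∑' m, 2 * ((∑' n, k m n * x n) ^ 2 + (∑' n, k' m n * x n) ^ 2) :=
        ENNReal.tsum_le_tsum fun m => ENNReal.add_sq_le_two_mul _ _
    _ = 2 * (∑' m, (∑' n, k m n * x n) ^ 2 + ∑' m, (∑' n, k' m n * x n) ^ 2) := by
        rw [ENNReal.tsum_mul_left, ENNReal.tsum_add]
    _ ≤ 2 * (B * ∑' n, x n ^ 2 + B' * ∑' n, x n ^ 2) := by gcongr; exacts [h x, h' x]
    _ = 2 * (B + B') * ∑' n, x n ^ 2 := by ring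

theorem KernelBound.const_mul {k : ℕ → ℕ → ℝ≥0∞} {B : ℝ≥0∞} (h : KernelBound k B) (c : ℝ≥0∞) :
    KernelBound (fun m n => c * k m n) (c ^ 2 * B) := fun x =>
  calc ∑' m, (∑' n, c * k m n * x n) ^ 2 = c ^ 2 * ∑' m, (∑' n, k m n * x n) ^ 2 := by
        simp_rw [mul_assoc, ENNReal.tsum_mul_left, mul_pow, ENNReal.tsum_mul_left]
    _ ≤ c ^ 2 * (B * ∑' n, x n ^ 2) := by gcongr; exact h x
    _ = c ^ 2 * B * ∑' n, x n ^ 2 := by ring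

/-! ### Matrices in a Hilbert basis, compact perturbations and Riesz bases -/

section HilbertSpace

variable {E : Type*} [NormedAddCommGroup E] [InnerProductSpace ℂ E]

theorem HilbertBasis.hasSum_norm_inner_sq (e : HilbertBasis ℕ ℂ E) (x : E) :
    HasSum (fun m => ‖inner ℂ (e m) x‖ ^ 2) (‖x‖ ^ 2) := by
  have h := Complex.hasSum_re (e.hasSum_inner_mul_inner x x)
  convert! h using 1
  · ext m
    rw [← inner_conj_symm x (e m), Complex.conj_mul']
    norm_cast
  · rw [@norm_sq_eq_re_inner ℂ]; rfl

theorem HilbertBasis.tsum_enorm_inner_sq (e : HilbertBasis ℕ ℂ E) (x : E) :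
    ∑' m, ‖inner ℂ (e m) x‖ₑ ^ 2 = ‖x‖ₑ ^ 2 := by
  have h1 := e.hasSum_norm_inner_sq x
  have h3 := ENNReal.ofReal_tsum_of_nonneg (fun m => sq_nonneg ‖inner ℂ (e m) x‖) h1.summable
  rw [h1.tsum_eq] at h3
  simp only [← ofReal_norm, ← ENNReal.ofReal_pow (norm_nonneg _)]
  exact h3.symm

theorem HilbertBasis.hasSum_inner_smul (e : HilbertBasis ℕ ℂ E) (x : E) :
    HasSum (fun n => inner ℂ (e n) x • e n) x := by
  simpa only [HilbertBasis.repr_apply_apply] using e.hasSum_repr x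

theorem HilbertBasis.ext_inner (e : HilbertBasis ℕ ℂ E) {x y : E}
    (h : ∀ n, inner ℂ (e n) x = inner ℂ (e n) y) : x = y := by
  have hx := e.hasSum_inner_smul x
  simp only [h] at hx
  exact hx.unique (e.hasSum_inner_smul y)

theorem HilbertBasis.inner_eq_ite (e : HilbertBasis ℕ ℂ E) (m n : ℕ) :
    inner ℂ (e m) (e n) = if m = n then (1 : ℂ) else 0 :=
  orthonormal_iff_ite.1 e.orthonormal m n

/-- A family with entries dominated by a bounded kernel defines a bounded operator. -/
theorem HilbertBasis.exists_operator [CompleteSpace E] (e : HilbertBasis ℕ ℂ E) {g : ℕ → E}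
    {k : ℕ → ℕ → ℝ≥0∞} {B : ℝ≥0∞} (hk : KernelBound k B) (hB : B ≠ ⊤)
    (hg : ∀ m n, ‖inner ℂ (e m) (g n)‖ₑ ≤ k m n) :
    ∃ C : E →L[ℂ] E, (∀ n, C (e n) = g n) ∧ ∀ x, ‖C x‖ₑ ^ 2 ≤ B * ‖x‖ₑ ^ 2 := by
  -- The kernel bound applied to coefficients extended by zero. This single estimate makes the
  -- defining series Cauchy and, in the limit, bounds the operator.
  have hfin : ∀ (F : Finset ℕ) (c : ℕ → ℂ),
      ‖∑ n ∈ F, c n • g n‖ₑ ^ 2 ≤ B * ∑ n ∈ F, ‖c n‖ₑ ^ 2 := by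
    intro F c
    have h1 := hk (fun n => if n ∈ F then ‖c n‖ₑ else 0)
    have h2 : ∀ f : ℕ → ℝ≥0∞, ∑' n, f n * (if n ∈ F then ‖c n‖ₑ else 0)
        = ∑ n ∈ F, f n * ‖c n‖ₑ := by
      intro f
      rw [tsum_eq_sum (s := F) (by intro n hn; simp [hn])]
      exact Finset.sum_congr rfl fun n hn => by simp [hn]
    have h3 : ∑' n, (if n ∈ F then ‖c n‖ₑ else 0) ^ 2 = ∑ n ∈ F, ‖c n‖ₑ ^ 2 := by
      rw [tsum_eq_sum (s := F) (by intro n hn; simp [hn])]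
      exact Finset.sum_congr rfl fun n hn => by simp [hn]
    simp only [h2, h3] at h1
    refine le_trans ?_ h1
    rw [← e.tsum_enorm_inner_sq]
    refine ENNReal.tsum_le_tsum fun m => pow_le_pow_left₀ zero_le ?_ 2
    rw [inner_sum]
    refine (enorm_sum_le _ _).trans (Finset.sum_le_sum fun n _ => ?_)
    rw [inner_smul_right, enorm_mul, mul_comm]
    gcongr
    exact hg m n
  have hsum : ∀ x : E, Summable fun n => inner ℂ (e n) x • g n := by
    intro x
    have hx : Summable fun n => ‖inner ℂ (e n) x‖ ^ 2 := e.orthonormal.inner_products_summable x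
    rw [summable_iff_vanishing_norm]
    intro ε hε
    obtain ⟨s, hs⟩ := summable_iff_vanishing_norm.1 hx (ε ^ 2 / (B.toReal + 1)) (by positivity)
    refine ⟨s, fun t ht => ?_⟩
    have h1 := hfin t fun n => inner ℂ (e n) x
    have h2 : ‖∑ n ∈ t, inner ℂ (e n) x • g n‖ ^ 2
        ≤ B.toReal * ∑ n ∈ t, ‖inner ℂ (e n) x‖ ^ 2 := by
      have h3 := ENNReal.toReal_mono (by
        refine ENNReal.mul_ne_top hB (ENNReal.sum_ne_top.2 fun n _ => ?_)
        exact ENNReal.pow_ne_top enorm_ne_top) h1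
      rw [ENNReal.toReal_mul, ENNReal.toReal_sum (fun n _ => ENNReal.pow_ne_top enorm_ne_top)] at h3
      simpa using h3
    have h4 := hs t ht
    rw [Real.norm_of_nonneg (Finset.sum_nonneg fun n _ => sq_nonneg _)] at h4
    have hb : 0 ≤ B.toReal := ENNReal.toReal_nonneg
    have h5 : ‖∑ n ∈ t, inner ℂ (e n) x • g n‖ ^ 2 < ε ^ 2 := by
      calc _ ≤ B.toReal * ∑ n ∈ t, ‖inner ℂ (e n) x‖ ^ 2 := h2
        _ ≤ B.toReal * (ε ^ 2 / (B.toReal + 1)) := by gcongr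
        _ < ε ^ 2 := by
          rw [mul_div_assoc', div_lt_iff₀ (by positivity)]
          nlinarith [sq_pos_of_pos hε]
    exact lt_of_pow_lt_pow_left₀ 2 hε.le h5
  have hbound : ∀ x : E, ‖∑' n, inner ℂ (e n) x • g n‖ₑ ^ 2 ≤ B * ‖x‖ₑ ^ 2 := by
    intro x
    have h1 := ((ENNReal.continuous_pow 2).tendsto _).comp (hsum x).hasSum.enorm
    refine le_of_tendsto h1 (Eventually.of_forall fun F => ?_)
    refine (hfin F _).trans ?_
    gcongr
    rw [← e.tsum_enorm_inner_sq]
    exact ENNReal.sum_le_tsum F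
  let C₀ : E →ₗ[ℂ] E :=
    { toFun := fun x => ∑' n, inner ℂ (e n) x • g n
      map_add' := fun x y => by
        rw [← (hsum x).tsum_add (hsum y)]
        simp only [inner_add_right, add_smul]
      map_smul' := fun c x => by
        rw [RingHom.id_apply, ← (hsum x).tsum_const_smul c]
        simp only [inner_smul_right, mul_smul] }
  refine ⟨C₀.mkContinuous (Real.sqrt B.toReal) fun x => ?_, fun n => ?_, hbound⟩
  · have h3 := ENNReal.toReal_mono
      (ENNReal.mul_ne_top hB (ENNReal.pow_ne_top enorm_ne_top)) (hbound x)
    simp only [ENNReal.toReal_pow, ENNReal.toReal_mul, toReal_enorm] at h3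
    refine le_of_sq_le_sq ?_ (by positivity)
    rw [mul_pow, Real.sq_sqrt ENNReal.toReal_nonneg]
    exact h3
  · change ∑' i, inner ℂ (e i) (e n) • g i = g n
    simp only [e.inner_eq_ite]
    rw [tsum_eq_single n (by intro i hi; simp [hi])]
    simp

theorem HilbertBasis.enorm_apply_sq_le (e : HilbertBasis ℕ ℂ E) (T : E →L[ℂ] E)
    {k : ℕ → ℕ → ℝ≥0∞} {B : ℝ≥0∞} (hk : KernelBound k B)
    (hT : ∀ m n, ‖inner ℂ (e m) (T (e n))‖ₑ ≤ k m n) (x : E) : ‖T x‖ₑ ^ 2 ≤ B * ‖x‖ₑ ^ 2 := by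
  rw [← e.tsum_enorm_inner_sq x, ← e.tsum_enorm_inner_sq (T x)]
  refine le_trans ?_ (hk fun n => ‖inner ℂ (e n) x‖ₑ)
  refine ENNReal.tsum_le_tsum fun m => pow_le_pow_left₀ zero_le ?_ 2
  have h : HasSum (fun n => inner ℂ (e m) (T (e n)) * inner ℂ (e n) x) (inner ℂ (e m) (T x)) := by
    have := ((e.hasSum_inner_smul x).mapL ((innerSL ℂ (e m)).comp T))
    simpa [inner_smul_right, mul_comm] using this
  refine (tsum_of_enorm_bounded (f := fun n => inner ℂ (e m) (T (e n)) * inner ℂ (e n) x)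
    ENNReal.summable.hasSum fun n => ?_).trans' (by rw [h.tsum_eq])
  rw [enorm_mul]
  gcongr
  exact hT m n

theorem opNorm_le_of_enorm_sq_le {T : E →L[ℂ] E} {r : ℝ} (hr : 0 ≤ r)
    (h : ∀ x, ‖T x‖ₑ ^ 2 ≤ ENNReal.ofReal (r ^ 2) * ‖x‖ₑ ^ 2) : ‖T‖ ≤ r := by
  refine T.opNorm_le_bound hr fun x => ?_
  have h3 := ENNReal.toReal_mono
    (ENNReal.mul_ne_top ENNReal.ofReal_ne_top (ENNReal.pow_ne_top enorm_ne_top)) (h x)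
  simp only [ENNReal.toReal_pow, ENNReal.toReal_mul, toReal_enorm,
    ENNReal.toReal_ofReal (sq_nonneg r)] at h3
  refine le_of_sq_le_sq ?_ (by positivity)
  rwa [mul_pow]

end HilbertSpace

theorem KernelBound.diagonal {d : ℕ → ℝ≥0∞} {R : ℝ≥0∞} (hd : ∀ n, d n ≤ R) :
    KernelBound (fun m n => if m = n then d n else 0) (R * R) := by
  refine KernelBound.of_weight (p := fun _ => 1) (by simp) (by simp) (fun m => ?_) (fun n => ?_)
  · rw [tsum_eq_single m (by intro n hn; simp [hn.symm])]
    simpa using hd m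
  · rw [tsum_eq_single n (by intro m hm; simp [hm])]
    simpa using hd n

section HilbertSpace

variable {E : Type*} [NormedAddCommGroup E] [InnerProductSpace ℂ E]

theorem isCompactOperator_rankOne (u v : E) :
    IsCompactOperator ((innerSL ℂ u).smulRight v : E →L[ℂ] E) := by
  have h : IsCompactOperator ((1 : ℂ →L[ℂ] ℂ).smulRight v) :=
    isCompactOperator_of_locallyCompactSpace_rng ((1 : ℂ →L[ℂ] ℂ).smulRight v)
  have := h.comp_clm (innerSL ℂ u)
  convert! this using 1

theorem isCompactOperator_sum {ι : Type*} (s : Finset ι) (T : ι → E →L[ℂ] E)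
    (h : ∀ i ∈ s, IsCompactOperator (T i)) : IsCompactOperator (∑ i ∈ s, T i : E →L[ℂ] E) := by
  classical
  induction s using Finset.induction_on with
  | empty => simpa using! (isCompactOperator_zero : IsCompactOperator (0 : E → E))
  | insert i s hi ih =>
    rw [Finset.sum_insert hi]
    exact (h i (Finset.mem_insert_self i s)).add
      (ih fun j hj => h j (Finset.mem_insert_of_mem hj))

/-- The projection onto the first `N` vectors of a basis. -/
noncomputable def HilbertBasis.head (e : HilbertBasis ℕ ℂ E) (N : ℕ) : E →L[ℂ] E :=
  ∑ n ∈ Finset.range N, (innerSL ℂ (e n)).smulRight (e n)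

theorem HilbertBasis.head_apply (e : HilbertBasis ℕ ℂ E) (N : ℕ) (x : E) :
    e.head N x = ∑ n ∈ Finset.range N, inner ℂ (e n) x • e n := by
  simp [HilbertBasis.head]

theorem HilbertBasis.isCompactOperator_head (e : HilbertBasis ℕ ℂ E) (N : ℕ) :
    IsCompactOperator (e.head N) :=
  isCompactOperator_sum _ _ fun _ _ => isCompactOperator_rankOne _ _

theorem HilbertBasis.head_self (e : HilbertBasis ℕ ℂ E) (N n : ℕ) :
    e.head N (e n) = if n < N then e n else 0 := by
  rw [e.head_apply]
  simp only [e.inner_eq_ite, ite_smul, one_smul, zero_smul]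
  simp

theorem HilbertBasis.inner_head (e : HilbertBasis ℕ ℂ E) (N n : ℕ) (x : E) :
    inner ℂ (e n) (e.head N x) = if n < N then inner ℂ (e n) x else 0 := by
  rw [e.head_apply, inner_sum]
  simp only [inner_smul_right, e.inner_eq_ite, mul_ite, mul_one, mul_zero]
  simp

/-- With `P` the projection onto the first `N` basis vectors and `Q = 1 - P`, the difference `T -
QTQ = PT + QTP` is compact, and the tail block `QTQ` is small in norm. So `T` is a norm limit of
compact operators. -/
theorem HilbertBasis.isCompactOperator_of_kernel [CompleteSpace E] (e : HilbertBasis ℕ ℂ E)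
    (T : E →L[ℂ] E) {k : ℕ → ℕ → ℝ≥0∞} (hT : ∀ m n, ‖inner ℂ (e m) (T (e n))‖ₑ ≤ k m n)
    (hk : ∀ ε : ℝ, 0 < ε → ∃ N, KernelBound (fun m n => if N ≤ m ∧ N ≤ n then k m n else 0)
      (ENNReal.ofReal ε)) : IsCompactOperator T := by
  have hcl : IsClosed {f : E →L[ℂ] E | IsCompactOperator f} :=
    isClosed_setOfPred_isCompactOperator
  refine hcl.closure_subset (Metric.mem_closure_iff.2 fun ε hε => ?_)
  obtain ⟨N, hN⟩ := hk ((ε / 2) ^ 2) (by positivity)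
  set P := e.head N with hP
  set Q : E →L[ℂ] E := 1 - P with hQ
  have hPc := e.isCompactOperator_head N
  refine ⟨T - Q * T * Q, ?_, ?_⟩
  · have h : T - Q * T * Q = P * T + Q * T * P := by rw [hQ]; noncomm_ring
    change IsCompactOperator (T - Q * T * Q : E →L[ℂ] E)
    rw [h]
    exact (hPc.comp_clm T).add (hPc.clm_comp (Q * T))
  · rw [dist_eq_norm, sub_sub_cancel]
    refine lt_of_le_of_lt (opNorm_le_of_enorm_sq_le (half_pos hε).le
      (e.enorm_apply_sq_le _ hN fun m n => ?_)) (half_lt_self hε)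
    have hQn : Q (e n) = if N ≤ n then e n else 0 := by
      rw [hQ, sub_apply, e.head_self]
      by_cases h : N ≤ n <;> simp [h, not_lt.2, not_le.1]
    have hQi : ∀ y, inner ℂ (e m) (Q y) = if N ≤ m then inner ℂ (e m) y else 0 := by
      intro y
      rw [hQ, sub_apply, inner_sub_right, e.inner_head]
      by_cases h : N ≤ m
      · simp [h]
      · simp [h, not_le.1 h]
    change ‖inner ℂ (e m) (Q (T (Q (e n))))‖ₑ ≤ _
    rw [hQi, hQn]
    by_cases hm : N ≤ m <;> by_cases hn : N ≤ n <;> simp [hm, hn, hT m n]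

/-- The Fredholm alternative at the point `-1`. Every later invertibility claim that does not come
from a small norm reduces to injectivity through this. -/
theorem isUnit_one_add_of_isCompactOperator [CompleteSpace E] {C : E →L[ℂ] E}
    (hC : IsCompactOperator C) (hinj : ∀ x, x + C x = 0 → x = 0) : IsUnit (1 + C) := by
  rcases hC.hasEigenvalue_or_mem_resolventSet (μ := (-1 : ℂ)) (by simp) with h | h
  · obtain ⟨v, hv⟩ := h.exists_hasEigenvector
    refine absurd (hinj v ?_) hv.2
    have : C v = (-1 : ℂ) • v := hv.apply_eq_smul
    rw [this]; simp
  · rw [spectrum.mem_resolventSet_iff, ← IsUnit.neg_iff] at h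
    convert! h using 1
    simp [add_comm]

theorem isUnit_one_add_of_norm_lt_one [CompleteSpace E] {C : E →L[ℂ] E} (hC : ‖C‖ < 1) :
    IsUnit (1 + C) := by
  have := isUnit_one_sub_of_norm_lt_one (x := -C) (by simpa using hC)
  simpa using this

theorem IsRieszBasis.of_isUnit {f : ℕ → E} (e : HilbertBasis ℕ ℂ E) {S : E →L[ℂ] E}
    (hS : IsUnit S) (h : ∀ n, f n = S (e n)) : IsRieszBasis f := by
  obtain ⟨u, rfl⟩ := hS
  exact ⟨e, ContinuousLinearEquiv.ofUnit u, h⟩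

theorem IsRieszBasis.exists_isUnit {f : ℕ → E} (h : IsRieszBasis f) :
    ∃ (e : HilbertBasis ℕ ℂ E) (S : E →L[ℂ] E), IsUnit S ∧ ∀ n, f n = S (e n) := by
  obtain ⟨e, S, h⟩ := h
  exact ⟨e, S, ⟨ContinuousLinearEquiv.toUnit S, rfl⟩, h⟩

/-- A family that agrees from some index on with a small perturbation of an orthonormal basis, and
satisfies no nontrivial linear relation with infinitely many terms, is a Riesz basis. -/
theorem HilbertBasis.isRieszBasis_of_tail [CompleteSpace E] (e : HilbertBasis ℕ ℂ E)
    {C : E →L[ℂ] E} (hC : ‖C‖ < 1) {N : ℕ} {f : ℕ → E} (hf : ∀ n ≥ N, f n = e n + C (e n))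
    (hinj : ∀ c : ℕ → ℂ, HasSum (fun n => c n • f n) 0 → ∀ n, c n = 0) : IsRieszBasis f := by
  obtain ⟨U, hU⟩ := isUnit_one_add_of_norm_lt_one hC
  -- Finite-rank correction at the first `N` vectors, chosen so that `1 + C + F` maps `e n` to `f n`
  -- for every `n`.
  set F : E →L[ℂ] E :=
    ∑ n ∈ Finset.range N, (innerSL ℂ (e n)).smulRight (f n - (e n + C (e n))) with hF
  have hFc : IsCompactOperator F :=
    isCompactOperator_sum _ _ fun _ _ => isCompactOperator_rankOne _ _
  have hFe : ∀ n, F (e n) = f n - (e n + C (e n)) := by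
    intro n
    have : F (e n) = if n < N then f n - (e n + C (e n)) else 0 := by
      simp [hF, e.inner_eq_ite]
    rw [this]
    split_ifs with h
    · rfl
    · rw [hf n (not_lt.1 h), sub_self]
  set S : E →L[ℂ] E := 1 + C + F with hS
  have hSe : ∀ n, f n = S (e n) := by
    intro n
    simp [hS, hFe n]
  -- Dividing by the invertible `1 + C` leaves identity plus compact, so only injectivity of `S` is
  -- needed; a kernel vector of `S` is a vanishing series in the `f n`.
  have hS1 : S = U * (1 + ↑U⁻¹ * F) := by
    rw [mul_add, mul_one, ← mul_assoc, U.mul_inv, one_mul, hU]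
  refine IsRieszBasis.of_isUnit e (S := S) ?_ hSe
  rw [hS1]
  refine U.isUnit.mul (isUnit_one_add_of_isCompactOperator
    (hFc.clm_comp (↑U⁻¹ : E →L[ℂ] E)) fun x hx => ?_)
  have hSx : S x = 0 := by
    rw [hS1]
    change (U : E →L[ℂ] E) (x + (↑U⁻¹ : E →L[ℂ] E) (F x)) = 0
    rw [show x + (↑U⁻¹ : E →L[ℂ] E) (F x) = 0 from hx, map_zero]
  have h1 := (e.hasSum_inner_smul x).mapL S
  simp only [map_smul, ← hSe, hSx] at h1
  refine e.ext_inner fun n => ?_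
  rw [hinj _ h1 n, inner_zero_right]

theorem HilbertBasis.isUnit_diagonal [CompleteSpace E] (e : HilbertBasis ℕ ℂ E) {c : ℕ → ℂ}
    {r R : ℝ} (hr : 0 < r) (h1 : ∀ n, r ≤ ‖c n‖) (h2 : ∀ n, ‖c n‖ ≤ R) :
    ∃ D : E →L[ℂ] E, IsUnit D ∧ ∀ n, D (e n) = c n • e n := by
  have key : ∀ (d : ℕ → ℂ) (R : ℝ), (∀ n, ‖d n‖ ≤ R) →
      ∃ D : E →L[ℂ] E, ∀ n, D (e n) = d n • e n := by
    intro d R hd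
    obtain ⟨D, hD, -⟩ := e.exists_operator (g := fun n => d n • e n)
      (KernelBound.diagonal (d := fun n => ‖d n‖ₑ) (R := ENNReal.ofReal R)
        fun n => by rw [← ofReal_norm]; exact ENNReal.ofReal_le_ofReal (hd n))
      (by finiteness) (fun m n => by
        rw [inner_smul_right, e.inner_eq_ite]
        by_cases h : m = n <;> simp [h])
    exact ⟨D, hD⟩
  have hc : ∀ n, c n ≠ 0 := fun n => norm_pos_iff.1 (hr.trans_le (h1 n))
  obtain ⟨D, hD⟩ := key c R h2
  obtain ⟨D', hD'⟩ := key (fun n => (c n)⁻¹) r⁻¹ fun n => by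
    rw [norm_inv]; exact inv_anti₀ hr (h1 n)
  have hext : ∀ T : E →L[ℂ] E, (∀ n, T (e n) = e n) → T = 1 := by
    intro T hT
    ext x
    have h1 := (e.hasSum_inner_smul x).mapL T
    simp only [map_smul, hT] at h1
    exact h1.unique (e.hasSum_inner_smul x)
  refine ⟨D, ⟨⟨D, D', hext _ fun n => ?_, hext _ fun n => ?_⟩, rfl⟩, hD⟩
  · change D (D' (e n)) = e n
    rw [hD', map_smul, hD, smul_smul, inv_mul_cancel₀ (hc n), one_smul]
  · change D' (D (e n)) = e n
    rw [hD, map_smul, hD', smul_smul, mul_inv_cancel₀ (hc n), one_smul]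

theorem IsRieszBasis.smul [CompleteSpace E] {f : ℕ → E} (hf : IsRieszBasis f) {c : ℕ → ℂ}
    {r R : ℝ} (hr : 0 < r) (h1 : ∀ n, r ≤ ‖c n‖) (h2 : ∀ n, ‖c n‖ ≤ R) :
    IsRieszBasis fun n => c n • f n := by
  obtain ⟨e, S, hS, h⟩ := hf.exists_isUnit
  obtain ⟨D, hD, hDe⟩ := e.isUnit_diagonal hr h1 h2
  refine IsRieszBasis.of_isUnit e (hS.mul hD) fun n => ?_
  change _ = S (D (e n))
  rw [hDe, map_smul, h n]

theorem IsRieszBasis.norm_bounds {f : ℕ → E} (hf : IsRieszBasis f) :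
    ∃ r R : ℝ, 0 < r ∧ ∀ n, r ≤ ‖f n‖ ∧ ‖f n‖ ≤ R := by
  obtain ⟨e, S, h⟩ := hf
  have hnorm : ∀ n, ‖e n‖ = 1 := e.orthonormal.1
  refine ⟨(‖(S.symm : E →L[ℂ] E)‖ + 1)⁻¹, ‖(S : E →L[ℂ] E)‖, by positivity, fun n => ⟨?_, ?_⟩⟩
  · rw [inv_le_iff_one_le_mul₀ (by positivity), h n]
    have := (S.symm : E →L[ℂ] E).le_opNorm (S (e n))
    simp only [ContinuousLinearEquiv.coe_coe, ContinuousLinearEquiv.symm_apply_apply, hnorm] at this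
    nlinarith [norm_nonneg (S (e n))]
  · have := (S : E →L[ℂ] E).le_opNorm (e n)
    simpa [h n, hnorm] using this

/-- The norms of a Riesz basis are bounded above and away from zero, so normalizing is a diagonal
rescaling that is bounded in both directions. -/
theorem IsRieszBasis.normalize [CompleteSpace E] {f : ℕ → E} (hf : IsRieszBasis f) :
    IsRieszBasis fun n => ((‖f n‖⁻¹ : ℝ) : ℂ) • f n := by
  obtain ⟨r, R, hr, h⟩ := hf.norm_bounds
  have hR : 0 < R := hr.trans_le ((h 0).1.trans (h 0).2)
  refine hf.smul (r := R⁻¹) (R := r⁻¹) (inv_pos.2 hR) (fun n => ?_) fun n => ?_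
  · rw [Complex.norm_real, norm_inv, norm_norm]
    exact inv_anti₀ (hr.trans_le (h n).1) (h n).2
  · rw [Complex.norm_real, norm_inv, norm_norm]
    exact inv_anti₀ hr (h n).1

end HilbertSpace

/-! ### Sums over separated sequences -/

section Gap

/-- The exponent may have either sign because `γ - 1` may; the minimum covers both monotonicities.
-/
theorem exists_mul_rpow_le_rpow (s : ℝ) :
    ∃ c > 0, ∀ x y : ℝ, 0 < y → y / 2 ≤ x → x ≤ y → c * y ^ s ≤ x ^ s := by
  refine ⟨min 1 ((1 / 2) ^ s), by positivity, fun x y hy h1 h2 => ?_⟩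
  have hx : 0 < x := by linarith
  rcases le_total 0 s with hs | hs
  · calc min 1 ((1 / 2) ^ s) * y ^ s ≤ (1 / 2) ^ s * y ^ s := by gcongr; exact min_le_right _ _
      _ = (y / 2) ^ s := by rw [← Real.mul_rpow (by norm_num) hy.le]; ring_nf
      _ ≤ x ^ s := Real.rpow_le_rpow (by positivity) h1 hs
  · calc min 1 ((1 / 2) ^ s) * y ^ s ≤ 1 * y ^ s := by gcongr; exact min_le_left _ _
      _ = y ^ s := one_mul _
      _ ≤ x ^ s := Real.rpow_le_rpow_of_nonpos hx h2 hs

/-- Only the upper half of the interval is kept. There `i + 1` lies between `(b + 1)/2` and `b + 1`,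
so all its powers are comparable to that of `b + 1`. -/
theorem exists_mul_le_sum_rpow (s : ℝ) :
    ∃ c > 0, ∀ a b : ℕ, a ≤ b →
      c * ((b : ℝ) - a) * ((b : ℝ) + 1) ^ s ≤ ∑ i ∈ Finset.Ico a b, ((i : ℝ) + 1) ^ s := by
  obtain ⟨c, hc, h⟩ := exists_mul_rpow_le_rpow s
  refine ⟨c / 2, by positivity, fun a b hab => ?_⟩
  have hm1 : a ≤ (a + b) / 2 := by omega
  have hm2 : (a + b) / 2 ≤ b := by omega
  have hm3 : (b : ℝ) ≤ 2 * (((a + b) / 2 : ℕ) : ℝ) + 1 := by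
    have : b ≤ 2 * ((a + b) / 2) + 1 := by omega
    exact_mod_cast this
  have hm4 : 2 * (((a + b) / 2 : ℕ) : ℝ) ≤ a + b := by
    have : 2 * ((a + b) / 2) ≤ a + b := by omega
    exact_mod_cast this
  calc c / 2 * ((b : ℝ) - a) * ((b : ℝ) + 1) ^ s
      ≤ ((b : ℝ) - ((a + b) / 2 : ℕ)) * (c * ((b : ℝ) + 1) ^ s) := by
        have : 0 ≤ c * ((b : ℝ) + 1) ^ s := by positivity
        nlinarith
    _ = ∑ i ∈ Finset.Ico ((a + b) / 2) b, c * ((b : ℝ) + 1) ^ s := by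
        rw [Finset.sum_const, Nat.card_Ico, nsmul_eq_mul, Nat.cast_sub hm2]
    _ ≤ ∑ i ∈ Finset.Ico ((a + b) / 2) b, ((i : ℝ) + 1) ^ s := by
        refine Finset.sum_le_sum fun i hi => ?_
        rw [Finset.mem_Ico] at hi
        have h1 : (((a + b) / 2 : ℕ) : ℝ) ≤ i := by exact_mod_cast hi.1
        have h2 : (i : ℝ) + 1 ≤ b := by exact_mod_cast hi.2
        exact h _ _ (by positivity) (by linarith) (by linarith)
    _ ≤ _ := Finset.sum_le_sum_of_subset_of_nonneg (Finset.Ico_subset_Ico_left hm1)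
        fun i _ _ => by positivity

variable {μ : ℕ → ℝ} {γ κ : ℝ} {N₀ : ℕ}

theorem sum_gap_le (hsep : ∀ k ≥ N₀, κ * ((k : ℝ) + 1) ^ (γ - 1) ≤ μ (k + 1) - μ k)
    {a b : ℕ} (ha : N₀ ≤ a) (hab : a ≤ b) :
    κ * ∑ i ∈ Finset.Ico a b, ((i : ℝ) + 1) ^ (γ - 1) ≤ μ b - μ a := by
  rw [Finset.mul_sum, ← Finset.sum_Ico_sub μ hab]
  exact Finset.sum_le_sum fun i hi => hsep i (ha.trans (Finset.mem_Ico.1 hi).1)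

theorem tendsto_add_one_rpow_atTop {s : ℝ} (hs : 0 < s) :
    Tendsto (fun n : ℕ => ((n : ℝ) + 1) ^ s) atTop atTop :=
  (tendsto_rpow_atTop hs).comp (tendsto_atTop_add_const_right _ _ tendsto_natCast_atTop_atTop)

theorem tendsto_add_one_rpow_neg {s : ℝ} (hs : 0 < s) :
    Tendsto (fun n : ℕ => ((n : ℝ) + 1) ^ (-s)) atTop (𝓝 0) :=
  (tendsto_rpow_neg_atTop hs).comp
    (tendsto_atTop_add_const_right _ _ tendsto_natCast_atTop_atTop)

/-- Summing adjacent gaps settles `j ≥ N₀`. Below `N₀` nothing is known about the order of the `μ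
j`, but these finitely many values cost only a constant `D`, which is absorbed because `(n + 1)^γ`
tends to infinity. -/
theorem exists_gap (hγ : 0 < γ) (hκ : 0 < κ)
    (hsep : ∀ k ≥ N₀, κ * ((k : ℝ) + 1) ^ (γ - 1) ≤ μ (k + 1) - μ k) :
    ∃ c > 0, ∃ N : ℕ, ∀ n ≥ N, ∀ j < n,
      c * ((n : ℝ) - j) * ((n : ℝ) + 1) ^ (γ - 1) ≤ μ n - μ j := by
  obtain ⟨c, hc, h⟩ := exists_mul_le_sum_rpow (γ - 1)
  have hfar : ∀ a ≥ N₀, ∀ b ≥ a,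
      κ * c * ((b : ℝ) - a) * ((b : ℝ) + 1) ^ (γ - 1) ≤ μ b - μ a := by
    intro a ha b hab
    calc _ = κ * (c * ((b : ℝ) - a) * ((b : ℝ) + 1) ^ (γ - 1)) := by ring
      _ ≤ κ * _ := by gcongr; exact h a b hab
      _ ≤ _ := sum_gap_le hsep ha hab
  obtain ⟨D, hD⟩ : ∃ D : ℝ, ∀ j < N₀, μ j - μ N₀ ≤ D := by
    obtain ⟨D, hD⟩ := ((Set.finite_lt_nat N₀).image fun j => μ j - μ N₀).bddAbove
    exact ⟨D, fun j hj => hD ⟨j, hj, rfl⟩⟩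
  obtain ⟨N₁, hN₁⟩ := eventually_atTop.1
    ((tendsto_add_one_rpow_atTop hγ).eventually_ge_atTop (D / (κ * c / 16)))
  refine ⟨κ * c / 4, by positivity, max N₁ (2 * N₀ + 1), fun n hn j hj => ?_⟩
  have hn1 := hN₁ n (le_of_max_le_left hn)
  have hn2 : 2 * N₀ + 1 ≤ n := le_of_max_le_right hn
  have hjn : (j : ℝ) < n := by exact_mod_cast hj
  rcases le_or_gt N₀ j with hj0 | hj0
  · refine le_trans ?_ (hfar j hj0 n hj.le)
    have : 0 ≤ κ * c * ((n : ℝ) - j) * ((n : ℝ) + 1) ^ (γ - 1) := by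
      have := sub_nonneg.2 hjn.le
      positivity
    linarith
  · have h1 := hfar N₀ le_rfl n (by omega)
    have h2 := hD j hj0
    rw [div_le_iff₀ (by positivity)] at hn1
    have hs : ((n : ℝ) + 1) ^ γ = ((n : ℝ) + 1) ^ (γ - 1) * ((n : ℝ) + 1) := by
      rw [← Real.rpow_add_one (by positivity), sub_add_cancel]
    rw [hs] at hn1
    have hn3 : 2 * (N₀ : ℝ) + 1 ≤ n := by exact_mod_cast hn2
    have hj1 : (0 : ℝ) ≤ j := by positivity
    have hN0 : (0 : ℝ) ≤ N₀ := by positivity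
    have hj2 : (j : ℝ) ≤ N₀ := by exact_mod_cast hj0.le
    set X : ℝ := κ * c * ((n : ℝ) + 1) ^ (γ - 1) with hX
    have hX0 : 0 ≤ X := by positivity
    have h3 : X * (n - N₀) ≤ μ n - μ N₀ := by
      calc _ = _ := by rw [hX]; ring
        _ ≤ _ := h1
    have h4 : D ≤ X * (n + 1) / 16 := by
      calc D ≤ _ := hn1
        _ = _ := by rw [hX]; ring
    calc κ * c / 4 * ((n : ℝ) - j) * ((n : ℝ) + 1) ^ (γ - 1) = X * ((n - j) / 4) := by
          rw [hX]; ring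
      _ ≤ X * (n - N₀) - X * (n + 1) / 16 := by
          have : (n - (j : ℝ)) / 4 ≤ (n - N₀) - (n + 1) / 16 := by linarith
          calc _ ≤ X * ((n - N₀) - (n + 1) / 16) := by gcongr
            _ = _ := by ring
      _ ≤ μ n - μ j := by linarith

/-- The summand of the sums below is dominated by a summable one, uniformly. -/
theorem rpow_div_mul_max_le {α δ : ℝ} (hδ : δ = 2 * α + γ - 1) (hδ0 : 0 < δ) (hδγ : δ ≤ γ)
    {x y : ℝ} (hx : 0 < x) (hy : 0 < y) (hxy : x ≠ y) :
    x ^ (-(2 * α)) / (|x - y| * max x y ^ (γ - 1)) ≤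
      max x y ^ (-(δ / 2)) * (x ^ (-(1 + δ / 2)) + |x - y| ^ (-(1 + δ / 2))) := by
  rcases lt_or_gt_of_ne hxy with h | h
  · have hd : 0 < y - x := sub_pos.2 h
    rw [max_eq_right h.le, abs_sub_comm, abs_of_pos hd]
    -- This is `y/(y - x) = 1 + x/(y - x)`. In both terms the remaining power of `x` has nonnegative
    -- exponent, because `δ ≤ γ`, and may be replaced by the same power of `y`.
    have h1 : x ^ (-(2 * α)) / ((y - x) * y ^ (γ - 1))
        = y ^ (-γ) * (x ^ (γ - δ / 2) * x ^ (-(1 + δ / 2))) +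
          y ^ (-γ) * (x ^ (γ - δ) * (y - x)⁻¹) := by
      rw [← Real.rpow_add hx, show γ - δ / 2 + -(1 + δ / 2) = -(2 * α) by rw [hδ]; ring,
        show γ - δ = -(2 * α) + 1 by rw [hδ]; ring, Real.rpow_add_one hx.ne',
        Real.rpow_sub_one hy.ne', Real.rpow_neg hy.le]
      have : y ^ γ ≠ 0 := by positivity
      field_simp
      ring
    rw [h1, mul_add]
    refine add_le_add ?_ ?_
    · calc y ^ (-γ) * (x ^ (γ - δ / 2) * x ^ (-(1 + δ / 2)))
          ≤ y ^ (-γ) * (y ^ (γ - δ / 2) * x ^ (-(1 + δ / 2))) := by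
            gcongr
            linarith
        _ = _ := by rw [← mul_assoc, ← Real.rpow_add hy]; ring_nf
    · calc y ^ (-γ) * (x ^ (γ - δ) * (y - x)⁻¹)
          ≤ y ^ (-γ) * (y ^ (γ - δ) * (y - x)⁻¹) := by
            gcongr
        _ = y ^ (-(δ / 2)) * (y ^ (-(δ / 2)) * (y - x)⁻¹) := by
            rw [← mul_assoc, ← mul_assoc, ← Real.rpow_add hy, ← Real.rpow_add hy]; ring_nf
        _ ≤ y ^ (-(δ / 2)) * ((y - x) ^ (-(δ / 2)) * (y - x)⁻¹) := by
            gcongr ?_ * (?_ * _)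
            exact Real.rpow_le_rpow_of_nonpos hd (by linarith) (by linarith)
        _ = _ := by
            rw [← Real.rpow_neg_one (y - x), ← Real.rpow_add hd]; ring_nf
  · have hd : 0 < x - y := sub_pos.2 h
    rw [max_eq_left h.le, abs_of_pos hd]
    calc x ^ (-(2 * α)) / ((x - y) * x ^ (γ - 1))
        = x ^ (-(δ / 2)) * (x ^ (-(δ / 2)) * (x - y)⁻¹) := by
          rw [← mul_assoc, ← Real.rpow_add hx, div_eq_mul_inv, mul_inv, ← Real.rpow_neg hx.le,
            mul_comm (x - y)⁻¹, ← mul_assoc, ← Real.rpow_add hx, hδ]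
          ring_nf
      _ ≤ x ^ (-(δ / 2)) * ((x - y) ^ (-(δ / 2)) * (x - y)⁻¹) := by
          gcongr ?_ * (?_ * _)
          exact Real.rpow_le_rpow_of_nonpos hd (by linarith) (by linarith)
      _ = x ^ (-(δ / 2)) * (x - y) ^ (-(1 + δ / 2)) := by
          rw [← Real.rpow_neg_one (x - y), ← Real.rpow_add hd]; ring_nf
      _ ≤ _ := by
          gcongr
          have : 0 ≤ x ^ (-(1 + δ / 2)) := by positivity
          linarith

/-- Each side of the diagonal contributes at most one copy of the one-sided sum. -/
theorem tsum_ite_ne_abs_sub_le (g : ℝ → ℝ≥0∞) (m : ℕ) :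
    ∑' n : ℕ, (if n ≠ m then g |(n : ℝ) - m| else 0) ≤ 2 * ∑' i : ℕ, g ((i : ℝ) + 1) := by
  have hsplit : ∀ n : ℕ, (if n ≠ m then g |(n : ℝ) - m| else 0) =
      (if m < n then g ((n : ℝ) - m) else 0) + (if n < m then g ((m : ℝ) - n) else 0) := by
    intro n
    rcases lt_trichotomy n m with h | h | h
    · have h' : (n : ℝ) < m := by exact_mod_cast h
      simp [h, h.ne, not_lt.2 h.le, abs_of_neg (sub_neg.2 h')]
    · simp [h]
    · have h' : (m : ℝ) < n := by exact_mod_cast h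
      simp [h, h.ne', not_lt.2 h.le, abs_of_pos (sub_pos.2 h')]
  simp_rw [hsplit]
  rw [ENNReal.tsum_add, two_mul]
  refine add_le_add (le_of_eq ?_) ?_
  · have hinj : Function.Injective fun i : ℕ => m + 1 + i := add_right_injective _
    rw [← hinj.tsum_eq]
    · refine tsum_congr fun i => ?_
      have : m < m + 1 + i := by omega
      simp only [this, if_true]
      congr 1
      push_cast
      ring
    · intro n hn
      have h : m < n := by
        by_contra h
        simp [h] at hn
      exact ⟨n - (m + 1), by simp only; omega⟩
  · rw [tsum_eq_sum (s := Finset.range m) (by intro n hn; simp at hn; simp [not_lt.2 hn]),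
      ← Finset.sum_range_reflect]
    refine le_trans (Finset.sum_le_sum (g := fun i : ℕ => g ((i : ℝ) + 1)) fun i hi => ?_)
      (ENNReal.sum_le_tsum _)
    rw [Finset.mem_range] at hi
    have h : m - 1 - i < m := by omega
    simp only [h, if_true]
    refine le_of_eq (congrArg g ?_)
    have h1 : m = (m - 1 - i) + i + 1 := by omega
    have h2 : (m : ℝ) = ((m - 1 - i : ℕ) : ℝ) + i + 1 := by exact_mod_cast h1
    linarith

/-- The surplus `δ = 2α + γ - 1 > 0` is spent in two halves: one raises the exponent of the summands
above 1, the other leaves the decay `(N + 1)^{-δ/2}`, uniformly in `m`. The factor 3 counts one sum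
in `n` and two in `|n - m|`. -/
theorem tsum_div_gap_le (hγ : 0 < γ) (hκ : 0 < κ)
    (hsep : ∀ k ≥ N₀, κ * ((k : ℝ) + 1) ^ (γ - 1) ≤ μ (k + 1) - μ k)
    {α : ℝ} (hα : 1 < 2 * α + γ) (hα' : α ≤ 1 / 2) {ε : ℝ} (hε : 0 < ε) :
    ∃ N, ∀ m, ∑' n : ℕ, (if n ≠ m ∧ (N ≤ m ∨ N ≤ n) then
      ENNReal.ofReal (((n : ℝ) + 1) ^ (-(2 * α)) / |μ m - μ n|) else 0) ≤ ENNReal.ofReal ε := by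
  obtain ⟨c, hc, N₁, hN₁⟩ := exists_gap hγ hκ hsep
  set δ := 2 * α + γ - 1 with hδ
  have hδ0 : 0 < δ := by linarith
  have hδγ : δ ≤ γ := by linarith
  set g : ℝ → ℝ≥0∞ := fun t => ENNReal.ofReal (t ^ (-(1 + δ / 2))) with hg
  set Z : ℝ≥0∞ := ∑' i : ℕ, g ((i : ℝ) + 1) with hZ
  have hZtop : Z ≠ ⊤ := by
    have hs : Summable fun i : ℕ => ((i : ℝ) + 1) ^ (-(1 + δ / 2)) := by
      have := (summable_nat_add_iff 1).2 (Real.summable_nat_rpow (p := -(1 + δ / 2)) |>.2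
        (by linarith))
      simpa using this
    exact hs.tsum_ofReal_ne_top
  have hlim : Tendsto (fun N : ℕ => c⁻¹ * ((N : ℝ) + 1) ^ (-(δ / 2)) * (3 * Z).toReal) atTop
      (𝓝 0) := by
    have := ((tendsto_add_one_rpow_neg (half_pos hδ0)).const_mul c⁻¹).mul_const (3 * Z).toReal
    simpa using this
  obtain ⟨N₂, hN₂⟩ := eventually_atTop.1 (hlim.eventually_le_const hε)
  set N := max N₁ N₂ with hN
  refine ⟨N, fun m => ?_⟩
  set a : ℝ := c⁻¹ * ((N : ℝ) + 1) ^ (-(δ / 2)) with ha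
  have ha0 : 0 ≤ a := by positivity
  have hterm : ∀ n : ℕ, (if n ≠ m ∧ (N ≤ m ∨ N ≤ n) then
      ENNReal.ofReal (((n : ℝ) + 1) ^ (-(2 * α)) / |μ m - μ n|) else 0) ≤
      ENNReal.ofReal a * (g ((n : ℝ) + 1) + (if n ≠ m then g |(n : ℝ) - m| else 0)) := by
    intro n
    split_ifs with h1 h2 h2
    · rw [hg, ← ENNReal.ofReal_add (by positivity) (by positivity), ← ENNReal.ofReal_mul ha0]
      refine ENNReal.ofReal_le_ofReal ?_
      have hne : (n : ℝ) + 1 ≠ (m : ℝ) + 1 := by simpa using h2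
      have hmax : (N : ℝ) + 1 ≤ max ((n : ℝ) + 1) ((m : ℝ) + 1) := by
        rcases h1.2 with h | h
        · exact le_max_of_le_right (by exact_mod_cast Nat.succ_le_succ h)
        · exact le_max_of_le_left (by exact_mod_cast Nat.succ_le_succ h)
      have hgap : c * (|((n : ℝ) + 1) - (m + 1)| * max ((n : ℝ) + 1) ((m : ℝ) + 1) ^ (γ - 1))
          ≤ |μ m - μ n| := by
        rcases lt_or_gt_of_ne h2 with h | h
        · have h' : (n : ℝ) < m := by exact_mod_cast h
          have := hN₁ m (by
            rcases h1.2 with h3 | h3 <;> exact (le_max_left N₁ N₂).trans (by omega)) n h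
          rw [max_eq_right (by linarith), abs_of_neg (by linarith)]
          refine le_trans ?_ (le_abs_self _)
          calc _ = _ := by ring
            _ ≤ _ := this
        · have h' : (m : ℝ) < n := by exact_mod_cast h
          have := hN₁ n (by
            rcases h1.2 with h3 | h3 <;> exact (le_max_left N₁ N₂).trans (by omega)) m h
          rw [max_eq_left (by linarith), abs_of_pos (by linarith), abs_sub_comm]
          refine le_trans ?_ (le_abs_self _)
          calc _ = _ := by ring
            _ ≤ _ := this
      have hpos : 0 < |((n : ℝ) + 1) - (m + 1)| := abs_pos.2 (sub_ne_zero.2 hne)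
      calc ((n : ℝ) + 1) ^ (-(2 * α)) / |μ m - μ n|
          ≤ ((n : ℝ) + 1) ^ (-(2 * α)) /
            (c * (|((n : ℝ) + 1) - (m + 1)| * max ((n : ℝ) + 1) ((m : ℝ) + 1) ^ (γ - 1))) := by
            gcongr
        _ = c⁻¹ * (((n : ℝ) + 1) ^ (-(2 * α)) /
            (|((n : ℝ) + 1) - (m + 1)| * max ((n : ℝ) + 1) ((m : ℝ) + 1) ^ (γ - 1))) := by
            rw [mul_comm c, ← div_div, div_eq_inv_mul _ c]
        _ ≤ c⁻¹ * (max ((n : ℝ) + 1) ((m : ℝ) + 1) ^ (-(δ / 2)) *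
            (((n : ℝ) + 1) ^ (-(1 + δ / 2)) +
              |((n : ℝ) + 1) - (m + 1)| ^ (-(1 + δ / 2)))) := by
            gcongr
            exact rpow_div_mul_max_le hδ hδ0 hδγ (by positivity) (by positivity) hne
        _ ≤ c⁻¹ * (((N : ℝ) + 1) ^ (-(δ / 2)) *
            (((n : ℝ) + 1) ^ (-(1 + δ / 2)) +
              |((n : ℝ) + 1) - (m + 1)| ^ (-(1 + δ / 2)))) := by
            gcongr c⁻¹ * (?_ * _)
            exact Real.rpow_le_rpow_of_nonpos (by positivity) hmax (by linarith)
        _ = _ := by rw [ha, add_sub_add_right_eq_sub]; ring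
    · exact absurd h1.1 h2
    · exact zero_le
    · exact zero_le
  calc _ ≤ ∑' n : ℕ, ENNReal.ofReal a *
        (g ((n : ℝ) + 1) + (if n ≠ m then g |(n : ℝ) - m| else 0)) := ENNReal.tsum_le_tsum hterm
    _ ≤ ENNReal.ofReal a * (Z + 2 * Z) := by
        rw [ENNReal.tsum_mul_left, ENNReal.tsum_add]
        gcongr
        exact tsum_ite_ne_abs_sub_le g m
    _ = ENNReal.ofReal (a * (3 * Z).toReal) := by
        rw [ENNReal.ofReal_mul ha0, ENNReal.ofReal_toReal (ENNReal.mul_ne_top (by simp) hZtop)]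
        ring
    _ ≤ ENNReal.ofReal ε := ENNReal.ofReal_le_ofReal (hN₂ N (le_max_right _ _))

/-- Positive numbers `μ n`, eventually separated by the margins `2 * q₁ n` on the left and
`2 * q₂ n` on the right, and weights `p n` that are small relative to the separation. -/
structure SeparatedWeights (μ p q₁ q₂ : ℕ → ℝ) : Prop where
  pos : ∀ n, 0 < μ n
  weight_pos : ∀ n, 0 < p n
  tendsto_atTop : Tendsto μ atTop atTop
  tsum_le : ∀ ε : ℝ, 0 < ε → ∃ N, ∀ m, ∑' n : ℕ, (if n ≠ m ∧ (N ≤ m ∨ N ≤ n) then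
    ENNReal.ofReal (p n ^ 2 / |μ m - μ n|) else 0) ≤ ENNReal.ofReal ε
  gap : ∀ᶠ n in atTop, 0 < q₁ n ∧ 0 < q₂ n ∧ (∀ j < n, 2 * q₁ n ≤ μ n - μ j) ∧
    ∀ j > n, 2 * q₂ n ≤ μ j - μ n
  tendsto_left : Tendsto (fun n => p n ^ 2 / q₁ n) atTop (𝓝 0)
  tendsto_right : Tendsto (fun n => p n ^ 2 / q₂ n) atTop (𝓝 0)

theorem separatedWeights_of_gap (hμ : ∀ n, 0 < μ n) (hγ : 0 < γ) (hκ : 0 < κ)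
    (hsep : ∀ k ≥ N₀, κ * ((k : ℝ) + 1) ^ (γ - 1) ≤ μ (k + 1) - μ k)
    {α : ℝ} (hα : 1 < 2 * α + γ) (hα' : α ≤ 1 / 2) :
    SeparatedWeights μ (fun n => ((n : ℝ) + 1) ^ (-α)) (fun n => κ / 2 * (n : ℝ) ^ (γ - 1))
      (fun n => κ / 2 * ((n : ℝ) + 1) ^ (γ - 1)) := by
  have hp2 : ∀ n : ℕ, (((n : ℝ) + 1) ^ (-α)) ^ 2 = ((n : ℝ) + 1) ^ (-(2 * α)) := by
    intro n
    rw [← Real.rpow_natCast, ← Real.rpow_mul (by positivity)]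
    congr 1
    push_cast
    ring
  obtain ⟨c, hc, N, hN⟩ := exists_gap hγ hκ hsep
  have hright : Tendsto (fun n : ℕ => ((n : ℝ) + 1) ^ (-(2 * α)) / (κ / 2 *
      ((n : ℝ) + 1) ^ (γ - 1))) atTop (𝓝 0) := by
    have h := (tendsto_add_one_rpow_neg (s := 2 * α + γ - 1) (by linarith)).const_mul (κ / 2)⁻¹
    rw [mul_zero] at h
    refine h.congr fun n => ?_
    rw [mul_comm (κ / 2), ← div_div, ← Real.rpow_sub (by positivity), div_eq_inv_mul]
    ring_nf
  refine ⟨hμ, fun n => by positivity, ?_, ?_, ?_, ?_, ?_⟩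
  · refine tendsto_atTop_mono' _ ?_
      (((tendsto_add_one_rpow_atTop hγ).const_mul_atTop (half_pos hc)))
    filter_upwards [eventually_ge_atTop (max N 1)] with n hn
    have h1 := hN n (le_of_max_le_left hn) 0 (le_of_max_le_right hn)
    have h2 : (1 : ℝ) ≤ n := by exact_mod_cast le_of_max_le_right hn
    have h3 := hμ 0
    have h4 : ((n : ℝ) + 1) ^ γ = ((n : ℝ) + 1) * ((n : ℝ) + 1) ^ (γ - 1) := by
      rw [mul_comm, ← Real.rpow_add_one (by positivity), sub_add_cancel]
    calc c / 2 * ((n : ℝ) + 1) ^ γ = c * (((n : ℝ) + 1) / 2) * ((n : ℝ) + 1) ^ (γ - 1) := by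
          rw [h4]; ring
      _ ≤ c * ((n : ℝ) - (0 : ℕ)) * ((n : ℝ) + 1) ^ (γ - 1) := by
          gcongr
          push_cast
          linarith
      _ ≤ μ n := by linarith
  · intro ε hε
    simp only [hp2]
    exact tsum_div_gap_le hγ hκ hsep hα hα' hε
  · filter_upwards [eventually_ge_atTop (max N N₀ + 1)] with n hn
    have hnN : N + 1 ≤ n := (Nat.succ_le_succ (le_max_left _ _)).trans hn
    have hnN0 : N₀ + 1 ≤ n := (Nat.succ_le_succ (le_max_right _ _)).trans hn
    have hn0 : (0 : ℝ) < n := by exact_mod_cast (by omega : 0 < n)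
    have hmono : ∀ a b, N ≤ b → a ≤ b → μ a ≤ μ b := by
      intro a b hb hab
      rcases hab.eq_or_lt with rfl | h
      · exact le_rfl
      · have h1 := hN b hb a h
        have h2 : (a : ℝ) < b := by exact_mod_cast h
        have h3 : 0 ≤ c * ((b : ℝ) - a) * ((b : ℝ) + 1) ^ (γ - 1) := by
          have := sub_nonneg.2 h2.le
          positivity
        linarith
    refine ⟨by positivity, by positivity, fun j hj => ?_, fun j hj => ?_⟩
    · have h1 := hsep (n - 1) (by omega)
      rw [Nat.sub_add_cancel (by omega), Nat.cast_sub (by omega), Nat.cast_one,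
        sub_add_cancel] at h1
      have h2 := hmono j (n - 1) (by omega) (by omega)
      linarith
    · have h1 := hsep n (by omega)
      have h2 := hmono (n + 1) j (by omega) hj
      linarith
  · obtain ⟨d, hd, h⟩ := exists_mul_rpow_le_rpow (γ - 1)
    have h1 := hright.const_mul d⁻¹
    rw [mul_zero] at h1
    refine squeeze_zero' (Eventually.of_forall fun n => by positivity) ?_ h1
    filter_upwards [eventually_ge_atTop 1] with n hn
    have hn1 : (1 : ℝ) ≤ n := by exact_mod_cast hn
    rw [hp2]
    have h2 := h n (n + 1) (by positivity) (by linarith) (by linarith)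
    calc ((n : ℝ) + 1) ^ (-(2 * α)) / (κ / 2 * (n : ℝ) ^ (γ - 1))
        ≤ ((n : ℝ) + 1) ^ (-(2 * α)) / (κ / 2 * (d * ((n : ℝ) + 1) ^ (γ - 1))) := by
          gcongr
      _ = _ := by
          rw [inv_mul_eq_div, div_div]
          ring_nf
  · simp only [hp2]
    exact hright

end Gap

/-! ### Residues on rectangles -/

section Rectangle

variable {H : Type*} [NormedAddCommGroup H] [InnerProductSpace ℂ H] {p q r : ℝ}

/-- The closed rectangle `p ≤ Re z ≤ q`, `|Im z| ≤ r`. -/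
def closedRectangle (p q r : ℝ) : Set ℂ := {z | p ≤ z.re ∧ z.re ≤ q ∧ |z.im| ≤ r}

theorem isOpen_rectangle (p q r : ℝ) : IsOpen (rectangle p q r) :=
  (isOpen_lt continuous_const Complex.continuous_re).inter
    ((isOpen_lt Complex.continuous_re continuous_const).inter
      (isOpen_lt (continuous_abs.comp Complex.continuous_im) continuous_const))

theorem isClosed_closedRectangle (p q r : ℝ) : IsClosed (closedRectangle p q r) :=
  (isClosed_le continuous_const Complex.continuous_re).inter
    ((isClosed_le Complex.continuous_re continuous_const).inter
      (isClosed_le (continuous_abs.comp Complex.continuous_im) continuous_const))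

theorem rectangle_subset_closedRectangle (p q r : ℝ) : rectangle p q r ⊆ closedRectangle p q r :=
  fun _ hz => ⟨hz.1.le, hz.2.1.le, hz.2.2.le⟩

theorem frontier_rectangle_subset (p q r : ℝ) :
    frontier (rectangle p q r) ⊆ closedRectangle p q r \ rectangle p q r := by
  rw [(isOpen_rectangle p q r).frontier_eq]
  exact Set.sdiff_subset_sdiff_left
    (closure_minimal (rectangle_subset_closedRectangle p q r) (isClosed_closedRectangle p q r))

theorem lower_edge_mem (hr : 0 < r) {x : ℝ} (hx : x ∈ Set.Icc p q) :
    (x - r * Complex.I : ℂ) ∈ closedRectangle p q r \ rectangle p q r := by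
  refine ⟨⟨by simpa using hx.1, by simpa using hx.2, by simp [abs_of_pos hr]⟩, fun h => ?_⟩
  simpa [abs_of_pos hr] using h.2.2

theorem upper_edge_mem (hr : 0 < r) {x : ℝ} (hx : x ∈ Set.Icc p q) :
    (x + r * Complex.I : ℂ) ∈ closedRectangle p q r \ rectangle p q r := by
  refine ⟨⟨by simpa using hx.1, by simpa using hx.2, by simp [abs_of_pos hr]⟩, fun h => ?_⟩
  simpa [abs_of_pos hr] using h.2.2

theorem right_edge_mem (hpq : p ≤ q) {y : ℝ} (hy : y ∈ Set.Icc (-r) r) :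
    (q + y * Complex.I : ℂ) ∈ closedRectangle p q r \ rectangle p q r := by
  refine ⟨⟨by simpa using hpq, by simp, by simpa using abs_le.2 hy⟩, fun h => ?_⟩
  simpa using h.2.1

theorem left_edge_mem (hpq : p ≤ q) {y : ℝ} (hy : y ∈ Set.Icc (-r) r) :
    (p + y * Complex.I : ℂ) ∈ closedRectangle p q r \ rectangle p q r := by
  refine ⟨⟨by simp, by simpa using hpq, by simpa using abs_le.2 hy⟩, fun h => ?_⟩
  simpa using h.1

theorem rectangleIntegral_congr (hpq : p ≤ q) (hr : 0 < r) {f g : ℂ → H}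
    (h : ∀ z ∈ closedRectangle p q r \ rectangle p q r, f z = g z) :
    rectangleIntegral f p q r = rectangleIntegral g p q r := by
  have hr' : -r ≤ r := by linarith
  unfold rectangleIntegral
  congr 1
  · congr 1
    · congr 1
      · exact intervalIntegral.integral_congr fun x hx =>
          h _ (lower_edge_mem hr (by rwa [Set.uIcc_of_le hpq] at hx))
      · congr 1
        exact intervalIntegral.integral_congr fun y hy =>
          h _ (right_edge_mem hpq (by rwa [Set.uIcc_of_le hr'] at hy))
    · exact intervalIntegral.integral_congr fun x hx =>
        h _ (upper_edge_mem hr (by rwa [Set.uIcc_of_le hpq] at hx))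
  · congr 1
    exact intervalIntegral.integral_congr fun y hy =>
      h _ (left_edge_mem hpq (by rwa [Set.uIcc_of_le hr'] at hy))

theorem rectangleIntegral_add (hpq : p ≤ q) (hr : 0 < r) {f g : ℂ → H}
    (hf : ContinuousOn f (closedRectangle p q r \ rectangle p q r))
    (hg : ContinuousOn g (closedRectangle p q r \ rectangle p q r)) :
    rectangleIntegral (fun z => f z + g z) p q r =
      rectangleIntegral f p q r + rectangleIntegral g p q r := by
  have hr' : -r ≤ r := by linarith
  have hl : ∀ h : ℂ → H, ContinuousOn h (closedRectangle p q r \ rectangle p q r) →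
      IntervalIntegrable (fun x : ℝ => h (x - r * Complex.I)) MeasureTheory.volume p q ∧
      IntervalIntegrable (fun y : ℝ => h (q + y * Complex.I)) MeasureTheory.volume (-r) r ∧
      IntervalIntegrable (fun x : ℝ => h (x + r * Complex.I)) MeasureTheory.volume p q ∧
      IntervalIntegrable (fun y : ℝ => h (p + y * Complex.I)) MeasureTheory.volume (-r) r := by
    intro h hh
    refine ⟨?_, ?_, ?_, ?_⟩ <;> refine ContinuousOn.intervalIntegrable ?_ <;>
      refine hh.comp (by fun_prop) fun x hx => ?_
    · exact lower_edge_mem hr (by rwa [Set.uIcc_of_le hpq] at hx)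
    · exact right_edge_mem hpq (by rwa [Set.uIcc_of_le hr'] at hx)
    · exact upper_edge_mem hr (by rwa [Set.uIcc_of_le hpq] at hx)
    · exact left_edge_mem hpq (by rwa [Set.uIcc_of_le hr'] at hx)
  obtain ⟨f1, f2, f3, f4⟩ := hl f hf
  obtain ⟨g1, g2, g3, g4⟩ := hl g hg
  unfold rectangleIntegral
  rw [intervalIntegral.integral_add f1 g1, intervalIntegral.integral_add f2 g2,
    intervalIntegral.integral_add f3 g3, intervalIntegral.integral_add f4 g4]
  simp only [smul_add]
  abel

theorem rectangleIntegral_smul_const [CompleteSpace H] (f : ℂ → ℂ) (v : H) :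
    rectangleIntegral (fun z => f z • v) p q r = rectangleIntegral f p q r • v := by
  unfold rectangleIntegral
  simp only [intervalIntegral.integral_smul_const, sub_smul, add_smul, smul_eq_mul, mul_smul]

theorem rectangleIntegral_eq_zero (hpq : p ≤ q) (hr : 0 < r) {f : ℂ → H}
    (hf : DifferentiableOn ℂ f (closedRectangle p q r)) : rectangleIntegral f p q r = 0 := by
  have h := Complex.integral_boundary_rect_eq_zero_of_differentiableOn f
    (p - r * Complex.I) (q + r * Complex.I) (hf.mono ?_)
  · rw [← h]
    unfold rectangleIntegral
    simp [sub_eq_add_neg]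
    abel
  · intro z hz
    rw [Complex.mem_reProdIm] at hz
    simp only [Complex.sub_re, Complex.ofReal_re, Complex.re_ofReal_mul, Complex.I_re, mul_zero,
      sub_zero, Complex.add_re, add_zero, Complex.sub_im, Complex.ofReal_im, Complex.im_ofReal_mul,
      Complex.I_im, mul_one, zero_sub, Complex.add_im, zero_add] at hz
    rw [Set.uIcc_of_le hpq, Set.uIcc_of_le (by linarith : -r ≤ r)] at hz
    exact ⟨hz.1.1, hz.1.2, abs_le.2 hz.2⟩

theorem integral_inv_segment {a d : ℂ} {s t : ℝ} (hst : s ≤ t)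
    (h : ∀ x ∈ Set.Icc s t, a + x * d ∈ Complex.slitPlane) :
    d * ∫ x in s..t, (a + x * d)⁻¹ = Complex.log (a + t * d) - Complex.log (a + s * d) := by
  rw [← intervalIntegral.integral_const_mul]
  have hd : ∀ x : ℝ, HasDerivAt (fun x : ℝ => a + x * d) d x := by
    intro x
    simpa using ((Complex.ofRealCLM.hasDerivAt (x := x)).mul_const d).const_add a
  refine intervalIntegral.integral_eq_sub_of_hasDerivAt
    (f := fun x : ℝ => Complex.log (a + x * d)) (fun x hx => ?_) ?_
  · rw [Set.uIcc_of_le hst] at hx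
    have := (hd x).clog_real (h x hx)
    rwa [div_eq_mul_inv] at this
  · refine ContinuousOn.intervalIntegrable ?_
    refine ContinuousOn.mul continuousOn_const (ContinuousOn.inv₀ (by fun_prop) fun x hx => ?_)
    rw [Set.uIcc_of_le hst] at hx
    exact Complex.slitPlane_ne_zero (h x hx)

/-- The principal logarithm of `z - w` is a primitive along the lower, right and upper edges. The
left edge meets the cut, so there the logarithm of `w - z` is used. The two branches differ by `πi`
at the upper left and by `-πi` at the lower left corner, which adds up to `2πi`. -/
theorem rectangleIntegral_inv_sub {w : ℂ} (hw : w ∈ rectangle p q r) :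
    rectangleIntegral (fun z => (z - w)⁻¹) p q r = 2 * Real.pi * Complex.I := by
  obtain ⟨h1, h2, h3⟩ := hw
  have hpq : p ≤ q := by linarith
  have hr : 0 < r := (abs_nonneg _).trans_lt h3
  have hr' : -r ≤ r := by linarith
  obtain ⟨h4, h5⟩ := abs_lt.1 h3
  have e1 := integral_inv_segment (a := -r * Complex.I - w) (d := 1) hpq fun x _ =>
    Complex.mem_slitPlane_iff.2 (Or.inr (by simp; linarith))
  have e2 := integral_inv_segment (a := q - w) (d := Complex.I) hr' fun x _ =>
    Complex.mem_slitPlane_iff.2 (Or.inl (by simp; linarith))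
  have e3 := integral_inv_segment (a := r * Complex.I - w) (d := 1) hpq fun x _ =>
    Complex.mem_slitPlane_iff.2 (Or.inr (by simp; linarith))
  have e4 := integral_inv_segment (a := w - p) (d := -Complex.I) hr' fun x _ =>
    Complex.mem_slitPlane_iff.2 (Or.inl (by simp; linarith))
  have e4' : ∫ x in (-r)..r, (w - p + x * -Complex.I)⁻¹ =
      -∫ y in (-r)..r, (p + y * Complex.I - w)⁻¹ := by
    rw [← intervalIntegral.integral_neg]
    refine intervalIntegral.integral_congr fun x _ => ?_
    rw [← inv_neg]
    ring_nf
  rw [e4', neg_mul_neg] at e4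
  have hu : Complex.log (p + r * Complex.I - w) =
      Complex.log (w - p + r * -Complex.I) + Real.pi * Complex.I := by
    have h : w - p + r * -Complex.I = -(p + r * Complex.I - w) := by ring
    rw [h, Complex.log, Complex.log,
      Complex.arg_neg_eq_arg_sub_pi_of_im_pos (by simp; linarith), norm_neg]
    push_cast
    ring
  have hl : Complex.log (p - r * Complex.I - w) =
      Complex.log (w - p + (-r : ℝ) * -Complex.I) - Real.pi * Complex.I := by
    have h : w - p + (-r : ℝ) * -Complex.I = -(p - r * Complex.I - w) := by push_cast; ring
    rw [h, Complex.log, Complex.log,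
      Complex.arg_neg_eq_arg_add_pi_of_im_neg (by simp; linarith), norm_neg]
    push_cast
    ring
  have i1 : ∫ x in p..q, ((x : ℂ) - r * Complex.I - w)⁻¹ =
      ∫ x in p..q, (-r * Complex.I - w + x * 1)⁻¹ := by
    refine intervalIntegral.integral_congr fun x _ => ?_
    ring_nf
  have i2 : ∫ y in (-r)..r, ((q : ℂ) + y * Complex.I - w)⁻¹ =
      ∫ x in (-r)..r, (q - w + x * Complex.I)⁻¹ := by
    refine intervalIntegral.integral_congr fun x _ => ?_
    ring_nf
  have i3 : ∫ x in p..q, ((x : ℂ) + r * Complex.I - w)⁻¹ =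
      ∫ x in p..q, (r * Complex.I - w + x * 1)⁻¹ := by
    refine intervalIntegral.integral_congr fun x _ => ?_
    ring_nf
  unfold rectangleIntegral
  simp only [smul_eq_mul]
  rw [one_mul] at e1 e3
  rw [i1, i2, i3, e1, e2, e3, e4]
  have c1 : -r * Complex.I - w + q * 1 = q - w + (-r : ℝ) * Complex.I := by push_cast; ring
  have c2 : q - w + r * Complex.I = r * Complex.I - w + q * 1 := by ring
  have c3 : r * Complex.I - w + p * 1 = p + r * Complex.I - w := by ring
  have c4 : -r * Complex.I - w + p * 1 = p - r * Complex.I - w := by ring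
  rw [c1, c2, c3, c4, hu, hl]
  ring

/-- The residue theorem on a rectangle, for a quotient with one simple pole. -/
theorem rectangleIntegral_inv_smul [CompleteSpace H] {F : ℂ → ℂ} {u : ℂ → H} {w : ℂ}
    (hw : w ∈ rectangle p q r) (hF : DifferentiableOn ℂ F (closedRectangle p q r))
    (hu : DifferentiableOn ℂ u (closedRectangle p q r)) (hFw : F w = 0) (hF' : deriv F w ≠ 0)
    (hF0 : ∀ z ∈ closedRectangle p q r, z ≠ w → F z ≠ 0) :
    rectangleIntegral (fun z => (F z)⁻¹ • u z) p q r =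
      (2 * Real.pi * Complex.I) • (deriv F w)⁻¹ • u w := by
  have hpq : p ≤ q := by linarith [hw.1, hw.2.1]
  have hr : 0 < r := (abs_nonneg _).trans_lt hw.2.2
  have hnhds : closedRectangle p q r ∈ 𝓝 w :=
    mem_of_superset ((isOpen_rectangle p q r).mem_nhds hw) (rectangle_subset_closedRectangle p q r)
  -- `F` factors as `(z - w)` times a nowhere vanishing analytic function, so the integrand is `(z -
  -- w)⁻¹ v(z)` with `v` analytic. Splitting off `v(w)` leaves `dslope v w`, whose integral vanishes
  -- by Cauchy's theorem.
  have hq : DifferentiableOn ℂ (dslope F w) (closedRectangle p q r) :=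
    (Complex.differentiableOn_dslope hnhds).2 hF
  have hq0 : ∀ z ∈ closedRectangle p q r, dslope F w z ≠ 0 := by
    intro z hz
    by_cases h : z = w
    · rw [h, dslope_same]; exact hF'
    · have := sub_smul_dslope F w z
      rw [hFw, sub_zero, smul_eq_mul] at this
      exact right_ne_zero_of_mul (this.trans_ne (hF0 z hz h))
  set v : ℂ → H := fun z => (dslope F w z)⁻¹ • u z with hv
  have hvd : DifferentiableOn ℂ v (closedRectangle p q r) := (hq.inv hq0).smul hu
  have hvd' : DifferentiableOn ℂ (dslope v w) (closedRectangle p q r) :=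
    (Complex.differentiableOn_dslope hnhds).2 hvd
  have hne : ∀ z ∈ closedRectangle p q r \ rectangle p q r, z ≠ w := fun z hz h => hz.2 (h ▸ hw)
  rw [rectangleIntegral_congr hpq hr (g := fun z => (z - w)⁻¹ • v w + dslope v w z),
    rectangleIntegral_add hpq hr, rectangleIntegral_smul_const, rectangleIntegral_inv_sub hw,
    rectangleIntegral_eq_zero hpq hr hvd', add_zero, hv]
  · simp only [dslope_same]
  · exact (ContinuousOn.inv₀ (by fun_prop) fun z hz => sub_ne_zero.2 (hne z hz)).smul
      continuousOn_const
  · exact hvd'.continuousOn.mono Set.sdiff_subset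
  · intro z hz
    have hzw : z - w ≠ 0 := sub_ne_zero.2 (hne z hz)
    have h1 := sub_smul_dslope F w z
    rw [hFw, sub_zero, smul_eq_mul] at h1
    have h2 := sub_smul_dslope v w z
    have h3 : dslope v w z = (z - w)⁻¹ • (v z - v w) := by
      rw [← h2, smul_smul, inv_mul_cancel₀ hzw, one_smul]
    rw [h3, ← h1, mul_inv, mul_smul, smul_sub]
    simp only [hv]
    abel

end Rectangle

/-! ### Root spaces and resolvents -/

namespace LinearPMap

variable {H : Type*} [NormedAddCommGroup H] [InnerProductSpace ℂ H] {T : H →ₗ.[ℂ] H}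
  {z l : ℂ} {R : H →L[ℂ] H}

theorem IsResolventAt.unique {R' : H →L[ℂ] H} (h : T.IsResolventAt z R)
    (h' : T.IsResolventAt z R') : R = R' := by
  ext x
  obtain ⟨hx, hx'⟩ := h.1 x
  have h1 := h'.2 ⟨R x, hx⟩
  rw [hx'] at h1
  exact h1.symm

theorem IsResolventAt.resolvent_eq (h : T.IsResolventAt z R) : T.resolvent z = R := by
  have h' : ∃ R, T.IsResolventAt z R := ⟨R, h⟩
  rw [LinearPMap.resolvent, dif_pos h']
  exact h'.choose_spec.unique h

theorem IsResolventAt.apply_of_sub_eq (h : T.IsResolventAt z R) {x y : H} (hx : x ∈ T.domain)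
    (hy : z • x - T ⟨x, hx⟩ = y) : R y = x := by
  rw [← hy]
  exact h.2 ⟨x, hx⟩

theorem mem_kerPow_succ {k : ℕ} {x : H} :
    x ∈ T.kerPow l (k + 1) ↔ ∃ hx : x ∈ T.domain, T ⟨x, hx⟩ - l • x ∈ T.kerPow l k := by
  rw [LinearPMap.kerPow, Submodule.mem_map]
  constructor
  · rintro ⟨⟨y, hy⟩, hy', rfl⟩
    exact ⟨hy, hy'⟩
  · rintro ⟨hx, hx'⟩
    exact ⟨⟨x, hx⟩, hx', rfl⟩

theorem kerPow_mono_succ (k : ℕ) : T.kerPow l k ≤ T.kerPow l (k + 1) := by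
  induction k with
  | zero => exact bot_le
  | succ k ih =>
    intro x hx
    obtain ⟨h, hx'⟩ := mem_kerPow_succ.1 hx
    exact mem_kerPow_succ.2 ⟨h, ih hx'⟩

theorem sub_smul_mem_kerPow {k : ℕ} {x : H} (hx : x ∈ T.kerPow l k) :
    ∃ h : x ∈ T.domain, T ⟨x, h⟩ - l • x ∈ T.kerPow l k :=
  mem_kerPow_succ.1 (kerPow_mono_succ k hx)

theorem SolvesEigen.mem_rootSpace {x : H} (h : T.SolvesEigen l x) : x ∈ T.rootSpace l := by
  obtain ⟨hx, h⟩ := h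
  refine Submodule.mem_iSup_of_mem 1 (mem_kerPow_succ.2 ⟨hx, ?_⟩)
  rw [h, sub_self]
  exact zero_mem _

theorem SolvesEigen.mem_spectrum {x : H} (h : T.SolvesEigen l x) (hx : x ≠ 0) :
    l ∈ T.spectrum := by
  rintro ⟨R, hR⟩
  obtain ⟨hxd, h⟩ := h
  have := hR.apply_of_sub_eq (y := 0) hxd (by rw [h, sub_self])
  rw [_root_.map_zero] at this
  exact hx this.symm

/-- On the domain `χ((T - l)x) = (ν - l) χ(x)`, so vanishing propagates from each kernel to the
next. This gives the biorthogonality between left eigenvectors and root vectors of other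
eigenvalues. -/
theorem rootSpace_le_ker {χ : H →ₗ[ℂ] ℂ} {ν : ℂ} (hχ : ∀ u : T.domain, χ (T u) = ν * χ u)
    (hl : l ≠ ν) : T.rootSpace l ≤ LinearMap.ker χ := by
  refine iSup_le fun k => ?_
  induction k with
  | zero => exact bot_le
  | succ k ih =>
    intro x hx
    obtain ⟨h, hx'⟩ := mem_kerPow_succ.1 hx
    have h1 : χ (T ⟨x, h⟩ - l • x) = 0 := ih hx'
    rw [_root_.map_sub, hχ, _root_.map_smul, smul_eq_mul, ← sub_mul] at h1
    exact (mul_eq_zero.1 h1).resolve_left (sub_ne_zero.2 hl.symm)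

theorem IsResolventAt.injective (h : T.IsResolventAt z R) {x : H} (hx : R x = 0) : x = 0 := by
  obtain ⟨h1, h2⟩ := h.1 x
  have : (⟨R x, h1⟩ : T.domain) = 0 := Subtype.ext hx
  rw [← h2, this, hx]
  simp

theorem IsResolventAt.rootSpace_self (h : T.IsResolventAt z R) : T.rootSpace z = ⊥ := by
  refine iSup_eq_bot.2 fun k => ?_
  induction k with
  | zero => rfl
  | succ k ih =>
    refine (Submodule.eq_bot_iff _).2 fun x hx => ?_
    obtain ⟨hxd, hx'⟩ := mem_kerPow_succ.1 hx
    rw [ih, Submodule.mem_bot] at hx'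
    have := h.apply_of_sub_eq (y := 0) hxd (by rw [← neg_sub, hx', neg_zero])
    rw [← this, _root_.map_zero]

/-- On the domain `R - (z - l)⁻¹ = (z - l)⁻¹ R (T - l)`, and `R` commutes with the left side. Root
spaces of the unbounded `T` thus become generalized eigenspaces of the bounded `R`. -/
theorem IsResolventAt.kerPow_eq (h : T.IsResolventAt z R) (hl : z ≠ l) (k : ℕ) :
    T.kerPow l k = LinearMap.ker (((R : H →ₗ[ℂ] H) - (z - l)⁻¹ • 1) ^ k) := by
  have hzl : z - l ≠ 0 := sub_ne_zero.2 hl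
  set f : Module.End ℂ H := (R : H →ₗ[ℂ] H) - (z - l)⁻¹ • 1 with hf
  have hfx : ∀ x, f x = R x - (z - l)⁻¹ • x := fun x => by simp [hf]
  have hcomm : Commute f (R : H →ₗ[ℂ] H) := by
    rw [hf]
    exact (Commute.refl _).sub_left ((Commute.one_left _).smul_left _)
  induction k with
  | zero => ext x; simp [LinearPMap.kerPow, Module.End.one_eq_id]
  | succ k ih =>
    ext x
    rw [LinearMap.mem_ker, pow_succ, Module.End.mul_apply]
    constructor
    · intro hx
      obtain ⟨hxd, hx'⟩ := mem_kerPow_succ.1 hx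
      rw [ih, LinearMap.mem_ker] at hx'
      have h1 : f x = (z - l)⁻¹ • R (T ⟨x, hxd⟩ - l • x) := by
        have h2 := h.apply_of_sub_eq hxd rfl
        have h3 : z • x - T ⟨x, hxd⟩ = (z - l) • x - (T ⟨x, hxd⟩ - l • x) := by
          rw [sub_smul]; abel
        rw [h3, _root_.map_sub, _root_.map_smul] at h2
        have h4 : R (T ⟨x, hxd⟩ - l • x) = (z - l) • R x - x := by
          rw [eq_sub_iff_add_eq, add_comm]
          exact (sub_eq_iff_eq_add.1 h2).symm
        rw [h4, hfx, smul_sub, smul_smul, inv_mul_cancel₀ hzl, one_smul]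
      rw [h1, _root_.map_smul]
      have h5 : (f ^ k) (R (T ⟨x, hxd⟩ - l • x)) = R ((f ^ k) (T ⟨x, hxd⟩ - l • x)) :=
        LinearMap.congr_fun (hcomm.pow_left k).eq _
      rw [h5, hx', _root_.map_zero, smul_zero]
    · intro hx
      set v := f x with hv
      have hvk : v ∈ T.kerPow l k := by rw [ih]; exact hx
      obtain ⟨hvd, hv'⟩ := sub_smul_mem_kerPow hvk
      obtain ⟨hRd, hR⟩ := h.1 x
      have hx1 : x = (z - l) • (R x - v) := by
        rw [hv, hfx, sub_sub_cancel, smul_smul, mul_inv_cancel₀ hzl, one_smul]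
      have hxd : x ∈ T.domain := by
        rw [hx1]
        exact Submodule.smul_mem _ _ (Submodule.sub_mem _ hRd hvd)
      refine mem_kerPow_succ.2 ⟨hxd, ?_⟩
      have hTx : T ⟨x, hxd⟩ = (z - l) • (T ⟨R x, hRd⟩ - T ⟨v, hvd⟩) := by
        rw [← T.map_sub, ← T.map_smul]
        congr 1
        exact Subtype.ext hx1
      have hTR : T ⟨R x, hRd⟩ = z • R x - x := by
        rw [eq_sub_iff_add_eq, add_comm]
        exact (sub_eq_iff_eq_add.1 hR).symm
      have h6 : (z - l) • R x = (z - l) • v + x := by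
        conv_rhs => rw [hx1]
        module
      have : T ⟨x, hxd⟩ - l • x = (z - l) • (-(T ⟨v, hvd⟩ - l • v) + (z - l) • v) := by
        rw [hTx, hTR]
        linear_combination (norm := module) z • h6
      rw [this]
      exact Submodule.smul_mem _ _
        (Submodule.add_mem _ (Submodule.neg_mem _ hv') (Submodule.smul_mem _ _ hvk))

theorem IsResolventAt.rootSpace_eq (h : T.IsResolventAt z R) (hl : z ≠ l) :
    T.rootSpace l = Module.End.maxGenEigenspace (R : H →ₗ[ℂ] H) (z - l)⁻¹ := by
  rw [Module.End.maxGenEigenspace, Module.End.genEigenspace_top, LinearPMap.rootSpace]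
  refine iSup_congr fun k => ?_
  rw [h.kerPow_eq hl, Module.End.genEigenspace_nat]

theorem IsResolventAt.iSupIndep_rootSpace (h : T.IsResolventAt z R) :
    iSupIndep fun l : {l // l ≠ z} => T.rootSpace l := by
  have h1 := (Module.End.independent_maxGenEigenspace (R : H →ₗ[ℂ] H)).comp
    (f := fun l : {l // l ≠ z} => (z - l)⁻¹) (by
      rintro ⟨a, ha⟩ ⟨b, hb⟩ hab
      exact Subtype.ext (sub_right_injective (inv_injective hab)))
  convert! h1 using 1
  ext1 l
  exact h.rootSpace_eq l.2.symm

/-- The vectors of a root system are linearly independent. -/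
theorem IsRootSystem.linearIndependent_all {l : ℕ → ℂ} {x : ℕ → H} (h : T.IsResolventAt z R)
    (hx : T.IsRootSystem l x) : LinearIndependent ℂ x := by
  have hlz : ∀ n, l n ≠ z := by
    rintro n rfl
    have : l n ∈ T.spectrum := hx.range_eq ▸ Set.mem_range_self n
    exact this ⟨R, h⟩
  have hmem : ∀ n, x n ∈ T.rootSpace (l n) := fun n => by
    rw [← hx.span_eq n]
    exact Submodule.subset_span ⟨n, rfl, rfl⟩
  rw [linearIndependent_iff']
  intro s g hg i hi
  set l' : ℕ → {l // l ≠ z} := fun n => ⟨l n, hlz n⟩ with hl'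
  have h1 := (iSupIndep_iff_finsetSum_eq_zero_imp_eq_zero _).1 h.iSupIndep_rootSpace
    (s.image l') (fun w => ∑ n ∈ s with l' n = w, g n • x n) (fun w _ =>
      Submodule.sum_mem _ fun n hn => Submodule.smul_mem _ _ (by
        rw [← (Finset.mem_filter.1 hn).2]; exact hmem n))
    (by rw [Finset.sum_fiberwise_of_maps_to fun n hn => Finset.mem_image_of_mem _ hn]; exact hg)
    (l' i) (Finset.mem_image_of_mem _ hi)
  have h2 : LinearIndepOn ℂ x {n | l n = l i} := hx.linearIndependent i
  refine linearIndepOn_iff'.1 h2 (s.filter fun n => l' n = l' i) g ?_ h1 i (by simp [hi])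
  intro n hn
  have : l' n = l' i := by simpa using (Finset.mem_filter.1 hn).2
  exact congrArg Subtype.val this

end LinearPMap

theorem Module.End.exists_basis_maxGenEigenspace {M : Type*} [AddCommGroup M] [Module ℂ M]
    [FiniteDimensional ℂ M] (f : Module.End ℂ M) {N : ℕ} (hN : Module.finrank ℂ M = N) :
    ∃ (b : Module.Basis (Fin N) ℂ M) (w : Fin N → ℂ), (∀ i, b i ∈ f.maxGenEigenspace (w i)) ∧
      ∀ z, f.maxGenEigenspace z ≤ Submodule.span ℂ (b '' {i | w i = z}) := by
  have hint : DirectSum.IsInternal f.maxGenEigenspace :=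
    DirectSum.isInternal_submodule_of_iSupIndep_of_iSup_eq_top
      f.independent_maxGenEigenspace f.iSup_maxGenEigenspace_eq_top
  set c := hint.collectedBasis fun z => Module.finBasis ℂ (f.maxGenEigenspace z) with hc
  have hfin : Finite (Σ z : ℂ, Fin (Module.finrank ℂ (f.maxGenEigenspace z))) :=
    Module.Finite.finite_basis c
  have := Fintype.ofFinite (Σ z : ℂ, Fin (Module.finrank ℂ (f.maxGenEigenspace z)))
  have hcard : Fintype.card (Σ z : ℂ, Fin (Module.finrank ℂ (f.maxGenEigenspace z))) = N := by
    rw [← hN, Module.finrank_eq_card_basis c]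
  set σ := Fintype.equivFinOfCardEq hcard with hσ
  refine ⟨c.reindex σ, fun i => (σ.symm i).1, fun i => ?_, fun z x hx => ?_⟩
  · rw [Module.Basis.reindex_apply]
    exact hint.collectedBasis_mem _ _
  · rw [← c.sum_repr x]
    refine Submodule.sum_mem _ fun i _ => ?_
    by_cases hi : i.1 = z
    · exact Submodule.smul_mem _ _ (Submodule.subset_span ⟨σ i, by simpa using hi, by simp⟩)
    · have : c.repr x i = 0 :=
        hint.collectedBasis_repr_of_mem_ne
          (fun z => Module.finBasis ℂ (f.maxGenEigenspace z)) (a := i.2) (Ne.symm hi) hx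
      rw [this, zero_smul]
      exact zero_mem _

namespace LinearPMap

variable {H : Type*} [NormedAddCommGroup H] [InnerProductSpace ℂ H] {T : H →ₗ.[ℂ] H}
  {z₀ : ℂ} {R : H →L[ℂ] H}

/-- If all but `N` dimensions are accounted for by eigenvectors `v k`, `k ≥ N`, with a dual system
`χ k` of left eigenvectors, then these eigenvectors can be completed to a root system. -/
theorem exists_isRootSystem (hR : T.IsResolventAt z₀ R)
    (hspec : ∀ z ∈ T.spectrum, ∃ x, x ≠ 0 ∧ T.SolvesEigen z x) {N : ℕ} {χ : ℕ → H →ₗ[ℂ] ℂ}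
    {ν : ℕ → ℂ} {v : ℕ → H} (hχ : ∀ k ≥ N, ∀ u : T.domain, χ k (T u) = ν k * χ k u)
    (hv : ∀ k ≥ N, T.SolvesEigen (ν k) (v k)) (hχv : ∀ k ≥ N, χ k (v k) ≠ 0)
    (hν : ∀ j ≥ N, ∀ k ≥ N, ν j = ν k → j = k) {M : Submodule ℂ H}
    (hM : ∀ x, x ∈ M ↔ ∀ k ≥ N, χ k x = 0) [FiniteDimensional ℂ M]
    (hdim : Module.finrank ℂ M = N) :
    ∃ (l : ℕ → ℂ) (x : ℕ → H), T.IsRootSystem l x ∧ ∀ k ≥ N, x k = v k := by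
  have hv0 : ∀ k ≥ N, v k ≠ 0 := fun k hk h => hχv k hk (by rw [h, _root_.map_zero])
  have hz₀ : ∀ z ∈ T.spectrum, z₀ ≠ z := fun z hz h => hz (h ▸ ⟨R, hR⟩)
  have hνs : ∀ k ≥ N, ν k ∈ T.spectrum := fun k hk => (hv k hk).mem_spectrum (hv0 k hk)
  -- Applying a left eigenvector to `z₀ R x - T R x = x` multiplies its value at `R x` by `z₀ - ν
  -- k`, which is nonzero.
  have hRM : ∀ x ∈ M, (R : H →ₗ[ℂ] H) x ∈ M := by
    intro x hx
    rw [hM] at hx ⊢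
    intro k hk
    obtain ⟨h1, h2⟩ := hR.1 x
    have h3 := hx k hk
    rw [← h2, _root_.map_sub, _root_.map_smul, hχ k hk, smul_eq_mul, ← sub_mul] at h3
    exact (mul_eq_zero.1 h3).resolve_left (sub_ne_zero.2 (hz₀ _ (hνs k hk)))
  set f : Module.End ℂ M := (R : H →ₗ[ℂ] H).restrict hRM with hf
  obtain ⟨b, w, hbw, hspan⟩ := f.exists_basis_maxGenEigenspace hdim
  have hgen : ∀ (c : ℂ) (y : M),
      y ∈ f.maxGenEigenspace c ↔ (y : H) ∈ Module.End.maxGenEigenspace (R : H →ₗ[ℂ] H) c := by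
    intro c y
    rw [hf, Module.End.maxGenEigenspace, Module.End.genEigenspace_restrict, Submodule.mem_comap]
    rfl
  have hw0 : ∀ i, w i ≠ 0 := by
    intro i hi
    have h1 := (hgen _ _).1 (hbw i)
    rw [hi, Module.End.maxGenEigenspace, Module.End.mem_genEigenspace_top] at h1
    obtain ⟨k, hk⟩ := h1
    rw [zero_smul, sub_zero, LinearMap.mem_ker] at hk
    have h2 : ∀ (k : ℕ) (y : H), ((R : H →ₗ[ℂ] H) ^ k) y = 0 → y = 0 := by
      intro k
      induction k with
      | zero => intro y hy; simpa using hy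
      | succ k ih =>
        intro y hy
        rw [pow_succ, Module.End.mul_apply] at hy
        exact hR.injective (ih _ hy)
    exact b.ne_zero i (Subtype.ext (h2 k _ hk))
  -- An eigenvalue `w` of the resolvent at `z₀` belongs to the eigenvalue `z₀ - w⁻¹` of `T`; the
  -- first `N` places are filled from the restriction of `R` to `M`.
  set l : ℕ → ℂ := fun n => if h : n < N then z₀ - (w ⟨n, h⟩)⁻¹ else ν n with hl
  set x : ℕ → H := fun n => if h : n < N then (b ⟨n, h⟩ : H) else v n with hx
  have hlN : ∀ k ≥ N, l k = ν k := fun k hk => by simp [hl, not_lt.2 hk]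
  have hxN : ∀ k ≥ N, x k = v k := fun k hk => by simp [hx, not_lt.2 hk]
  have hli : ∀ i : Fin N, l i = z₀ - (w i)⁻¹ := fun i => by simp [hl]
  have hxi : ∀ i : Fin N, x i = b i := fun i => by simp [hx]
  have hmem : ∀ n, x n ∈ T.rootSpace (l n) := by
    intro n
    rcases lt_or_ge n N with h | h
    · have h1 := hli ⟨n, h⟩
      have h2 := hxi ⟨n, h⟩
      simp only at h1 h2
      have h3 : z₀ ≠ l n := by
        rw [h1]
        intro h4
        exact inv_ne_zero (hw0 _) (sub_eq_self.1 h4.symm)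
      rw [hR.rootSpace_eq h3, h2, ← hgen, h1, sub_sub_cancel, inv_inv]
      exact hbw _
    · rw [hlN n h, hxN n h]
      exact (hv n h).mem_rootSpace
  have hχx : ∀ k ≥ N, ∀ n, n ≠ k → χ k (x n) = 0 := by
    intro k hk n hn
    rcases lt_or_ge n N with h | h
    · rw [show x n = b ⟨n, h⟩ from hxi ⟨n, h⟩]
      exact (hM _).1 (b ⟨n, h⟩).2 k hk
    · exact rootSpace_le_ker (hχ k hk) (fun h1 => hn (hν n h k hk (by rw [← hlN n h, h1])))
        (hmem n)
  have hind : LinearIndependent ℂ x := by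
    rw [linearIndependent_iff']
    intro s g hg
    have hlarge : ∀ k ∈ s, N ≤ k → g k = 0 := by
      intro k hks hk
      have h1 := congrArg (χ k) hg
      rw [map_sum, _root_.map_zero, Finset.sum_eq_single k, _root_.map_smul, smul_eq_mul,
        hxN k hk] at h1
      · exact (mul_eq_zero.1 h1).resolve_right (hχv k hk)
      · intro n _ hn
        rw [_root_.map_smul, hχx k hk n hn, smul_zero]
      · exact fun h => absurd hks h
    have hbi : LinearIndependent ℂ fun i : Fin N => x i := by
      have := b.linearIndependent.map' M.subtype M.ker_subtype
      convert! this using 1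
      ext i
      exact hxi i
    have h2 : ∑ i : Fin N, (if (i : ℕ) ∈ s then g i else 0) • x i = 0 := by
      rw [Fin.sum_univ_eq_sum_range (fun i => (if i ∈ s then g i else 0) • x i) N, ← hg]
      simp only [ite_smul, zero_smul]
      rw [← Finset.sum_filter]
      refine Finset.sum_subset_zero_on_sdiff (fun i hi => (Finset.mem_filter.1 hi).2)
        (fun i hi => ?_) fun _ _ => rfl
      simp only [Finset.mem_sdiff, Finset.mem_filter, Finset.mem_range, not_and] at hi
      rw [hlarge i hi.1 (not_lt.1 fun h => hi.2 h hi.1), zero_smul]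
    intro i his
    rcases lt_or_ge i N with h | h
    · have := Fintype.linearIndependent_iff.1 hbi _ h2 ⟨i, h⟩
      simpa [his] using this
    · exact hlarge i his h
  have hsub : ∀ z, ∀ y ∈ T.rootSpace z, y ∈ M → y ∈ Submodule.span ℂ (x '' {n | l n = z}) := by
    intro z y hy hyM
    by_cases hz : z₀ = z
    · rw [← hz, hR.rootSpace_self, Submodule.mem_bot] at hy
      rw [hy]
      exact zero_mem _
    rw [hR.rootSpace_eq hz] at hy
    have h1 := hspan _ ((hgen _ ⟨y, hyM⟩).2 hy)
    have h2 := Submodule.mem_map_of_mem (f := M.subtype) h1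
    rw [Submodule.map_span] at h2
    refine Submodule.span_mono ?_ h2
    rintro _ ⟨_, ⟨i, hi, rfl⟩, rfl⟩
    refine ⟨i, ?_, hxi i⟩
    change l i = z
    rw [hli, show w i = _ from hi, inv_inv, sub_sub_cancel]
  have hspan_eq : ∀ m, Submodule.span ℂ (x '' {n | l n = l m}) = T.rootSpace (l m) := by
    intro m
    refine le_antisymm (Submodule.span_le.2 ?_) fun y hy => ?_
    · rintro _ ⟨n, hn, rfl⟩
      have := hmem n
      rwa [show l n = l m from hn] at this
    · by_cases hk : ∃ k ≥ N, ν k = l m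
      · obtain ⟨k, hkN, hk⟩ := hk
        have hvk : v k ∈ T.rootSpace (l m) := hk ▸ (hv k hkN).mem_rootSpace
        -- Removing the component along `v k` lands in `M`: `χ k` vanishes by the choice of
        -- coefficient, the other functionals because their eigenvalues differ from `l m`.
        have h1 : y - (χ k y / χ k (v k)) • v k ∈ Submodule.span ℂ (x '' {n | l n = l m}) := by
          have h2 := Submodule.sub_mem _ hy (Submodule.smul_mem _ (χ k y / χ k (v k)) hvk)
          refine hsub _ _ h2 ((hM _).2 fun j hj => ?_)
          by_cases hjk : j = k
          · rw [hjk, _root_.map_sub, _root_.map_smul, smul_eq_mul,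
              div_mul_cancel₀ _ (hχv k hkN), sub_self]
          · exact rootSpace_le_ker (hχ j hj)
              (fun h => hjk (hν j hj k hkN (by rw [hk, h]))) h2
        have h3 : v k ∈ Submodule.span ℂ (x '' {n | l n = l m}) :=
          Submodule.subset_span ⟨k, (hlN k hkN).trans hk, hxN k hkN⟩
        have := Submodule.add_mem _ h1 (Submodule.smul_mem _ (χ k y / χ k (v k)) h3)
        rwa [sub_add_cancel] at this
      · push Not at hk
        exact hsub _ _ hy ((hM _).2 fun j hj => rootSpace_le_ker (hχ j hj) (hk j hj).symm hy)
  refine ⟨l, x, ⟨?_, fun m => ?_, fun m => ?_, hspan_eq⟩, hxN⟩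
  · refine Set.Subset.antisymm ?_ fun z hz => ?_
    · rintro _ ⟨n, rfl⟩ ⟨R', hR'⟩
      have h1 := hmem n
      rw [hR'.rootSpace_self, Submodule.mem_bot] at h1
      exact hind.ne_zero n h1
    · by_contra hzl
      obtain ⟨y, hy0, hy⟩ := hspec z hz
      have h1 : y ∈ M := (hM y).2 fun k hk => rootSpace_le_ker (hχ k hk)
        (fun h => hzl ⟨k, (hlN k hk).trans h.symm⟩) hy.mem_rootSpace
      have h2 := hsub z y hy.mem_rootSpace h1
      have h3 : {n | l n = z} = ∅ := Set.eq_empty_of_forall_notMem fun n hn => hzl ⟨n, hn⟩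
      rw [h3, Set.image_empty, Submodule.span_empty, Submodule.mem_bot] at h2
      exact hy0 h2
  · rw [← hspan_eq m]
    refine FiniteDimensional.span_of_finite ℂ (Set.Finite.image _ ?_)
    have h1 : {n | l n = l m} ⊆ Set.Iio N ∪ {n | N ≤ n ∧ l n = l m} := fun n hn =>
      (lt_or_ge n N).imp id fun h => ⟨h, hn⟩
    refine ((Set.finite_Iio N).union (Set.Subsingleton.finite ?_)).subset h1
    rintro j ⟨hj, hj'⟩ k ⟨hk, hk'⟩
    exact hν j hj k hk (by rw [← hlN j hj, ← hlN k hk, hj', hk'])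
  · exact hind.comp _ Subtype.val_injective

end LinearPMap

/-! ### The operator pencil of a perturbed form -/

theorem ENNReal.exists_tsum_ite_le {f : ℕ → ℝ≥0∞} (hf : ∑' n, f n ≠ ⊤) {ε : ℝ≥0∞} (hε : 0 < ε) :
    ∃ N, ∑' n, (if N ≤ n then f n else 0) ≤ ε := by
  obtain ⟨N, hN⟩ := ((ENNReal.tendsto_sum_nat_add f hf).eventually_le_const hε).exists
  refine ⟨N, le_of_eq_of_le ?_ hN⟩
  rw [← (add_left_injective N).tsum_eq]
  · simp
  · intro n hn
    have h : N ≤ n := by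
      by_contra h
      simp [h] at hn
    exact ⟨n - N, by simp [h]⟩

theorem summable_of_tsum_ofReal_ne_top {f : ℕ → ℝ} (hf : ∀ n, 0 ≤ f n)
    (h : ∑' n, ENNReal.ofReal (f n) ≠ ⊤) : Summable f := by
  simpa [ENNReal.toReal_ofReal (hf _)] using ENNReal.summable_toReal h

namespace SeparatedWeights

variable {μ p q₁ q₂ : ℕ → ℝ} (h : SeparatedWeights μ p q₁ q₂)
include h

theorem sqrt_pos (n : ℕ) : 0 < √(μ n) := Real.sqrt_pos.2 (h.pos n)

theorem div_sqrt_pos (n : ℕ) : 0 < p n / √(μ n) := div_pos (h.weight_pos n) (h.sqrt_pos n)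

theorem mul_div_sqrt_sq (n : ℕ) : μ n * (p n / √(μ n)) ^ 2 = p n ^ 2 := by
  have := (h.pos n).ne'
  rw [div_pow, Real.sq_sqrt (h.pos n).le]
  field_simp

/-- Row 0 of the gap sums already contains this: `p_n²/μ_n ≤ p_n²/|μ_0 - μ_n|` as soon as `μ_n >
μ_0`. -/
theorem summable_div_sqrt_sq : Summable fun n => (p n / √(μ n)) ^ 2 := by
  obtain ⟨N, hN⟩ := h.tsum_le 1 one_pos
  set f : ℕ → ℝ := fun n => if n ≠ 0 ∧ (N ≤ 0 ∨ N ≤ n) then p n ^ 2 / |μ 0 - μ n| else 0 with hf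
  have hs : Summable f := by
    refine summable_of_tsum_ofReal_ne_top (fun n => ?_) ?_
    · rw [hf]; dsimp only; split_ifs <;> positivity
    · refine ne_top_of_le_ne_top ENNReal.ofReal_ne_top (le_trans (le_of_eq ?_) (hN 0))
      refine tsum_congr fun n => ?_
      rw [hf]; dsimp only; split_ifs <;> simp
  refine hs.of_norm_bounded_eventually_nat ?_
  filter_upwards [eventually_ge_atTop (N + 1), h.tendsto_atTop.eventually_gt_atTop (μ 0)]
    with n hn hμn
  rw [hf]
  have h1 : n ≠ 0 ∧ (N ≤ 0 ∨ N ≤ n) := ⟨by omega, Or.inr (by omega)⟩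
  simp only [if_pos h1]
  rw [Real.norm_of_nonneg (sq_nonneg _), div_pow, Real.sq_sqrt (h.pos n).le,
    abs_sub_comm, abs_of_pos (sub_pos.2 hμn)]
  have := sub_pos.2 hμn
  gcongr
  linarith [h.pos 0]

theorem tsum_ofReal_div_sqrt_sq_ne_top : ∑' n, ENNReal.ofReal (p n / √(μ n)) ^ 2 ≠ ⊤ := by
  simp_rw [← ENNReal.ofReal_pow (h.div_sqrt_pos _).le]
  exact h.summable_div_sqrt_sq.tsum_ofReal_ne_top

end SeparatedWeights

section Pencil

variable {V : Type*} [NormedAddCommGroup V] [InnerProductSpace ℂ V]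

/-- The data of a form `t` whose operator is `1 + K - z J` in the energy space, in terms of the
eigenbasis `e` of the unperturbed form. -/
structure SubordinatePencil (e : HilbertBasis ℕ ℂ V) (J K : V →L[ℂ] V) (μ p q₁ q₂ : ℕ → ℝ)
    (M : ℝ) : Prop extends SeparatedWeights μ p q₁ q₂ where
  M_pos : 0 < M
  apply_J : ∀ n, J (e n) = ((μ n)⁻¹ : ℂ) • e n
  norm_inner_K_le : ∀ m n, ‖inner ℂ (e m) (K (e n))‖ ≤ M * (p m / √(μ m)) * (p n / √(μ n))

namespace SubordinatePencil

variable {e : HilbertBasis ℕ ℂ V} {J K : V →L[ℂ] V} {μ p q₁ q₂ : ℕ → ℝ} {M : ℝ}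
  (h : SubordinatePencil e J K μ p q₁ q₂ M)
include h

/-- The entry bound is symmetric, so everything proved for the pencil also holds for the adjoint
one, which supplies the left eigenvectors. -/
theorem adjoint [CompleteSpace V] :
    SubordinatePencil e J (ContinuousLinearMap.adjoint K) μ p q₁ q₂ M :=
  { h with
    norm_inner_K_le := fun m n => by
      rw [ContinuousLinearMap.adjoint_inner_right, norm_inner_symm]
      refine (h.norm_inner_K_le n m).trans (le_of_eq ?_)
      ring }

/-- The dominating matrix is of rank one with a square summable vector `w`; Schur's test with weight
`w` bounds its tail block by the tail of `∑ w_n²`. -/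
theorem isCompactOperator_K [CompleteSpace V] : IsCompactOperator K := by
  refine e.isCompactOperator_of_kernel K
    (k := fun m n => ENNReal.ofReal M *
      (ENNReal.ofReal (p m / √(μ m)) * ENNReal.ofReal (p n / √(μ n)))) (fun m n => ?_)
    fun ε hε => ?_
  · rw [← ENNReal.ofReal_mul (h.div_sqrt_pos m).le, ← ENNReal.ofReal_mul h.M_pos.le, ← ofReal_norm,
      ← mul_assoc]
    exact ENNReal.ofReal_le_ofReal (h.norm_inner_K_le m n)
  · set w : ℕ → ℝ≥0∞ := fun n => ENNReal.ofReal (p n / √(μ n)) with hw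
    have hr : 0 < √ε / M := div_pos (Real.sqrt_pos.2 hε) h.M_pos
    obtain ⟨N, hN⟩ := ENNReal.exists_tsum_ite_le h.tsum_ofReal_div_sqrt_sq_ne_top
      (ENNReal.ofReal_pos.2 hr)
    refine ⟨N, ?_⟩
    have h1 : KernelBound (fun m n => if N ≤ m ∧ N ≤ n then w m * w n else 0)
        (ENNReal.ofReal (√ε / M) * ENNReal.ofReal (√ε / M)) := by
      refine KernelBound.of_weight (p := w) (fun n => (ENNReal.ofReal_pos.2 (h.div_sqrt_pos n)).ne')
        (fun n => ENNReal.ofReal_ne_top) (fun m => ?_) (fun n => ?_)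
      · refine le_trans ?_ (mul_le_mul_left hN _)
        rw [← ENNReal.tsum_mul_right]
        refine ENNReal.tsum_le_tsum fun n => ?_
        by_cases hn : N ≤ n <;> by_cases hm : N ≤ m <;> simp [hn, hm]
        exact le_of_eq (by ring)
      · refine le_trans ?_ (mul_le_mul_left hN _)
        rw [← ENNReal.tsum_mul_right]
        refine ENNReal.tsum_le_tsum fun m => ?_
        by_cases hn : N ≤ n <;> by_cases hm : N ≤ m <;> simp [hn, hm]
        exact le_of_eq (by ring)
    refine (h1.const_mul (ENNReal.ofReal M)).mono (fun m n => ?_) (le_of_eq ?_)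
    · split_ifs <;> simp [hw]
    · rw [← ENNReal.ofReal_mul hr.le, ← ENNReal.ofReal_pow h.M_pos.le,
        ← ENNReal.ofReal_mul (sq_nonneg _)]
      congr 1
      have := h.M_pos.ne'
      field_simp
      exact Real.sq_sqrt hε.le

theorem isCompactOperator_J [CompleteSpace V] : IsCompactOperator J := by
  refine e.isCompactOperator_of_kernel J
    (k := fun m n => if m = n then ENNReal.ofReal (μ n)⁻¹ else 0) (fun m n => ?_)
    fun ε hε => ?_
  · rw [h.apply_J, inner_smul_right, e.inner_eq_ite]
    split_ifs
    · rw [mul_one, ← Complex.ofReal_inv, ← ofReal_norm, Complex.norm_real,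
        Real.norm_of_nonneg (inv_nonneg.2 (h.pos n).le)]
    · simp
  · obtain ⟨N, hN⟩ := eventually_atTop.1
      (h.tendsto_atTop.inv_tendsto_atTop.eventually_le_const (Real.sqrt_pos.2 hε))
    refine ⟨N, (KernelBound.diagonal (d := fun n => if N ≤ n then ENNReal.ofReal (μ n)⁻¹ else 0)
      (R := ENNReal.ofReal √ε) fun n => ?_).mono (fun m n => ?_) (le_of_eq ?_)⟩
    · split_ifs with hn
      · exact ENNReal.ofReal_le_ofReal (hN n hn)
      · exact zero_le
    · by_cases hmn : m = n <;> simp [hmn]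
    · rw [← ENNReal.ofReal_mul (Real.sqrt_nonneg _), Real.mul_self_sqrt hε.le]

theorem inner_J (m : ℕ) (x : V) : inner ℂ (e m) (J x) = ((μ m)⁻¹ : ℂ) * inner ℂ (e m) x := by
  have h1 := (e.hasSum_inner_smul x).mapL ((innerSL ℂ (e m)).comp J)
  have h2 : HasSum (fun n => inner ℂ (e n) x * (((μ n)⁻¹ : ℂ) * if m = n then (1 : ℂ) else 0))
      (inner ℂ (e m) (J x)) := by
    simpa [inner_smul_right, h.apply_J, e.inner_eq_ite] using h1
  rw [← h2.tsum_eq, tsum_eq_single m (by intro n hn; simp [hn.symm])]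
  simp [mul_comm]

theorem summable_weight_mul_norm_inner (x : V) :
    Summable fun n => p n / √(μ n) * ‖inner ℂ (e n) x‖ := by
  have hx : Summable fun n => ‖inner ℂ (e n) x‖ ^ 2 := e.orthonormal.inner_products_summable x
  refine Summable.of_nonneg_of_le (fun n => mul_nonneg (h.div_sqrt_pos n).le (norm_nonneg _))
    (fun n => ?_) ((h.summable_div_sqrt_sq.add hx))
  nlinarith [sq_nonneg (p n / √(μ n) - ‖inner ℂ (e n) x‖), sq_nonneg (p n / √(μ n)),
    sq_nonneg ‖inner ℂ (e n) x‖]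

theorem norm_inner_K_apply_le (m : ℕ) (x : V) :
    ‖inner ℂ (e m) (K x)‖ ≤ M * (p m / √(μ m)) * ∑' n, p n / √(μ n) * ‖inner ℂ (e n) x‖ := by
  have h1 := (e.hasSum_inner_smul x).mapL ((innerSL ℂ (e m)).comp K)
  have h2 : HasSum (fun n => inner ℂ (e n) x * inner ℂ (e m) (K (e n)))
      (inner ℂ (e m) (K x)) := by
    simpa [inner_smul_right] using h1
  rw [← h2.tsum_eq]
  refine tsum_of_norm_bounded (((h.summable_weight_mul_norm_inner x).hasSum).mul_left _)
    fun n => ?_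
  rw [norm_mul]
  calc ‖inner ℂ (e n) x‖ * ‖inner ℂ (e m) (K (e n))‖
      ≤ ‖inner ℂ (e n) x‖ * (M * (p m / √(μ m)) * (p n / √(μ n))) := by
        gcongr; exact h.norm_inner_K_le m n
    _ = _ := by ring

theorem inner_pencil (z : ℂ) (m : ℕ) (x : V) :
    inner ℂ (e m) (x + K x - z • J x) =
      ((μ m - z) / μ m : ℂ) * inner ℂ (e m) x + inner ℂ (e m) (K x) := by
  have hμ : (μ m : ℂ) ≠ 0 := by exact_mod_cast (h.pos m).ne'
  rw [inner_sub_right, inner_add_right, inner_smul_right, h.inner_J]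
  field_simp
  ring

/-- An a priori estimate for solutions of all but one of the eigenvalue equations. -/
theorem norm_inner_le_of_eq_zero {n : ℕ} {z : ℂ}
    (hgap : ∀ j ≠ n, μ j ≠ μ n)
    (hz : ∀ j ≠ n, |μ n - μ j| / 2 ≤ ‖z - μ j‖)
    (hσ : ∑' j : ℕ, (if j ≠ n then ENNReal.ofReal (p j ^ 2 / |μ n - μ j|) else 0) ≤
      ENNReal.ofReal (1 / (4 * M)))
    {x : V} (hx : ∀ m ≠ n, inner ℂ (e m) (x + K x - z • J x) = 0) :
    (∑' j, p j / √(μ j) * ‖inner ℂ (e j) x‖ ≤ 2 * (p n / √(μ n) * ‖inner ℂ (e n) x‖)) ∧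
    ∀ m ≠ n, ‖inner ℂ (e m) x‖ ≤
      4 * M * (μ m * (p m / √(μ m)) * (p n / √(μ n)) / |μ n - μ m|) * ‖inner ℂ (e n) x‖ := by
  have hM := h.M_pos
  -- The `m`-th equation bounds the `m`-th coordinate by a multiple of `τ`. Multiplying by the
  -- weight and summing over `m ≠ n` returns at most `τ/2`, by the constant `1/(4M)` in `hσ`. Hence
  -- `τ` is at most twice its `n`-th term.
  set τ := ∑' j, p j / √(μ j) * ‖inner ℂ (e j) x‖ with hτ
  have hsum := h.summable_weight_mul_norm_inner x
  have hτ0 : 0 ≤ τ := tsum_nonneg fun j => mul_nonneg (h.div_sqrt_pos j).le (norm_nonneg _)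
  have hΔ : ∀ j ≠ n, 0 < |μ n - μ j| := fun j hj => abs_pos.2 (sub_ne_zero.2 (hgap j hj).symm)
  have hcoef : ∀ m ≠ n, ‖inner ℂ (e m) x‖ ≤ 2 * M * (μ m * (p m / √(μ m)) / |μ n - μ m|) * τ := by
    intro m hm
    have hμ : (μ m : ℂ) ≠ 0 := by exact_mod_cast (h.pos m).ne'
    have h1 := hx m hm
    rw [h.inner_pencil, add_eq_zero_iff_eq_neg] at h1
    have h2 : ‖z - μ m‖ * ‖inner ℂ (e m) x‖ = μ m * ‖inner ℂ (e m) (K x)‖ := by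
      have h3 := congrArg norm h1
      rw [norm_neg, norm_mul, norm_div, norm_sub_rev, Complex.norm_real,
        Real.norm_of_nonneg (h.pos m).le] at h3
      rw [← h3]
      have := (h.pos m).ne'
      field_simp
    have h4 := h.norm_inner_K_apply_le m x
    have h5 : |μ n - μ m| / 2 * ‖inner ℂ (e m) x‖ ≤ μ m * (M * (p m / √(μ m)) * τ) := by
      calc _ ≤ ‖z - μ m‖ * ‖inner ℂ (e m) x‖ := by gcongr; exact hz m hm
        _ = _ := h2
        _ ≤ _ := by have := (h.pos m).le; gcongr
    have h6 := hΔ m hm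
    rw [div_mul_eq_mul_div, div_le_iff₀ two_pos, mul_comm, ← le_div_iff₀ h6] at h5
    refine h5.trans (le_of_eq ?_)
    ring
  set f : ℕ → ℝ := fun j => if j ≠ n then p j ^ 2 / |μ n - μ j| else 0 with hf
  have hf0 : ∀ j, 0 ≤ f j := fun j => by rw [hf]; dsimp only; split_ifs <;> positivity
  have hσ' : ∑' j, ENNReal.ofReal (f j) ≤ ENNReal.ofReal (1 / (4 * M)) := by
    refine le_trans (le_of_eq (tsum_congr fun j => ?_)) hσ
    rw [hf]; dsimp only; split_ifs <;> simp
  have hfs : Summable f :=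
    summable_of_tsum_ofReal_ne_top hf0 (ne_top_of_le_ne_top ENNReal.ofReal_ne_top hσ')
  have hft : ∑' j, f j ≤ 1 / (4 * M) := by
    rw [← ENNReal.ofReal_tsum_of_nonneg hf0 hfs] at hσ'
    exact (ENNReal.ofReal_le_ofReal_iff (by positivity)).1 hσ'
  have hτle : τ ≤ 2 * (p n / √(μ n) * ‖inner ℂ (e n) x‖) := by
    have h1 : τ = p n / √(μ n) * ‖inner ℂ (e n) x‖ +
        ∑' j, if j = n then 0 else p j / √(μ j) * ‖inner ℂ (e j) x‖ :=
      hsum.tsum_eq_add_tsum_ite n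
    have h2 : ∑' j, (if j = n then 0 else p j / √(μ j) * ‖inner ℂ (e j) x‖) ≤
        ∑' j, 2 * M * τ * f j := by
      have hle : ∀ j, (if j = n then 0 else p j / √(μ j) * ‖inner ℂ (e j) x‖) ≤
          2 * M * τ * f j := by
        intro j
        by_cases hj : j = n
        · simp [hj, hf]
        · rw [if_neg hj, show f j = p j ^ 2 / |μ n - μ j| from if_pos hj]
          have h3 := h.div_sqrt_pos j
          calc _ ≤ p j / √(μ j) * (2 * M * (μ j * (p j / √(μ j)) / |μ n - μ j|) * τ) := by
                gcongr; exact hcoef j hj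
            _ = 2 * M * τ * ((μ j * (p j / √(μ j)) ^ 2) / |μ n - μ j|) := by ring
            _ = _ := by rw [h.mul_div_sqrt_sq]
      refine Summable.tsum_le_tsum hle ?_ (hfs.mul_left _)
      refine Summable.of_nonneg_of_le (fun j => ?_) hle (hfs.mul_left _)
      split_ifs
      · exact le_rfl
      · exact mul_nonneg (h.div_sqrt_pos j).le (norm_nonneg _)
    have h3 : 2 * M * τ * ∑' j, f j ≤ τ / 2 := by
      calc _ ≤ 2 * M * τ * (1 / (4 * M)) := by gcongr
        _ = τ / 2 := by field_simp; ring
    rw [tsum_mul_left] at h2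
    linarith
  refine ⟨hτle, fun m hm => (hcoef m hm).trans ?_⟩
  have h1 : 0 ≤ 2 * M * (μ m * (p m / √(μ m)) / |μ n - μ m|) := by
    have := h.div_sqrt_pos m
    have := h.pos m
    positivity
  calc _ ≤ 2 * M * (μ m * (p m / √(μ m)) / |μ n - μ m|) *
        (2 * (p n / √(μ n) * ‖inner ℂ (e n) x‖)) := by gcongr
    _ = _ := by ring

end SubordinatePencil

end Pencil

/-- The conditions on `n` under which the rectangle around `μ n` contains exactly one eigenvalue of
the perturbed operator. -/
structure IsolatedIndex (μ p q₁ q₂ : ℕ → ℝ) (M : ℝ) (n : ℕ) : Prop where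
  left_pos : 0 < q₁ n
  right_pos : 0 < q₂ n
  left_gap : ∀ j < n, 2 * q₁ n ≤ μ n - μ j
  right_gap : ∀ j > n, 2 * q₂ n ≤ μ j - μ n
  tsum_le : ∑' j : ℕ, (if j ≠ n then ENNReal.ofReal (p j ^ 2 / |μ n - μ j|) else 0) ≤
    ENNReal.ofReal (1 / (4 * M))
  le_left : 16 * M * p n ^ 2 ≤ q₁ n
  le_right : 16 * M * p n ^ 2 ≤ q₂ n

theorem SeparatedWeights.eventually_isolatedIndex {μ p q₁ q₂ : ℕ → ℝ}
    (h : SeparatedWeights μ p q₁ q₂) {M : ℝ} (hM : 0 < M) :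
    ∀ᶠ n in atTop, IsolatedIndex μ p q₁ q₂ M n := by
  obtain ⟨N, hN⟩ := h.tsum_le (1 / (4 * M)) (by positivity)
  have hc : (0 : ℝ) < 1 / (16 * M) := by positivity
  filter_upwards [h.gap, eventually_ge_atTop N, h.tendsto_left.eventually_le_const hc,
    h.tendsto_right.eventually_le_const hc] with n h1 h2 h3 h4
  refine ⟨h1.1, h1.2.1, h1.2.2.1, h1.2.2.2, ?_, ?_, ?_⟩
  · simpa [h2] using hN n
  · rw [div_le_div_iff₀ h1.1 (by positivity)] at h3
    linarith
  · rw [div_le_div_iff₀ h1.2.1 (by positivity)] at h4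
    linarith

namespace IsolatedIndex

variable {μ p q₁ q₂ : ℕ → ℝ} {M : ℝ} {n : ℕ} (hn : IsolatedIndex μ p q₁ q₂ M n)
include hn

theorem ne {j : ℕ} (hj : j ≠ n) : μ j ≠ μ n := by
  rcases lt_or_gt_of_ne hj with h | h
  · linarith [hn.left_gap j h, hn.left_pos]
  · linarith [hn.right_gap j h, hn.right_pos]

theorem abs_sub_le {z : ℂ} (hz : z ∈ closedRectangle (μ n - q₁ n) (μ n + q₂ n) (q₂ n)) {j : ℕ}
    (hj : j ≠ n) : |μ n - μ j| / 2 ≤ ‖z - μ j‖ := by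
  refine le_trans ?_ (Complex.abs_re_le_norm _)
  rw [Complex.sub_re, Complex.ofReal_re]
  obtain ⟨h1, h2, -⟩ := hz
  rcases lt_or_gt_of_ne hj with h | h
  · have h3 := hn.left_gap j h
    have := hn.left_pos
    rw [abs_of_nonneg (by linarith), abs_of_nonneg (by linarith)]
    linarith
  · have h3 := hn.right_gap j h
    have := hn.right_pos
    rw [abs_of_nonpos (by linarith), abs_of_nonpos (by linarith)]
    linarith

theorem disjoint_rectangle {k : ℕ} (hk : IsolatedIndex μ p q₁ q₂ M k) (hnk : n < k) :
    Disjoint (rectangle (μ n - q₁ n) (μ n + q₂ n) (q₂ n))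
      (rectangle (μ k - q₁ k) (μ k + q₂ k) (q₂ k)) := by
  rw [Set.disjoint_left]
  rintro z ⟨-, h1, -⟩ ⟨h2, -, -⟩
  linarith [hn.right_gap k hnk, hk.left_gap n hnk]

end IsolatedIndex

/-! ### Reduction to one scalar equation near `μ n` -/

section Pencil

variable {V : Type*} [NormedAddCommGroup V] [InnerProductSpace ℂ V]

/-- `l` is the only point of the closed rectangle around `μ n` at which the pencil is not injective;
the solutions `u z` of the pencil equations other than the `n`-th one are analytic, and `F` is
the defect in the `n`-th equation. -/
structure LocalEigen (e : HilbertBasis ℕ ℂ V) (J K : V →L[ℂ] V) (μ p q₁ q₂ : ℕ → ℝ) (M : ℝ) (n : ℕ)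
    (l : ℂ) (F : ℂ → ℂ) (u : ℂ → V) : Prop where
  mem_rectangle : l ∈ rectangle (μ n - q₁ n) (μ n + q₂ n) (q₂ n)
  differentiableOn_F : DifferentiableOn ℂ F (closedRectangle (μ n - q₁ n) (μ n + q₂ n) (q₂ n))
  differentiableOn_u : DifferentiableOn ℂ u (closedRectangle (μ n - q₁ n) (μ n + q₂ n) (q₂ n))
  apply_eq_zero : F l = 0
  le_norm_deriv : 3 / 4 ≤ ‖deriv F l‖
  norm_deriv_le : ‖deriv F l‖ ≤ 5 / 4
  ne_zero : ∀ z ∈ closedRectangle (μ n - q₁ n) (μ n + q₂ n) (q₂ n), z ≠ l → F z ≠ 0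
  pencil_eq : ∀ z ∈ closedRectangle (μ n - q₁ n) (μ n + q₂ n) (q₂ n),
    u z + K (u z) - z • J (u z) = -(F z / μ n) • e n
  inner_eq_one : inner ℂ (e n) (u l) = 1
  injective : ∀ z ∈ closedRectangle (μ n - q₁ n) (μ n + q₂ n) (q₂ n), z ≠ l →
    ∀ x, x + K x - z • J x = 0 → x = 0
  norm_inner_le : ∀ m ≠ n, ‖inner ℂ (e m) (u l)‖ ≤
    4 * M * (μ m * (p m / √(μ m)) * (p n / √(μ n)) / |μ n - μ m|)

namespace SubordinatePencil

variable {e : HilbertBasis ℕ ℂ V} {J K : V →L[ℂ] V} {μ p q₁ q₂ : ℕ → ℝ} {M : ℝ}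
  (h : SubordinatePencil e J K μ p q₁ q₂ M)
include h

theorem isUnit_pencil [CompleteSpace V] {z : ℂ}
    (hz : ∀ x, x + K x - z • J x = 0 → x = 0) : IsUnit (1 + (K - z • J)) := by
  refine isUnit_one_add_of_isCompactOperator
    (h.isCompactOperator_K.sub (h.isCompactOperator_J.smul z)) fun x hx => hz x ?_
  rw [← hx]
  simp [add_sub_assoc]

/-- A Lyapunov–Schmidt reduction: replacing the `n`-th equation by a prescribed `n`-th coordinate
leaves identity plus compact, and the a priori estimate gives injectivity throughout the closed
rectangle. Analyticity is that of operator inversion. -/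
theorem exists_solution [CompleteSpace V] {n : ℕ} (hn : IsolatedIndex μ p q₁ q₂ M n) :
    ∃ u : ℂ → V, ∀ z ∈ closedRectangle (μ n - q₁ n) (μ n + q₂ n) (q₂ n),
      DifferentiableAt ℂ u z ∧ inner ℂ (e n) (u z) = 1 ∧
        ∀ m ≠ n, inner ℂ (e m) (u z + K (u z) - z • J (u z)) = 0 := by
  set Q : V →L[ℂ] V := 1 - (innerSL ℂ (e n)).smulRight (e n) with hQ
  have hQi : ∀ m y, inner ℂ (e m) (Q y) = if m = n then 0 else inner ℂ (e m) y := by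
    intro m y
    have : Q y = y - inner ℂ (e n) y • e n := by simp [hQ]
    rw [this, inner_sub_right, inner_smul_right, e.inner_eq_ite]
    split_ifs with hm
    · simp [hm]
    · simp
  set C : ℂ → V →L[ℂ] V := fun z => Q * (K - z • J) with hC
  have hcoord : ∀ z x m, inner ℂ (e m) ((1 + C z) x) =
      if m = n then inner ℂ (e n) x else inner ℂ (e m) (x + K x - z • J x) := by
    intro z x m
    have h1 : (1 + C z) x = x + Q (K x - z • J x) := by simp [hC]
    rw [h1, inner_add_right, hQi]
    split_ifs with hm
    · rw [hm, add_zero]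
    · rw [add_sub_assoc, inner_add_right (𝕜 := ℂ) (e m) x]
  have hunit : ∀ z ∈ closedRectangle (μ n - q₁ n) (μ n + q₂ n) (q₂ n), IsUnit (1 + C z) := by
    intro z hz
    refine isUnit_one_add_of_isCompactOperator
      ((h.isCompactOperator_K.sub (h.isCompactOperator_J.smul z)).clm_comp Q) fun x hx => ?_
    have hx' : ∀ m, inner ℂ (e m) ((1 + C z) x) = 0 := fun m => by
      rw [show (1 + C z) x = 0 from hx, inner_zero_right]
    have hxn : inner ℂ (e n) x = 0 := by
      have := hx' n
      rwa [hcoord, if_pos rfl] at this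
    have hxm : ∀ m ≠ n, inner ℂ (e m) (x + K x - z • J x) = 0 := fun m hm => by
      have := hx' m
      rwa [hcoord, if_neg hm] at this
    refine e.ext_inner fun m => ?_
    rw [inner_zero_right]
    by_cases hm : m = n
    · rw [hm, hxn]
    · have := (h.norm_inner_le_of_eq_zero (fun j hj => hn.ne hj) (fun j hj => hn.abs_sub_le hz hj)
        hn.tsum_le hxm).2 m hm
      rw [hxn, norm_zero, mul_zero] at this
      exact norm_le_zero_iff.1 this
  refine ⟨fun z => Ring.inverse (1 + C z) (e n), fun z hz => ?_⟩
  have hinv : (1 + C z) (Ring.inverse (1 + C z) (e n)) = e n := by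
    have := Ring.mul_inverse_cancel _ (hunit z hz)
    exact DFunLike.congr_fun this (e n)
  refine ⟨?_, ?_, fun m hm => ?_⟩
  · have hCd : DifferentiableAt ℂ (fun z => 1 + C z) z := by
      have h1 : DifferentiableAt ℂ (fun z : ℂ => K - z • J) z := by fun_prop
      exact (h1.const_mul Q).const_add 1
    have h2 : DifferentiableAt ℂ (fun z => Ring.inverse (1 + C z)) z :=
      hCd.inverse (hunit z hz)
    exact h2.clm_apply (differentiableAt_const _)
  · have := hcoord z (Ring.inverse (1 + C z) (e n)) n
    rw [hinv, if_pos rfl, e.inner_eq_ite, if_pos rfl] at this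
    exact this.symm
  · have := hcoord z (Ring.inverse (1 + C z) (e n)) m
    rw [hinv, if_neg hm, e.inner_eq_ite, if_neg hm] at this
    exact this.symm

/-- After the reduction `z` is an eigenvalue exactly when `z = μ_n + G(z)`. The bound `|G| ≤ 2M
p_n²` is at most an eighth of the inner radius of the rectangle about `μ_n`, so this is a fixed
point problem for a contraction. -/
theorem exists_localEigen [CompleteSpace V] {n : ℕ} (hn : IsolatedIndex μ p q₁ q₂ M n) :
    ∃ l F u, LocalEigen e J K μ p q₁ q₂ M n l F u := by
  obtain ⟨u, hu⟩ := h.exists_solution hn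
  have hM := h.M_pos
  set D := closedRectangle (μ n - q₁ n) (μ n + q₂ n) (q₂ n) with hD
  have hμn : (μ n : ℂ) ≠ 0 := by exact_mod_cast (h.pos n).ne'
  have hapriori : ∀ z ∈ D, ∀ x, (∀ m ≠ n, inner ℂ (e m) (x + K x - z • J x) = 0) → _ :=
    fun z hz x hx => h.norm_inner_le_of_eq_zero (z := z) (x := x) (fun j hj => hn.ne hj)
      (fun j hj => hn.abs_sub_le hz hj) hn.tsum_le hx
  set G : ℂ → ℂ := fun z => μ n * inner ℂ (e n) (K (u z)) with hG
  have hGd : ∀ z ∈ D, DifferentiableAt ℂ G z := by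
    intro z hz
    have h1 : DifferentiableAt ℂ (fun z => ((innerSL ℂ (e n)).comp K) (u z)) z :=
      ((innerSL ℂ (e n)).comp K).differentiableAt.comp z (hu z hz).1
    exact h1.const_mul _
  have hGle : ∀ z ∈ D, ‖G z‖ ≤ 2 * M * p n ^ 2 := by
    intro z hz
    have h1 := (hapriori z hz _ (hu z hz).2.2).1
    rw [(hu z hz).2.1, norm_one, mul_one] at h1
    have h2 := h.norm_inner_K_apply_le n (u z)
    have h3 := h.div_sqrt_pos n
    have h4 := h.pos n
    calc ‖G z‖ = μ n * ‖inner ℂ (e n) (K (u z))‖ := by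
          rw [hG, norm_mul, Complex.norm_real, Real.norm_of_nonneg h4.le]
      _ ≤ μ n * (M * (p n / √(μ n)) * (2 * (p n / √(μ n)))) := by
          gcongr
          exact h2.trans (by gcongr)
      _ = 2 * M * (μ n * (p n / √(μ n)) ^ 2) := by ring
      _ = _ := by rw [h.mul_div_sqrt_sq]
  set ρ := min (q₁ n) (q₂ n) with hρ
  have hρ0 : 0 < ρ := lt_min hn.left_pos hn.right_pos
  have hρ1 : ρ ≤ q₁ n := min_le_left _ _
  have hρ2 : ρ ≤ q₂ n := min_le_right _ _
  have hρM : 16 * M * p n ^ 2 ≤ ρ := le_min hn.le_left hn.le_right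
  have hball : ∀ z : ℂ, ‖z - μ n‖ < ρ → z ∈ rectangle (μ n - q₁ n) (μ n + q₂ n) (q₂ n) := by
    intro z hz
    have h1 := (Complex.abs_re_le_norm (z - μ n)).trans_lt hz
    have h2 := (Complex.abs_im_le_norm (z - μ n)).trans_lt hz
    simp only [Complex.sub_re, Complex.ofReal_re, Complex.sub_im, Complex.ofReal_im,
      sub_zero] at h1 h2
    obtain ⟨h3, h4⟩ := abs_lt.1 h1
    exact ⟨by linarith, by linarith, by linarith⟩
  have hballD : ∀ z : ℂ, ‖z - μ n‖ < ρ → z ∈ D := fun z hz =>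
    rectangle_subset_closedRectangle _ _ _ (hball z hz)
  set B := Metric.closedBall (μ n : ℂ) (ρ / 4) with hB
  -- Cauchy's estimate on radius `ρ/2`, where `|G| ≤ ρ/8`; the discs stay inside the rectangle
  -- because `ρ/4 + ρ/2 < ρ`.
  have hderiv : ∀ z ∈ B, ‖deriv G z‖ ≤ 1 / 4 := by
    intro z hz
    rw [hB, mem_closedBall_iff_norm] at hz
    have hsub : ∀ w ∈ Metric.closedBall z (ρ / 2), w ∈ D := by
      intro w hw
      rw [mem_closedBall_iff_norm] at hw
      refine hballD w ?_
      calc ‖w - μ n‖ ≤ ‖w - z‖ + ‖z - μ n‖ := norm_sub_le_norm_sub_add_norm_sub ..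
        _ < ρ := by linarith
    have h1 := Complex.norm_deriv_le_of_forall_mem_sphere_norm_le (f := G) (c := z)
      (half_pos hρ0) (DifferentiableOn.diffContOnCl fun w hw => by
        rw [closure_ball _ (half_pos hρ0).ne'] at hw
        exact (hGd w (hsub w hw)).differentiableWithinAt)
      fun w hw => hGle w (hsub w (Metric.sphere_subset_closedBall hw))
    refine h1.trans ?_
    rw [div_le_div_iff₀ (by positivity) (by norm_num)]
    linarith
  have hBD : ∀ z ∈ B, z ∈ D := fun z hz => hballD z (by
    rw [hB, mem_closedBall_iff_norm] at hz
    linarith)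
  have hlip : ∀ z ∈ B, ∀ w ∈ B, ‖G w - G z‖ ≤ 1 / 4 * ‖w - z‖ := fun z hz w hw =>
    (convex_closedBall _ _).norm_image_sub_le_of_norm_deriv_le (fun x hx => hGd x (hBD x hx))
      hderiv hz hw
  have hmaps : Set.MapsTo (fun z => μ n + G z) B B := by
    intro z hz
    have := hGle z (hBD z hz)
    rw [hB, mem_closedBall_iff_norm, add_sub_cancel_left]
    linarith
  have hcontr : ContractingWith (1 / 4) (hmaps.restrict _ _ _) := by
    refine ⟨by rw [← NNReal.coe_lt_coe]; push_cast; norm_num,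
      LipschitzWith.of_dist_le_mul fun z w => ?_⟩
    rw [Subtype.dist_eq, Subtype.dist_eq, dist_eq_norm, dist_eq_norm]
    have := hlip w w.2 z z.2
    simpa using this
  obtain ⟨l, hlB, hl, -⟩ := hcontr.exists_fixedPoint' (Metric.isClosed_closedBall.isComplete)
    hmaps (x := (μ n : ℂ)) (Metric.mem_closedBall_self (by positivity)) (edist_ne_top _ _)
  have hl' : μ n + G l = l := hl
  have hlρ : ‖l - μ n‖ < ρ := by
    rw [hB, mem_closedBall_iff_norm] at hlB
    linarith
  have hlD := hBD l hlB
  set F : ℂ → ℂ := fun z => z - (μ n + G z) with hF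
  have hF' : deriv F l = 1 - deriv G l := by
    have h1 : HasDerivAt F (1 - deriv G l) l :=
      (hasDerivAt_id l).sub ((hGd l hlD).hasDerivAt.const_add _)
    exact h1.deriv
  have hGl := hderiv l hlB
  -- Any zero in the whole closed rectangle satisfies `|z - μ_n| = |G z|`, hence lies in the small
  -- ball on which the contraction applies.
  have huniq : ∀ z ∈ D, z ≠ l → F z ≠ 0 := by
    intro z hz hzl hFz
    have h1 : z - μ n = G z := by linear_combination hFz
    have hzB : z ∈ B := by
      rw [hB, mem_closedBall_iff_norm, h1]
      linarith [hGle z hz]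
    have h2 := hlip l hlB z hzB
    have h3 : G z - G l = z - l := by linear_combination -hl' - hFz
    rw [h3] at h2
    have h4 : 0 < ‖z - l‖ := norm_pos_iff.2 (sub_ne_zero.2 hzl)
    linarith
  have hpencil : ∀ z ∈ D, u z + K (u z) - z • J (u z) = -(F z / μ n) • e n := by
    intro z hz
    refine e.ext_inner fun m => ?_
    rw [inner_smul_right, e.inner_eq_ite]
    split_ifs with hm
    · rw [hm, h.inner_pencil, (hu z hz).2.1, hF, hG]
      field_simp
      ring
    · rw [(hu z hz).2.2 m hm, mul_zero]
  refine ⟨l, F, u, hball l hlρ, fun z hz => ?_, fun z hz => (hu z hz).1.differentiableWithinAt, ?_,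
    ?_, ?_, huniq, hpencil, (hu l hlD).2.1, fun z hz hzl x hx => ?_, fun m hm => ?_⟩
  · exact (differentiableAt_id.sub ((hGd z hz).const_add _)).differentiableWithinAt
  · rw [hF]
    exact sub_eq_zero.2 hl'.symm
  · rw [hF']
    have := norm_sub_norm_le (1 : ℂ) (deriv G l)
    rw [norm_one] at this
    linarith
  · rw [hF']
    have := norm_sub_le (1 : ℂ) (deriv G l)
    rw [norm_one] at this
    linarith
  · have key : ∀ y, (∀ m ≠ n, inner ℂ (e m) (y + K y - z • J y) = 0) → inner ℂ (e n) y = 0 →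
        y = 0 := by
      intro y hy hyn
      refine e.ext_inner fun m => ?_
      rw [inner_zero_right]
      by_cases hm : m = n
      · rw [hm, hyn]
      · have := (hapriori z hz y hy).2 m hm
        rw [hyn, norm_zero, mul_zero] at this
        exact norm_le_zero_iff.1 this
    -- Subtracting `c • u z` removes the `n`-th coordinate without disturbing the other equations,
    -- so `x = c • u z`; the `n`-th equation then forces `c F(z) = 0`.
    set c : ℂ := inner ℂ (e n) x with hc
    have hlin : (x - c • u z) + K (x - c • u z) - z • J (x - c • u z) =
        (c * (F z / μ n)) • e n := by
      have h1 := hpencil z hz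
      simp only [map_sub, map_smul]
      linear_combination (norm := module) hx - c • h1
    have hx0 : x - c • u z = 0 := by
      refine key _ (fun m hm => ?_) ?_
      · rw [hlin, inner_smul_right, e.inner_eq_ite, if_neg hm, mul_zero]
      · rw [inner_sub_right, inner_smul_right, (hu z hz).2.1, hc, mul_one, sub_self]
    rw [hx0] at hlin
    simp only [map_zero, smul_zero, add_zero, sub_zero] at hlin
    have h2 : c * (F z / μ n) = 0 := by
      have h3 := congrArg (inner ℂ (e n)) hlin
      rw [inner_zero_right, inner_smul_right, e.inner_eq_ite, if_pos rfl, mul_one] at h3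
      exact h3.symm
    have h4 : c = 0 := (mul_eq_zero.1 h2).resolve_right (div_ne_zero (huniq z hz hzl) hμn)
    rw [h4, zero_smul, sub_zero] at hx0
    exact hx0
  · have := (hapriori l hlD _ (hu l hlD).2.2).2 m hm
    rwa [(hu l hlD).2.1, norm_one, mul_one] at this

end SubordinatePencil

end Pencil

/-! ### The operator of a perturbed form -/

section FormOperator

open ContinuousLinearMap (adjoint)

variable {V H : Type*} [NormedAddCommGroup V] [InnerProductSpace ℂ V] [CompleteSpace V]
  [NormedAddCommGroup H] [InnerProductSpace ℂ H] [CompleteSpace H]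

omit [CompleteSpace V] in
theorem LocalEigen.pencil_self {e : HilbertBasis ℕ ℂ V} {J K : V →L[ℂ] V} {μ p q₁ q₂ : ℕ → ℝ}
    {M : ℝ} {n : ℕ} {l : ℂ} {F : ℂ → ℂ} {u : ℂ → V} (hl : LocalEigen e J K μ p q₁ q₂ M n l F u) :
    u l + K (u l) - l • J (u l) = 0 := by
  rw [hl.pencil_eq l (rectangle_subset_closedRectangle _ _ _ hl.mem_rectangle), hl.apply_eq_zero]
  simp

/-- `T` is the operator in `H` of the form `(u, v) ↦ ⟪v, u + K u⟫` on `V`, where `V` is embedded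
into `H` by `ι` and `K` satisfies the subordination condition with respect to the basis `e`. -/
structure FormOperator (e : HilbertBasis ℕ ℂ V) (ψ : HilbertBasis ℕ ℂ H) (ι : V →L[ℂ] H)
    (K : V →L[ℂ] V) (μ p q₁ q₂ : ℕ → ℝ) (M : ℝ) (T : H →ₗ.[ℂ] H) : Prop
    extends SubordinatePencil e (adjoint ι ∘L ι) K μ p q₁ q₂ M where
  incl_apply : ∀ n, ι (e n) = ((√(μ n))⁻¹ : ℂ) • ψ n
  mem_graph_iff : ∀ x w, (x, w) ∈ T.graph ↔ ∃ u, ι u = x ∧ u + K u = adjoint ι w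

namespace FormOperator

variable {e : HilbertBasis ℕ ℂ V} {ψ : HilbertBasis ℕ ℂ H} {ι : V →L[ℂ] H}
  {K : V →L[ℂ] V} {μ p q₁ q₂ : ℕ → ℝ} {M : ℝ} {T : H →ₗ.[ℂ] H}
  (h : FormOperator e ψ ι K μ p q₁ q₂ M T)
include h

theorem sqrt_ne_zero (n : ℕ) : ((√(μ n) : ℝ) : ℂ) ≠ 0 := by
  exact_mod_cast (h.sqrt_pos n).ne'

theorem inner_incl (n : ℕ) (v : V) : inner ℂ (ψ n) (ι v) = ((√(μ n))⁻¹ : ℂ) * inner ℂ (e n) v := by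
  have h1 := (e.hasSum_inner_smul v).mapL ((innerSL ℂ (ψ n)).comp ι)
  have h2 : HasSum (fun j => inner ℂ (e j) v * (((√(μ j))⁻¹ : ℂ) * if n = j then (1 : ℂ) else 0))
      (inner ℂ (ψ n) (ι v)) := by
    simpa [inner_smul_right, h.incl_apply, ψ.inner_eq_ite] using h1
  rw [← h2.tsum_eq, tsum_eq_single n (by intro j hj; simp [hj.symm])]
  simp [mul_comm]

theorem incl_injective : Function.Injective ι := by
  refine (injective_iff_map_eq_zero ι).2 fun v hv => e.ext_inner fun n => ?_
  have h1 := h.inner_incl n v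
  rw [hv, inner_zero_right] at h1
  rw [inner_zero_right]
  exact (mul_eq_zero.1 h1.symm).resolve_left (inv_ne_zero (h.sqrt_ne_zero n))

theorem adjoint_incl_apply (n : ℕ) : adjoint ι (ψ n) = ((√(μ n))⁻¹ : ℂ) • e n := by
  refine e.ext_inner fun m => ?_
  rw [ContinuousLinearMap.adjoint_inner_right, h.incl_apply, inner_smul_left, inner_smul_right,
    ψ.inner_eq_ite, e.inner_eq_ite]
  split_ifs with hmn
  · subst hmn
    rw [← Complex.ofReal_inv, Complex.conj_ofReal]
  · simp

theorem mem_graph {u : V} {w : H} (hu : u + K u = adjoint ι w) : (ι u, w) ∈ T.graph :=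
  (h.mem_graph_iff _ _).2 ⟨u, rfl, hu⟩

theorem apply_eq {u : V} {w : H} (hu : u + K u = adjoint ι w) :
    ∃ hx : ι u ∈ T.domain, T ⟨ι u, hx⟩ = w := by
  obtain ⟨y, hy1, hy2⟩ := LinearPMap.mem_graph_iff _ |>.1 (h.mem_graph hu)
  simp only at hy1 hy2
  refine ⟨hy1 ▸ y.2, ?_⟩
  rw [← hy2]
  congr 1
  exact Subtype.ext hy1.symm

theorem exists_of_mem_domain (x : T.domain) : ∃ u, ι u = x ∧ u + K u = adjoint ι (T x) :=
  (h.mem_graph_iff _ _).1 (T.mem_graph x)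

theorem solvesEigen {z : ℂ} {u : V} (hu : u + K u - z • (adjoint ι ∘L ι) u = 0) :
    T.SolvesEigen z (ι u) :=
  h.apply_eq (by rw [map_smul]; exact sub_eq_zero.1 hu)

/-- The resolvent is `-ι L⁻¹ ι*` with `L = 1 + K - z J`. -/
theorem exists_resolvent {z : ℂ} (hz : ∀ x, x + K x - z • (adjoint ι ∘L ι) x = 0 → x = 0) :
    ∃ R, T.IsResolventAt z R := by
  obtain ⟨L, hL⟩ := h.toSubordinatePencil.isUnit_pencil hz
  have hLx : ∀ x, (L : V →L[ℂ] V) x = x + K x - z • (adjoint ι) (ι x) := by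
    intro x
    rw [hL]
    simp [add_sub_assoc]
  have hL1 : ∀ x, (L : V →L[ℂ] V) ((↑L⁻¹ : V →L[ℂ] V) x) = x := fun x =>
    DFunLike.congr_fun L.mul_inv x
  have hL2 : ∀ x, (↑L⁻¹ : V →L[ℂ] V) ((L : V →L[ℂ] V) x) = x := fun x =>
    DFunLike.congr_fun L.inv_mul x
  refine ⟨-(ι ∘L (↑L⁻¹ : V →L[ℂ] V) ∘L adjoint ι), fun x => ?_, fun x => ?_⟩
  · set u : V := -((↑L⁻¹ : V →L[ℂ] V) (adjoint ι x)) with hu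
    have h1 : u + K u = adjoint ι (z • ι u - x) := by
      have h2 := hLx u
      rw [hu, map_neg, hL1, ← hu] at h2
      rw [map_sub, map_smul]
      linear_combination (norm := module) -h2
    obtain ⟨hx, hx'⟩ := h.apply_eq h1
    have h3 : (-(ι ∘L (↑L⁻¹ : V →L[ℂ] V) ∘L adjoint ι)) x = ι u := by simp [hu]
    simp only [h3]
    exact ⟨hx, by rw [hx', sub_sub_cancel]⟩
  · obtain ⟨u, hu, hu'⟩ := h.exists_of_mem_domain x
    have h1 : adjoint ι (z • (x : H) - T x) = -(L : V →L[ℂ] V) u := by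
      rw [hLx, map_sub, map_smul, ← hu', hu]
      abel
    change -(ι ((↑L⁻¹ : V →L[ℂ] V) (adjoint ι (z • (x : H) - T x)))) = x
    rw [h1, map_neg, hL2, map_neg, neg_neg, hu]

theorem exists_solvesEigen_of_mem_spectrum {z : ℂ} (hz : z ∈ T.spectrum) :
    ∃ x, x ≠ 0 ∧ T.SolvesEigen z x := by
  by_contra hcon
  push Not at hcon
  refine hz (h.exists_resolvent fun u hu => ?_)
  by_contra hu0
  exact hcon (ι u) (fun h1 => hu0 (h.incl_injective (by rw [h1, map_zero]))) (h.solvesEigen hu)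

section LocalEigen

variable {n : ℕ} {l : ℂ} {F : ℂ → ℂ} {u : ℂ → V}
  (hl : LocalEigen e (adjoint ι ∘L ι) K μ p q₁ q₂ M n l F u)
include hl

theorem solvesEigen_localEigen : T.SolvesEigen l (ι (u l)) := h.solvesEigen hl.pencil_self

/-- The defect of `u z` in the pencil is a multiple of `e n`, hence of `ι* ψ_n`. So `u z` gives `(z
- T)⁻¹ ψ_n` explicitly, with the only singularity in the scalar factor `1/F`. -/
theorem resolvent_apply {z : ℂ}
    (hz : z ∈ closedRectangle (μ n - q₁ n) (μ n + q₂ n) (q₂ n)) (hzl : z ≠ l) :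
    z ∈ T.resolventSet ∧ T.resolvent z (ψ n) = (F z)⁻¹ • ((√(μ n) : ℝ) : ℂ) • ι (u z) := by
  obtain ⟨R, hR⟩ := h.exists_resolvent (hl.injective z hz hzl)
  refine ⟨⟨R, hR⟩, ?_⟩
  have hs := h.sqrt_ne_zero n
  have hμ : (μ n : ℂ) = (√(μ n) : ℝ) * (√(μ n) : ℝ) := by
    rw [← Complex.ofReal_mul, Real.mul_self_sqrt (h.pos n).le]
  have h1 : u z + K (u z) = adjoint ι (z • ι (u z) - (F z / (√(μ n) : ℝ)) • ψ n) := by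
    have h2 := hl.pencil_eq z hz
    rw [ContinuousLinearMap.comp_apply] at h2
    rw [map_sub, map_smul, map_smul, h.adjoint_incl_apply, smul_smul]
    have h3 : F z / (√(μ n) : ℝ) * ((√(μ n))⁻¹ : ℂ) = F z / μ n := by
      rw [hμ]
      field_simp
    rw [h3]
    linear_combination (norm := module) h2
  obtain ⟨hx, hx'⟩ := h.apply_eq h1
  have h4 := hR.apply_of_sub_eq hx (y := (F z / (√(μ n) : ℝ)) • ψ n)
    (by rw [hx', sub_sub_cancel])
  rw [hR.resolvent_eq, ← h4, map_smul, smul_smul, smul_smul]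
  have hF := hl.ne_zero z hz hzl
  rw [show (F z)⁻¹ * ((√(μ n) : ℝ) : ℂ) * (F z / (√(μ n) : ℝ)) = 1 by field_simp, one_smul]

theorem frontier_subset : frontier (rectangle (μ n - q₁ n) (μ n + q₂ n) (q₂ n)) ⊆
    T.resolventSet := fun z hz => by
  obtain ⟨h1, h2⟩ := frontier_rectangle_subset _ _ _ hz
  exact (h.resolvent_apply hl h1 fun h3 => h2 (h3 ▸ hl.mem_rectangle)).1

theorem resolventSet_nonempty : T.resolventSet.Nonempty := by
  have hr := hl.mem_rectangle
  have hq := (abs_nonneg _).trans hr.2.2.le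
  refine ⟨((μ n - q₁ n : ℝ) : ℂ), (h.resolvent_apply hl ?_ fun h0 => ?_).1⟩
  · simpa [closedRectangle, hq] using hr.1.le.trans hr.2.1.le
  · have := hr.1
    rw [← h0, Complex.ofReal_re] at this
    exact lt_irrefl _ this

theorem rieszProjection_eq :
    rieszProjection T (μ n - q₁ n) (μ n + q₂ n) (q₂ n) (ψ n) =
      (((√(μ n) : ℝ) : ℂ) * (deriv F l)⁻¹) • ι (u l) := by
  have hr := hl.mem_rectangle
  have hq : 0 < q₂ n := (abs_nonneg _).trans_lt hr.2.2
  have hpq : μ n - q₁ n ≤ μ n + q₂ n := by linarith [hr.1, hr.2.1]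
  have hd : deriv F l ≠ 0 := fun h0 => by
    have := hl.le_norm_deriv
    rw [h0, norm_zero] at this
    norm_num at this
  have hud : DifferentiableOn ℂ (fun z => ((√(μ n) : ℝ) : ℂ) • ι (u z))
      (closedRectangle (μ n - q₁ n) (μ n + q₂ n) (q₂ n)) :=
    (ι.differentiable.comp_differentiableOn hl.differentiableOn_u).const_smul _
  rw [rieszProjection, rectangleIntegral_congr hpq hq
    (g := fun z => (F z)⁻¹ • ((√(μ n) : ℝ) : ℂ) • ι (u z)),
    rectangleIntegral_inv_smul hr hl.differentiableOn_F hud hl.apply_eq_zero hd hl.ne_zero,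
    smul_smul, inv_mul_cancel₀, one_smul, smul_smul, mul_comm]
  · simp [Real.pi_ne_zero]
  · intro z hz
    exact (h.resolvent_apply hl hz.1 fun h3 => hz.2 (h3 ▸ hr)).2

end LocalEigen

/-- Solutions of the adjoint problem are left eigenvectors. -/
theorem inner_apply {z : ℂ} {v : V}
    (hv : v + adjoint K v - z • (adjoint ι ∘L ι) v = 0) (x : T.domain) :
    inner ℂ (ι v) (T x) = conj z * inner ℂ (ι v) (x : H) := by
  obtain ⟨u, hu, hu'⟩ := h.exists_of_mem_domain x
  rw [← ContinuousLinearMap.adjoint_inner_right, ← hu', inner_add_right,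
    ← ContinuousLinearMap.adjoint_inner_left, ← inner_add_left, sub_eq_zero.1 hv, inner_smul_left,
    ContinuousLinearMap.comp_apply, ContinuousLinearMap.adjoint_inner_left, hu]

end FormOperator

end FormOperator

/-! ### Small kernels for the eigenvector coordinates -/

namespace SeparatedWeights

variable {μ p q₁ q₂ : ℕ → ℝ} (h : SeparatedWeights μ p q₁ q₂)
include h

/-- With Schur weight `p` both row and column sums become gap sums `∑ p² / |μ_m - μ_n|`. Discarding
the columns below `N` suffices, since those sums are small when either index is large. -/
theorem exists_kernelBound_gap {ε : ℝ} (hε : 0 < ε) : ∃ N₀, ∀ N ≥ N₀, KernelBound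
    (fun m n => if m ≠ n ∧ N ≤ n then ENNReal.ofReal (p m * p n / |μ m - μ n|) else 0)
    (ENNReal.ofReal ε * ENNReal.ofReal ε) := by
  obtain ⟨N₀, hN₀⟩ := h.tsum_le ε hε
  have hp := h.weight_pos
  have key : ∀ m n, ENNReal.ofReal (p m * p n / |μ m - μ n|) * ENNReal.ofReal (p n) =
      ENNReal.ofReal (p n ^ 2 / |μ m - μ n|) * ENNReal.ofReal (p m) := by
    intro m n
    rw [← ENNReal.ofReal_mul' (hp n).le, ← ENNReal.ofReal_mul' (hp m).le]
    congr 1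
    ring
  refine ⟨N₀, fun N hN => KernelBound.of_weight (p := fun n => ENNReal.ofReal (p n))
    (fun n => (ENNReal.ofReal_pos.2 (hp n)).ne') (fun n => ENNReal.ofReal_ne_top)
    (fun m => ?_) fun n => ?_⟩
  · refine le_trans ?_ (mul_le_mul_left (hN₀ m) _)
    rw [← ENNReal.tsum_mul_right]
    refine ENNReal.tsum_le_tsum fun n => ?_
    by_cases hmn : m ≠ n ∧ N ≤ n
    · rw [if_pos hmn, if_pos ⟨hmn.1.symm, Or.inr (hN.trans hmn.2)⟩, key]
    · rw [if_neg hmn, zero_mul]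
      exact zero_le
  · refine le_trans ?_ (mul_le_mul_left (hN₀ n) _)
    rw [← ENNReal.tsum_mul_right]
    refine ENNReal.tsum_le_tsum fun m => ?_
    by_cases hmn : m ≠ n ∧ N ≤ n
    · rw [if_pos hmn, if_pos ⟨hmn.1, Or.inl (hN.trans hmn.2)⟩, ← key, mul_comm (p m), abs_sub_comm]
    · rw [if_neg hmn, zero_mul]
      exact zero_le

theorem exists_kernelBound_rankOne {ε : ℝ} (hε : 0 < ε) : ∃ N₀, ∀ N ≥ N₀, KernelBound
    (fun m n => if m ≠ n ∧ N ≤ n then ENNReal.ofReal (p m / √(μ m) * (p n / √(μ n))) else 0)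
    (ENNReal.ofReal ε * ENNReal.ofReal ε) := by
  set w : ℕ → ℝ := fun n => p n / √(μ n) with hw
  have hw0 : ∀ n, 0 < w n := h.div_sqrt_pos
  set W : ℝ := ∑' n, w n ^ 2
  have hW0 : 0 ≤ W := tsum_nonneg fun n => sq_nonneg _
  have hW : ∑' n, ENNReal.ofReal (w n) ^ 2 = ENNReal.ofReal W := by
    rw [ENNReal.ofReal_tsum_of_nonneg (fun n => sq_nonneg _) h.summable_div_sqrt_sq]
    exact tsum_congr fun n => (ENNReal.ofReal_pow (hw0 n).le 2).symm
  obtain ⟨N₀, hN₀⟩ := ENNReal.exists_tsum_ite_le h.tsum_ofReal_div_sqrt_sq_ne_top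
    (ε := ENNReal.ofReal (ε * ε / (W + 1))) (ENNReal.ofReal_pos.2 (by positivity))
  refine ⟨N₀, fun N hN => ?_⟩
  have h1 : KernelBound (fun m n => if m ≠ n ∧ N ≤ n then ENNReal.ofReal (w m * w n) else 0)
      (ENNReal.ofReal (ε * ε / (W + 1)) * ENNReal.ofReal W) := by
    refine KernelBound.of_weight (p := fun n => ENNReal.ofReal (w n))
      (fun n => (ENNReal.ofReal_pos.2 (hw0 n)).ne') (fun n => ENNReal.ofReal_ne_top)
      (fun m => ?_) fun n => ?_
    · refine le_trans ?_ (mul_le_mul_left hN₀ _)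
      rw [← ENNReal.tsum_mul_right]
      refine ENNReal.tsum_le_tsum fun n => ?_
      by_cases hmn : m ≠ n ∧ N ≤ n
      · rw [if_pos hmn, if_pos (hN.trans hmn.2), ENNReal.ofReal_mul (hw0 m).le]
        exact le_of_eq (by ring)
      · rw [if_neg hmn, zero_mul]
        exact zero_le
    · rw [← hW, ← ENNReal.tsum_mul_right]
      refine ENNReal.tsum_le_tsum fun m => ?_
      by_cases hmn : m ≠ n ∧ N ≤ n
      · rw [if_pos hmn, ENNReal.ofReal_mul (hw0 m).le]
        exact le_of_eq (by ring)
      · rw [if_neg hmn, zero_mul]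
        exact zero_le
  refine h1.mono (fun m n => le_rfl) ?_
  rw [← ENNReal.ofReal_mul' hW0, ← ENNReal.ofReal_mul hε.le]
  refine ENNReal.ofReal_le_ofReal ?_
  rw [div_mul_eq_mul_div, div_le_iff₀ (by positivity)]
  nlinarith [mul_pos hε hε]

theorem exists_kernelBound {A : ℝ} (hA : 0 < A) : ∃ N₀, ∀ N ≥ N₀, KernelBound
    (fun m n => if m ≠ n ∧ N ≤ n then
      ENNReal.ofReal (A * (p m * p n / |μ m - μ n| + p m / √(μ m) * (p n / √(μ n)))) else 0)
    (ENNReal.ofReal ((1 / 4) ^ 2)) := by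
  -- The constant solves `A² · 2(ε² + ε²) = (1/4)²`, the cost of adding two kernels and scaling by
  -- `A`.
  obtain ⟨N₁, h1⟩ := h.exists_kernelBound_gap (ε := 1 / (8 * A)) (by positivity)
  obtain ⟨N₂, h2⟩ := h.exists_kernelBound_rankOne (ε := 1 / (8 * A)) (by positivity)
  refine ⟨max N₁ N₂, fun N hN => (((h1 N ((le_max_left _ _).trans hN)).add
    (h2 N ((le_max_right _ _).trans hN))).const_mul (ENNReal.ofReal A)).mono (fun m n => ?_) ?_⟩
  · have := h.weight_pos
    split_ifs
    · rw [ENNReal.ofReal_mul hA.le, ENNReal.ofReal_add]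
      · have := (this m).le; have := (h.weight_pos n).le; positivity
      · exact (mul_pos (h.div_sqrt_pos m) (h.div_sqrt_pos n)).le
    · exact zero_le
  · rw [← ENNReal.ofReal_mul (by positivity), ← ENNReal.ofReal_add (by positivity) (by positivity),
      ← ENNReal.ofReal_pow hA.le, ← ENNReal.ofReal_ofNat, ← ENNReal.ofReal_mul (by positivity),
      ← ENNReal.ofReal_mul (by positivity)]
    refine ENNReal.ofReal_le_ofReal (le_of_eq ?_)
    field_simp
    norm_num

end SeparatedWeights

/-- A family whose coordinates are dominated by a small kernel is a small perturbation of the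
basis. -/
theorem HilbertBasis.exists_perturbation {E : Type*} [NormedAddCommGroup E] [InnerProductSpace ℂ E]
    [CompleteSpace E] (e : HilbertBasis ℕ ℂ E) {k : ℕ → ℕ → ℝ} {N : ℕ} {r : ℝ} (hr : 0 ≤ r)
    (hk : KernelBound (fun m n => if m ≠ n ∧ N ≤ n then ENNReal.ofReal (k m n) else 0)
      (ENNReal.ofReal (r ^ 2))) {f : ℕ → E}
    (hf : ∀ n ≥ N, inner ℂ (e n) (f n) = 1)
    (hfk : ∀ n ≥ N, ∀ m ≠ n, ‖inner ℂ (e m) (f n)‖ ≤ k m n) :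
    ∃ C : E →L[ℂ] E, ‖C‖ ≤ r ∧ ∀ n ≥ N, f n = e n + C (e n) := by
  have hg : ∀ m n, ‖inner ℂ (e m) (if N ≤ n then f n - e n else 0)‖ₑ ≤
      if m ≠ n ∧ N ≤ n then ENNReal.ofReal (k m n) else 0 := by
    intro m n
    by_cases hn : N ≤ n
    · by_cases hmn : m = n
      · subst hmn
        rw [if_pos hn, inner_sub_right, hf m hn, e.inner_eq_ite]
        simp
      · simp only [hn, hmn, if_true, inner_sub_right, e.inner_eq_ite, if_false, sub_zero, ne_eq,
          not_false_eq_true, and_self]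
        rw [← ofReal_norm]
        exact ENNReal.ofReal_le_ofReal (hfk n hn m hmn)
    · simp [hn]
  obtain ⟨C, hC, hC'⟩ := e.exists_operator hk ENNReal.ofReal_ne_top hg
  refine ⟨C, opNorm_le_of_enorm_sq_le hr hC', fun n hn => ?_⟩
  rw [hC, if_pos hn, add_sub_cancel]

namespace LocalEigen

variable {V : Type*} [NormedAddCommGroup V] [InnerProductSpace ℂ V]
  {e : HilbertBasis ℕ ℂ V} {J K : V →L[ℂ] V} {μ p q₁ q₂ : ℕ → ℝ} {M : ℝ} {n : ℕ} {l : ℂ}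
  {F : ℂ → ℂ} {u : ℂ → V} (hl : LocalEigen e J K μ p q₁ q₂ M n l F u)
  (h : SubordinatePencil e J K μ p q₁ q₂ M)
include hl h

/-- The factor `√μ_n/√μ_m` turns coordinates in `e` into coordinates of `√μ_n ι u` in `ψ`. In `H`
the bound is therefore the gap kernel alone. -/
theorem norm_inner_mul_sqrt_div_le {m : ℕ} (hm : m ≠ n) :
    √(μ n) / √(μ m) * ‖inner ℂ (e m) (u l)‖ ≤ 4 * M * (p m * p n / |μ m - μ n|) := by
  have h1 := h.sqrt_pos m
  have h2 := h.sqrt_pos n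
  refine (mul_le_mul_of_nonneg_left (hl.norm_inner_le m hm) (by positivity)).trans (le_of_eq ?_)
  rw [abs_sub_comm]
  nth_rw 2 [← Real.mul_self_sqrt (h.pos m).le]
  field_simp

/-- In `V` the bound carries the unbounded factor `√μ_m/√μ_n ≤ 1 + |μ_m - μ_n|/(√μ_m √μ_n)`. The
second summand cancels the gap in the denominator and leaves the rank-one kernel `w_m w_n`. -/
theorem norm_inner_le_add {m : ℕ} (hm : m ≠ n) (hμ : μ m ≠ μ n) : ‖inner ℂ (e m) (u l)‖ ≤
    4 * M * (p m * p n / |μ m - μ n| + p m / √(μ m) * (p n / √(μ n))) := by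
  have h1 := h.sqrt_pos m
  have h2 := h.sqrt_pos n
  have hM := h.M_pos
  have hpm := h.weight_pos m
  have hpn := h.weight_pos n
  have hd : 0 < |μ m - μ n| := abs_pos.2 (sub_ne_zero.2 hμ)
  have h3 : √(μ m) / √(μ n) ≤ 1 + |μ m - μ n| / (√(μ m) * √(μ n)) := by
    have h4 : √(μ m) * √(μ m) ≤ √(μ m) * √(μ n) + |μ m - μ n| := by
      rcases le_total (μ m) (μ n) with h5 | h5
      · nlinarith [Real.sqrt_le_sqrt h5]
      · rw [abs_of_nonneg (by linarith), Real.mul_self_sqrt (h.pos m).le]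
        nlinarith [Real.sqrt_le_sqrt h5, Real.mul_self_sqrt (h.pos n).le]
    calc √(μ m) / √(μ n) = (√(μ m) * √(μ m)) / (√(μ m) * √(μ n)) := by field_simp
      _ ≤ (√(μ m) * √(μ n) + |μ m - μ n|) / (√(μ m) * √(μ n)) := by gcongr
      _ = _ := by field_simp
  have h5 := hl.norm_inner_mul_sqrt_div_le h hm
  calc ‖inner ℂ (e m) (u l)‖
      = √(μ m) / √(μ n) * (√(μ n) / √(μ m) * ‖inner ℂ (e m) (u l)‖) := by field_simp
    _ ≤ √(μ m) / √(μ n) * (4 * M * (p m * p n / |μ m - μ n|)) := by gcongr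
    _ ≤ (1 + |μ m - μ n| / (√(μ m) * √(μ n))) * (4 * M * (p m * p n / |μ m - μ n|)) := by gcongr
    _ = _ := by field_simp

end LocalEigen

open ContinuousLinearMap (adjoint)

/-! ### Right and left eigenvectors for all large indices -/

section TailSystem

variable {V H : Type*} [NormedAddCommGroup V] [InnerProductSpace ℂ V] [CompleteSpace V]
  [NormedAddCommGroup H] [InnerProductSpace ℂ H] [CompleteSpace H]

/-- For `n ≥ N`, `ι (u n)` is an eigenvector and `ι (u' n)` a left eigenvector of `T` for the simple
eigenvalue `ν n` in the rectangle around `μ n`; the vectors `u n` are close to the basis `e` of `V`,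
and the vectors `√(μ n) • ι (u' n)` to the basis `ψ` of `H`. -/
structure TailEigenSystem (e : HilbertBasis ℕ ℂ V) (ψ : HilbertBasis ℕ ℂ H) (ι : V →L[ℂ] H)
    (μ q₁ q₂ : ℕ → ℝ) (T : H →ₗ.[ℂ] H) (N : ℕ) (ν d : ℕ → ℂ) (u u' : ℕ → V)
    (C : V →L[ℂ] V) (C' : H →L[ℂ] H) : Prop where
  le_norm : ∀ n ≥ N, 3 / 4 ≤ ‖d n‖
  norm_le : ∀ n ≥ N, ‖d n‖ ≤ 5 / 4
  frontier_subset : ∀ n ≥ N, frontier (rectangle (μ n - q₁ n) (μ n + q₂ n) (q₂ n)) ⊆ T.resolventSet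
  rieszProjection_eq : ∀ n ≥ N, rieszProjection T (μ n - q₁ n) (μ n + q₂ n) (q₂ n) (ψ n) =
    (((√(μ n) : ℝ) : ℂ) * (d n)⁻¹) • ι (u n)
  nonempty : T.resolventSet.Nonempty
  solvesEigen : ∀ n ≥ N, T.SolvesEigen (ν n) (ι (u n))
  left_eigen : ∀ n ≥ N, ∀ x : T.domain, inner ℂ (ι (u' n)) (T x) = ν n * inner ℂ (ι (u' n)) (x : H)
  inner_ne_zero : ∀ n ≥ N, inner ℂ (ι (u' n)) (ι (u n)) ≠ 0
  injective : ∀ j ≥ N, ∀ k ≥ N, ν j = ν k → j = k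
  norm_C_le : ‖C‖ ≤ 1 / 4
  norm_C'_le : ‖C'‖ ≤ 1 / 4
  eq_add : ∀ n ≥ N, u n = e n + C (e n)
  left_eq_add : ∀ n ≥ N, ((√(μ n) : ℝ) : ℂ) • ι (u' n) = ψ n + C' (ψ n)

omit [CompleteSpace H] in
-- The three error terms sum to at most `1/4 + 1/4 + 1/16 < 1`. This makes left and right
-- eigenvectors of the same index pair nontrivially.
theorem inner_one_add_ne_zero {x y z : H} (hx : ‖x‖ = 1) (hy : ‖y‖ ≤ 1 / 4) (hz : ‖z‖ ≤ 1 / 4) :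
    inner ℂ (x + y) (x + z) ≠ 0 := by
  intro h0
  have h1 : (1 : ℂ) = -(inner ℂ x z + inner ℂ y x + inner ℂ y z) := by
    rw [inner_add_left, inner_add_right, inner_add_right, inner_self_eq_norm_sq_to_K, hx] at h0
    simp only [RCLike.ofReal_one, one_pow] at h0
    linear_combination h0
  have h2 : (1 : ℝ) ≤ ‖inner ℂ x z‖ + ‖inner ℂ y x‖ + ‖inner ℂ y z‖ := by
    calc (1 : ℝ) = ‖(1 : ℂ)‖ := by simp
      _ = ‖inner ℂ x z + inner ℂ y x + inner ℂ y z‖ := by rw [h1, norm_neg]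
      _ ≤ _ := (norm_add_le _ _).trans (add_le_add_left (norm_add_le _ _) _)
  have h3 := norm_inner_le_norm (𝕜 := ℂ) x z
  have h4 := norm_inner_le_norm (𝕜 := ℂ) y x
  have h5 := norm_inner_le_norm (𝕜 := ℂ) y z
  rw [hx] at h3 h4
  nlinarith [norm_nonneg y, norm_nonneg z]

namespace FormOperator

variable {e : HilbertBasis ℕ ℂ V} {ψ : HilbertBasis ℕ ℂ H} {ι : V →L[ℂ] H}
  {K : V →L[ℂ] V} {μ p q₁ q₂ : ℕ → ℝ} {M : ℝ} {T : H →ₗ.[ℂ] H}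
  (h : FormOperator e ψ ι K μ p q₁ q₂ M T)
include h

theorem inner_sqrt_smul_incl (m n : ℕ) (v : V) :
    inner ℂ (ψ m) (((√(μ n) : ℝ) : ℂ) • ι v) =
      (((√(μ n) / √(μ m) : ℝ)) : ℂ) * inner ℂ (e m) v := by
  rw [inner_smul_right, h.inner_incl]
  push_cast
  ring

/-- Local eigenvectors for all large indices are small perturbations of the bases. -/
theorem exists_perturbation {K' : V →L[ℂ] V} (h' : SubordinatePencil e (adjoint ι ∘L ι) K' μ p q₁ q₂ M) :
    ∃ N₀, ∀ N ≥ N₀, ∀ (l : ℕ → ℂ) (F : ℕ → ℂ → ℂ) (u : ℕ → ℂ → V),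
      (∀ n ≥ N, LocalEigen e (adjoint ι ∘L ι) K' μ p q₁ q₂ M n (l n) (F n) (u n)) →
      (∃ C : V →L[ℂ] V, ‖C‖ ≤ 1 / 4 ∧ ∀ n ≥ N, u n (l n) = e n + C (e n)) ∧
      ∃ C : H →L[ℂ] H, ‖C‖ ≤ 1 / 4 ∧
        ∀ n ≥ N, ((√(μ n) : ℝ) : ℂ) • ι (u n (l n)) = ψ n + C (ψ n) := by
  have hM := h.M_pos
  obtain ⟨N₁, h1⟩ := h.exists_kernelBound (A := 4 * M) (by positivity)
  obtain ⟨N₂, h2⟩ := eventually_atTop.1 (h.eventually_isolatedIndex hM)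
  refine ⟨max N₁ N₂, fun N hN l F u hu => ?_⟩
  have hk := h1 N ((le_max_left _ _).trans hN)
  have hne : ∀ n ≥ N, ∀ m ≠ n, μ m ≠ μ n := fun n hn m hm =>
    (h2 n ((le_max_right _ _).trans (hN.trans hn))).ne hm
  refine ⟨e.exists_perturbation (by norm_num) hk (fun n hn => (hu n hn).inner_eq_one)
    fun n hn m hm => (hu n hn).norm_inner_le_add h' hm (hne n hn m hm),
    ψ.exists_perturbation (by norm_num) hk (fun n hn => ?_) fun n hn m hm => ?_⟩
  · rw [h.inner_sqrt_smul_incl, (hu n hn).inner_eq_one, div_self (h.sqrt_pos n).ne']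
    simp
  · rw [h.inner_sqrt_smul_incl, norm_mul, Complex.norm_real, Real.norm_of_nonneg
      (div_nonneg (h.sqrt_pos n).le (h.sqrt_pos m).le)]
    refine ((hu n hn).norm_inner_mul_sqrt_div_le h' hm).trans ?_
    have := (mul_pos (h.div_sqrt_pos m) (h.div_sqrt_pos n)).le
    gcongr
    exact le_add_of_nonneg_right this

theorem exists_tailEigenSystem : ∃ N ν d u u' C C',
    TailEigenSystem e ψ ι μ q₁ q₂ T N ν d u u' C C' := by
  have hM := h.M_pos
  obtain ⟨N₁, h1⟩ := h.exists_perturbation h.toSubordinatePencil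
  obtain ⟨N₂, h2⟩ := h.exists_perturbation h.toSubordinatePencil.adjoint
  obtain ⟨N₃, h3⟩ := eventually_atTop.1 (h.eventually_isolatedIndex hM)
  set N := max N₁ (max N₂ N₃) with hN
  have hN3 : ∀ n ≥ N, IsolatedIndex μ p q₁ q₂ M n := fun n hn => h3 n (le_trans (by simp [hN]) hn)
  have hex : ∀ n, ∃ l F u, N ≤ n → LocalEigen e (adjoint ι ∘L ι) K μ p q₁ q₂ M n l F u := by
    intro n
    by_cases hn : N ≤ n
    · obtain ⟨l, F, u, hu⟩ := h.toSubordinatePencil.exists_localEigen (hN3 n hn)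
      exact ⟨l, F, u, fun _ => hu⟩
    · exact ⟨0, 0, 0, fun h0 => absurd h0 hn⟩
  have hex' : ∀ n, ∃ l F u, N ≤ n →
      LocalEigen e (adjoint ι ∘L ι) (adjoint K) μ p q₁ q₂ M n l F u := by
    intro n
    by_cases hn : N ≤ n
    · obtain ⟨l, F, u, hu⟩ := h.toSubordinatePencil.adjoint.exists_localEigen (hN3 n hn)
      exact ⟨l, F, u, fun _ => hu⟩
    · exact ⟨0, 0, 0, fun h0 => absurd h0 hn⟩
  choose l F u hu using hex
  choose l' F' u' hu' using hex'
  obtain ⟨⟨C, hC, hCu⟩, ⟨D, hD, hDu⟩⟩ := h1 N (by simp [hN]) l F u hu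
  obtain ⟨-, ⟨D', hD', hDu'⟩⟩ := h2 N (by simp [hN]) l' F' u' hu'
  have hle : ∀ (A : H →L[ℂ] H) (n : ℕ), ‖A‖ ≤ 1 / 4 → ‖A (ψ n)‖ ≤ 1 / 4 := fun A n hA => by
    have := A.le_opNorm (ψ n)
    rw [ψ.orthonormal.1 n, mul_one] at this
    exact this.trans hA
  have hne : ∀ n ≥ N, inner ℂ (ι (u' n (l' n))) (ι (u n (l n))) ≠ 0 := fun n hn h0 => by
    refine inner_one_add_ne_zero (ψ.orthonormal.1 n) (hle D' n hD') (hle D n hD) ?_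
    rw [← hDu n hn, ← hDu' n hn, inner_smul_left, inner_smul_right, h0, mul_zero, mul_zero]
  have hleft := fun n (hn : N ≤ n) => h.inner_apply (hu' n hn).pencil_self
  -- The eigenvalues of the two pencils come from separate fixed point problems; evaluating the left
  -- eigenvector at `T` of the right one identifies them, as the pairing is nonzero.
  have hl : ∀ n ≥ N, conj (l' n) = l n := fun n hn => by
    obtain ⟨hx, hx'⟩ := h.solvesEigen_localEigen (hu n hn)
    have := hleft n hn ⟨_, hx⟩
    rw [hx', inner_smul_right] at this
    exact (mul_right_cancel₀ (hne n hn) this).symm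
  have hlt : ∀ j ≥ N, ∀ k > j, l j ≠ l k := fun j hj k hk h0 => by
    have hk' : N ≤ k := hj.trans hk.le
    refine Set.disjoint_left.1 ((hN3 j hj).disjoint_rectangle (hN3 k hk') hk)
      (hu j hj).mem_rectangle ?_
    rw [h0]
    exact (hu k hk').mem_rectangle
  exact ⟨N, l, fun n => deriv (F n) (l n), fun n => u n (l n), fun n => u' n (l' n), C, D',
    { le_norm := fun n hn => (hu n hn).le_norm_deriv
      norm_le := fun n hn => (hu n hn).norm_deriv_le
      frontier_subset := fun n hn => h.frontier_subset (hu n hn)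
      rieszProjection_eq := fun n hn => h.rieszProjection_eq (hu n hn)
      nonempty := h.resolventSet_nonempty (hu N le_rfl)
      solvesEigen := fun n hn => h.solvesEigen_localEigen (hu n hn)
      left_eigen := fun n hn x => by rw [← hl n hn]; exact hleft n hn x
      inner_ne_zero := hne
      injective := fun j hj k hk hjk => by
        rcases lt_trichotomy j k with h0 | h0 | h0
        · exact absurd hjk (hlt j hj k h0)
        · exact h0
        · exact absurd hjk.symm (hlt k hk j h0)
      norm_C_le := hC
      norm_C'_le := hD'
      eq_add := hCu
      left_eq_add := hDu' }⟩

end FormOperator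

omit [CompleteSpace H] in
/-- The vectors orthogonal to all but the first `N` vectors of a basis. -/
theorem HilbertBasis.mem_span_iff (e : HilbertBasis ℕ ℂ H) (N : ℕ) (x : H) :
    x ∈ Submodule.span ℂ (Set.range fun i : Fin N => e i) ↔ ∀ k ≥ N, inner ℂ (e k) x = 0 := by
  constructor
  · intro hx k hk
    induction hx using Submodule.span_induction with
    | mem x hx =>
      obtain ⟨i, rfl⟩ := hx
      rw [e.inner_eq_ite, if_neg (by have := i.2; omega)]
    | zero => simp
    | add x y _ _ hx hy => rw [inner_add_right, hx, hy, add_zero]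
    | smul c x _ hx => rw [inner_smul_right, hx, mul_zero]
  · intro hx
    have h1 : e.head N x = x := e.ext_inner fun n => by
      rw [e.inner_head]
      split_ifs with hn
      · rfl
      · rw [hx n (not_lt.1 hn)]
    rw [← h1, e.head_apply]
    exact Submodule.sum_mem _ fun i hi => Submodule.smul_mem _ _
      (Submodule.subset_span ⟨⟨i, Finset.mem_range.1 hi⟩, rfl⟩)

/-- The common kernel of all but `N` vectors of a small perturbation of a basis. -/
theorem HilbertBasis.exists_finrank_eq (e : HilbertBasis ℕ ℂ H) {C : H →L[ℂ] H} (hC : ‖C‖ < 1)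
    (N : ℕ) : ∃ S : Submodule ℂ H, FiniteDimensional ℂ S ∧ Module.finrank ℂ S = N ∧
      ∀ x, x ∈ S ↔ ∀ k ≥ N, inner ℂ (e k + C (e k)) x = 0 := by
  -- Orthogonality of `x` to `(1 + C) e_k` is orthogonality of `(1 + C*) x` to `e_k`, so the common
  -- kernel is the preimage of the span of the first `N` basis vectors under an isomorphism.
  obtain ⟨U, hU⟩ := isUnit_one_add_of_norm_lt_one (C := adjoint C) (by simpa using hC)
  set L : H ≃ₗ[ℂ] H := (ContinuousLinearEquiv.ofUnit U).toLinearEquiv with hL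
  have hLx : ∀ x, L x = x + adjoint C x := fun x => DFunLike.congr_fun hU x
  set S₀ := Submodule.span ℂ (Set.range fun i : Fin N => e i) with hS₀
  have hS₀f : FiniteDimensional ℂ S₀ := FiniteDimensional.span_of_finite ℂ (Set.finite_range _)
  have hS₀r : Module.finrank ℂ S₀ = N := by
    rw [hS₀, finrank_span_eq_card, Fintype.card_fin]
    exact e.orthonormal.linearIndependent.comp _ Fin.val_injective
  refine ⟨S₀.map (L.symm : H →ₗ[ℂ] H), inferInstance, ?_, fun x => ?_⟩
  · rw [LinearEquiv.finrank_map_eq, hS₀r]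
  · rw [Submodule.map_equiv_eq_comap_symm, Submodule.mem_comap, hS₀, e.mem_span_iff]
    refine forall₂_congr fun k _ => ?_
    change inner ℂ (e k) (L x) = 0 ↔ _
    rw [hLx, inner_add_right, inner_add_left, ContinuousLinearMap.adjoint_inner_right]

end TailSystem

/-! ### Existence of root systems and the basis property -/

section RootSystem

variable {V H : Type*} [NormedAddCommGroup V] [InnerProductSpace ℂ V] [CompleteSpace V]
  [NormedAddCommGroup H] [InnerProductSpace ℂ H] [CompleteSpace H]

namespace TailEigenSystem

variable {e : HilbertBasis ℕ ℂ V} {ψ : HilbertBasis ℕ ℂ H} {ι : V →L[ℂ] H}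
  {μ q₁ q₂ : ℕ → ℝ} {T : H →ₗ.[ℂ] H} {N : ℕ} {ν d : ℕ → ℂ} {u u' : ℕ → V}
  {C : V →L[ℂ] V} {C' : H →L[ℂ] H} (hs : TailEigenSystem e ψ ι μ q₁ q₂ T N ν d u u' C C')
include hs

omit [CompleteSpace V] [CompleteSpace H] in
theorem d_ne_zero {n : ℕ} (hn : N ≤ n) : d n ≠ 0 := fun h0 => by
  have := hs.le_norm n hn
  rw [h0, norm_zero] at this
  norm_num at this

omit [CompleteSpace V] [CompleteSpace H] in
theorem inner_eq_zero_of_mem_rootSpace {k : ℕ} (hk : N ≤ k) {z : ℂ} (hz : z ≠ ν k) {x : H}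
    (hx : x ∈ T.rootSpace z) : inner ℂ (ι (u' k)) x = 0 :=
  LinearPMap.rootSpace_le_ker (χ := (innerSL ℂ (ι (u' k))).toLinearMap)
    (fun x => hs.left_eigen k hk x) hz hx

omit [CompleteSpace V] [CompleteSpace H] in
theorem eventually_ne (z : ℂ) : ∀ᶠ k in atTop, z ≠ ν k := by
  by_cases hz : ∃ k ≥ N, z = ν k
  · obtain ⟨k, hk, rfl⟩ := hz
    filter_upwards [eventually_gt_atTop k] with j hj h0
    exact hj.ne (hs.injective k hk j (hk.le.trans hj.le) h0)
  · push Not at hz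
    filter_upwards [eventually_ge_atTop N] with k hk using hz k hk

end TailEigenSystem

namespace FormOperator

variable {e : HilbertBasis ℕ ℂ V} {ψ : HilbertBasis ℕ ℂ H} {ι : V →L[ℂ] H}
  {K : V →L[ℂ] V} {μ p q₁ q₂ : ℕ → ℝ} {M : ℝ} {T : H →ₗ.[ℂ] H}
  (h : FormOperator e ψ ι K μ p q₁ q₂ M T)
include h

theorem exists_eq_incl_of_mem_rootSpace {z : ℂ} {x : H} (hx : x ∈ T.rootSpace z) :
    ∃ v, ι v = x := by
  have hle : T.rootSpace z ≤ LinearMap.range (ι : V →ₗ[ℂ] H) := by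
    refine iSup_le fun k => ?_
    cases k with
    | zero => exact bot_le
    | succ k =>
      rintro _ ⟨y, -, rfl⟩
      obtain ⟨v, hv, -⟩ := h.exists_of_mem_domain y
      exact ⟨v, hv⟩
  exact hle hx

/-- Closeness of the left eigenvectors to `ψ` in `H` is what makes their common kernel have
dimension exactly `N`; thus the numbering of the remaining root vectors fits with no index left
over. -/
theorem exists_isRootSystem : ∃ (l : ℕ → ℂ) (φ : ℕ → V), T.IsRootSystem l (fun n => ι (φ n)) ∧
    ∃ N, ∀ n ≥ N, frontier (rectangle (μ n - q₁ n) (μ n + q₂ n) (q₂ n)) ⊆ T.resolventSet ∧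
      ι (φ n) = rieszProjection T (μ n - q₁ n) (μ n + q₂ n) (q₂ n) (ψ n) := by
  obtain ⟨N, ν, d, u, u', C, C', hs⟩ := h.exists_tailEigenSystem
  obtain ⟨z₀, R, hR⟩ := hs.nonempty
  obtain ⟨S, hSf, hSr, hS⟩ := ψ.exists_finrank_eq (hs.norm_C'_le.trans_lt (by norm_num)) N
  have hS' : ∀ x, x ∈ S ↔ ∀ k ≥ N, (innerSL ℂ (ι (u' k))).toLinearMap x = 0 := fun x => by
    rw [hS]
    refine forall₂_congr fun k hk => ?_
    rw [← hs.left_eq_add k hk, inner_smul_left, Complex.conj_ofReal, mul_eq_zero,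
      or_iff_right (h.sqrt_ne_zero k)]
    rfl
  have hc : ∀ k ≥ N, ((√(μ k) : ℝ) : ℂ) * (d k)⁻¹ ≠ 0 := fun k hk =>
    mul_ne_zero (h.sqrt_ne_zero k) (inv_ne_zero (hs.d_ne_zero hk))
  obtain ⟨l, x, hx, hxv⟩ := LinearPMap.exists_isRootSystem hR
    (fun z hz => h.exists_solvesEigen_of_mem_spectrum hz)
    (χ := fun k => (innerSL ℂ (ι (u' k))).toLinearMap) hs.left_eigen
    (v := fun k => (((√(μ k) : ℝ) : ℂ) * (d k)⁻¹) • ι (u k)) (fun k hk => by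
      obtain ⟨hk1, hk2⟩ := hs.solvesEigen k hk
      exact ⟨T.domain.smul_mem _ hk1, by
        rw [smul_comm, ← hk2, ← LinearPMap.map_smul]; rfl⟩)
    (fun k hk => by
      rw [map_smul]
      exact smul_ne_zero (hc k hk) (hs.inner_ne_zero k hk))
    hs.injective hS' hSr
  have hmem : ∀ n, x n ∈ T.rootSpace (l n) := fun n => by
    rw [← hx.span_eq n]
    exact Submodule.subset_span ⟨n, rfl, rfl⟩
  choose φ hφ using fun n => h.exists_eq_incl_of_mem_rootSpace (hmem n)
  refine ⟨l, φ, by simpa only [hφ] using hx, N, fun n hn => ⟨hs.frontier_subset n hn, ?_⟩⟩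
  rw [hφ, hxv n hn, hs.rieszProjection_eq n hn]

theorem isRieszBasis {l : ℕ → ℂ} {φ : ℕ → V} (hx : T.IsRootSystem l (fun n => ι (φ n))) {N₁ : ℕ}
    (hφ : ∀ n ≥ N₁, ι (φ n) = rieszProjection T (μ n - q₁ n) (μ n + q₂ n) (q₂ n) (ψ n)) :
    IsRieszBasis fun n => ((√(μ n))⁻¹ : ℂ) • φ n := by
  obtain ⟨N₂, ν, d, u, u', C, C', hs⟩ := h.exists_tailEigenSystem
  obtain ⟨z₀, R, hR⟩ := hs.nonempty
  set N := max N₁ N₂ with hN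
  have hN₁ : ∀ n ≥ N, N₁ ≤ n := fun n hn => (le_max_left _ _).trans hn
  have hN₂ : ∀ n ≥ N, N₂ ≤ n := fun n hn => (le_max_right _ _).trans hn
  have hφu : ∀ n ≥ N, φ n = (((√(μ n) : ℝ) : ℂ) * (d n)⁻¹) • u n := fun n hn =>
    h.incl_injective (by
      rw [hφ n (hN₁ n hn), hs.rieszProjection_eq n (hN₂ n hn), map_smul])
  have hmem : ∀ n, ι (φ n) ∈ T.rootSpace (l n) := fun n => by
    rw [← hx.span_eq n]
    exact Submodule.subset_span ⟨n, rfl, rfl⟩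
  have hne : ∀ n ≥ N, inner ℂ (ι (u' n)) (ι (φ n)) ≠ 0 := fun n hn => by
    rw [hφu n hn, map_smul, inner_smul_right]
    exact mul_ne_zero (mul_ne_zero (h.sqrt_ne_zero n) (inv_ne_zero (hs.d_ne_zero (hN₂ n hn))))
      (hs.inner_ne_zero n (hN₂ n hn))
  -- The numbering of a given root system is not assumed compatible with `ν`; the prescribed
  -- Riesz-projected vector forces it, since it pairs nontrivially with the `n`-th left eigenvector.
  have hlν : ∀ n ≥ N, l n = ν n := fun n hn => by
    by_contra h0
    exact hne n hn (hs.inner_eq_zero_of_mem_rootSpace (hN₂ n hn) h0 (hmem n))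
  -- One of the first `N` eigenvalues may a priori coincide with some `ν k`. Each can do so for at
  -- most one `k`, so beyond `P` none does.
  obtain ⟨P, hP⟩ := eventually_atTop.1 (((Filter.eventually_all_finset (Finset.range N)).2
    fun n _ => hs.eventually_ne (l n)).and (eventually_ge_atTop N))
  have hlP : ∀ k ≥ P, ∀ n ≠ k, l n ≠ ν k := fun k hk n hnk => by
    by_cases hn : n < N
    · exact (hP k hk).1 n (Finset.mem_range.2 hn)
    · rw [hlν n (not_lt.1 hn)]
      exact fun h0 => hnk (hs.injective n (hN₂ n (not_lt.1 hn)) k (hN₂ k (hP k hk).2) h0)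
  -- The residue factor on the tail, with 1 as a harmless value below. Dividing it out makes `s n •
  -- φ n` equal to `u n` there, and its modulus between 4/5 and 4/3 allows it to be restored at the
  -- end.
  set c : ℕ → ℂ := fun n => if N ≤ n then (d n)⁻¹ else 1 with hc
  have hc0 : ∀ n, c n ≠ 0 := fun n => by
    rw [hc]
    dsimp only
    split_ifs with hn
    · exact inv_ne_zero (hs.d_ne_zero (hN₂ n hn))
    · exact one_ne_zero
  set s : ℕ → ℂ := fun n => (c n)⁻¹ * ((√(μ n))⁻¹ : ℂ) with hs_def
  have hs0 : ∀ n, s n ≠ 0 := fun n =>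
    mul_ne_zero (inv_ne_zero (hc0 n)) (inv_ne_zero (h.sqrt_ne_zero n))
  have hf : IsRieszBasis fun n => s n • φ n := by
    refine e.isRieszBasis_of_tail (hs.norm_C_le.trans_lt (by norm_num)) (N := N)
      (fun n hn => ?_) fun b hb => ?_
    · rw [← hs.eq_add n (hN₂ n hn), hφu n hn, smul_smul, hs_def, hc]
      have h1 := hs.d_ne_zero (hN₂ n hn)
      have h2 := h.sqrt_ne_zero n
      simp only [if_pos hn]
      rw [show (d n)⁻¹⁻¹ * ((√(μ n))⁻¹ : ℂ) * (((√(μ n) : ℝ) : ℂ) * (d n)⁻¹) = 1 by field_simp,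
        one_smul]
    -- The `k`-th left eigenvector is continuous on `V` and annihilates every term of the series
    -- except the `k`-th. The finite remainder is handled by linear independence of root vectors.
    · have hbP : ∀ k ≥ P, b k = 0 := fun k hk => by
        have h1 := hb.mapL ((innerSL ℂ (ι (u' k))).comp ι)
        rw [map_zero] at h1
        have h2 := h1.unique (hasSum_single k fun n hn => ?_)
        · simp only [ContinuousLinearMap.comp_apply, map_smul, innerSL_apply_apply, smul_eq_mul,
            zero_eq_mul] at h2
          exact h2.resolve_right (mul_ne_zero (hs0 k) (hne k (hP k hk).2))
        · simp only [ContinuousLinearMap.comp_apply, map_smul, innerSL_apply_apply]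
          rw [hs.inner_eq_zero_of_mem_rootSpace (hN₂ k (hP k hk).2) (hlP k hk n hn) (hmem n)]
          simp
      have h1 : ∑ n ∈ Finset.range P, (b n * s n) • ι (φ n) = 0 := by
        have h2 := hb.unique (hasSum_sum_of_ne_finset_zero (s := Finset.range P) fun n hn => by
          rw [hbP n (by simpa using hn), zero_smul])
        have h3 := congrArg ι h2.symm
        simpa only [map_sum, map_smul, smul_smul, map_zero] using h3
      intro n
      by_cases hn : n < P
      · exact (mul_eq_zero.1 (linearIndependent_iff'.1
          (LinearPMap.IsRootSystem.linearIndependent_all hR hx) _ _ h1 n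
          (Finset.mem_range.2 hn))).resolve_right (hs0 n)
      · exact hbP n (not_lt.1 hn)
  have hcs : ∀ n, ((√(μ n))⁻¹ : ℂ) • φ n = c n • s n • φ n := fun n => by
    rw [smul_smul, hs_def, mul_inv_cancel_left₀ (hc0 n)]
  simp only [hcs]
  refine hf.smul (r := 4 / 5) (R := 4 / 3) (by norm_num) (fun n => ?_) fun n => ?_
  all_goals
    rw [hc]
    dsimp only
    split_ifs with hn
  · rw [norm_inv, le_inv_comm₀ (by norm_num) (norm_pos_iff.2 (hs.d_ne_zero (hN₂ n hn)))]
    exact (hs.norm_le n (hN₂ n hn)).trans (by norm_num)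
  · norm_num
  · rw [norm_inv, inv_le_comm₀ (norm_pos_iff.2 (hs.d_ne_zero (hN₂ n hn))) (by norm_num)]
    exact le_trans (by norm_num) (hs.le_norm n (hN₂ n hn))
  · norm_num

end FormOperator

end RootSystem

/-! ### From the energy form to the operator setting -/

theorem exists_pos_forall_le {μ : ℕ → ℝ} (hμ : ∀ n, 0 < μ n) (h : Tendsto μ atTop atTop) :
    ∃ c > 0, ∀ n, c ≤ μ n := by
  obtain ⟨B, hB⟩ := h.inv_tendsto_atTop.bddAbove_range
  have hB0 : ∀ n, (μ n)⁻¹ ≤ B := fun n => hB ⟨n, rfl⟩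
  have hBpos : 0 < B := (inv_pos.2 (hμ 0)).trans_le (hB0 0)
  exact ⟨B⁻¹, inv_pos.2 hBpos, fun n => (inv_le_comm₀ (hμ n) hBpos).1 (hB0 n)⟩

/-- A sesquilinear form that is continuous in each variable separately is the form of a bounded
operator. -/
theorem exists_operator_of_separately_continuous {V : Type*} [NormedAddCommGroup V]
    [InnerProductSpace ℂ V] [CompleteSpace V] (b : V →ₗ[ℂ] V →ₗ⋆[ℂ] ℂ)
    (hb₁ : ∀ v, Continuous fun u => b u v) (hb₂ : ∀ u, Continuous fun v => b u v) :
    ∃ K : V →L[ℂ] V, ∀ u v, inner ℂ v (K u) = b u v := by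
  have hex : ∀ u, ∃ w, ∀ v, inner ℂ v w = b u v := by
    intro u
    set f : V →L[ℂ] ℂ :=
      { toFun := fun v => conj (b u v)
        map_add' := fun v w => by simp
        map_smul' := fun c v => by simp
        cont := Complex.continuous_conj.comp (hb₂ u) } with hf
    refine ⟨(InnerProductSpace.toDual ℂ V).symm f, fun v => ?_⟩
    rw [← inner_conj_symm, InnerProductSpace.toDual_symm_apply]
    exact Complex.conj_conj _
  choose k hk using hex
  set L : V →ₗ[ℂ] V :=
    { toFun := k
      map_add' := fun u v => ext_inner_left ℂ fun w => by simp [inner_add_right, hk]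
      map_smul' := fun c u => ext_inner_left ℂ fun w => by simp [inner_smul_right, hk] } with hL
  -- The closed graph theorem: continuity in the first variable identifies the limit weakly, so
  -- joint boundedness of `b` need not be assumed.
  have hLc : Continuous L := by
    refine L.continuous_of_seq_closed_graph fun u x y hu hy => ext_inner_left ℂ fun v => ?_
    have h1 : Tendsto (fun n => inner ℂ v (L (u n))) atTop (𝓝 (inner ℂ v y)) :=
      tendsto_const_nhds.inner hy
    have h2 : Tendsto (fun n => b (u n) v) atTop (𝓝 (b x v)) := ((hb₁ v).tendsto x).comp hu
    rw [show inner ℂ v (L x) = b x v from hk x v]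
    exact tendsto_nhds_unique h1 (h2.congr fun n => (hk (u n) v).symm)
  exact ⟨⟨L, hLc⟩, hk⟩

namespace EnergyForm

variable {H : Type*} [NormedAddCommGroup H] [InnerProductSpace ℂ H] {a : EnergyForm H}

theorem incl_injective : Function.Injective a.incl := Subtype.val_injective

theorem mem_graph_operator (t : a.V →ₗ[ℂ] a.V →ₗ⋆[ℂ] ℂ) (x w : H) :
    (x, w) ∈ (a.operator t).graph ↔
      ∃ u : a.V, a.incl u = x ∧ ∀ v : a.V, t u v = inner ℂ (a.incl v) w := by
  rw [graph_operator]
  rfl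

theorem exists_lift {z : ℂ} {x : H} (hx : (a.operator a.energy).SolvesEigen z x) :
    ∃ g : a.V, a.incl g = x ∧ ∀ v, inner ℂ v g = z * inner ℂ (a.incl v) x := by
  obtain ⟨h, hx⟩ := hx
  have h1 := (a.operator a.energy).mem_graph ⟨x, h⟩
  rw [hx] at h1
  obtain ⟨g, hg, hg'⟩ := (mem_graph_operator _ _ _).1 h1
  exact ⟨g, hg, fun v => by rw [inner_def, hg', inner_smul_right]⟩

/-- Closedness of the form gives completeness of the energy space. -/
theorem completeSpace [CompleteSpace H] {C : ℝ} (hC : ∀ v, ‖a.incl v‖ ≤ C * ‖v‖) :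
    CompleteSpace a.V := by
  set ι : a.V →L[ℂ] H := a.incl.mkContinuous C hC with hι
  refine Metric.complete_of_cauchySeq_tendsto fun u hu => ?_
  obtain ⟨x, hx⟩ := cauchySeq_tendsto_of_complete (ι.uniformContinuous.comp_cauchySeq hu)
  obtain ⟨y, -, hy⟩ := a.closed u x hx fun ε hε => by
    obtain ⟨N, hN⟩ := Metric.cauchySeq_iff.1 hu (√ε) (Real.sqrt_pos.2 hε)
    refine ⟨N, fun m hm n hn => ?_⟩
    have h1 := hN m hm n hn
    rw [dist_eq_norm] at h1
    have h2 : ‖u m - u n‖ ^ 2 < ε := by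
      rw [← Real.sq_sqrt hε.le]
      exact pow_lt_pow_left₀ h1 (norm_nonneg _) two_ne_zero
    rw [norm_sq_eq] at h2
    exact h2
  set y' : a.V := y with hy'
  refine ⟨y', tendsto_iff_norm_sub_tendsto_zero.2 ?_⟩
  have h1 : Tendsto (fun n => ‖u n - y'‖ ^ 2) atTop (𝓝 0) :=
    hy.congr fun n => (norm_sq_eq a (u n - y')).symm
  have h2 := h1.sqrt
  simpa [Real.sqrt_sq (norm_nonneg _)] using h2

section Eigenbasis

variable {μ : ℕ → ℝ} {ψ : HilbertBasis ℕ ℂ H} {g : ℕ → a.V}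
  (hg : ∀ n, a.incl (g n) = ψ n)
  (hg' : ∀ n v, inner ℂ v (g n) = (μ n : ℂ) * inner ℂ (a.incl v) (ψ n))
include hg hg'

/-- The form takes the value `μ_n` at `(ψ_n, ψ_n)`, so positivity of the eigenvalues is a
consequence of positive definiteness. -/
theorem eigenvalue_pos (n : ℕ) : 0 < μ n := by
  have h1 : inner ℂ (g n) (g n) = (μ n : ℂ) := by
    rw [hg', hg, ψ.inner_eq_ite, if_pos rfl, mul_one]
  have h2 : g n ≠ 0 := fun h0 => by
    have := hg n
    rw [h0, map_zero] at this
    exact ψ.orthonormal.ne_zero n this.symm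
  have h3 := a.pos (g n) h2
  have h4 : a.form (g n) (g n) = (μ n : ℂ) := h1
  rwa [h4, Complex.ofReal_re] at h3

theorem orthonormal_smul : Orthonormal ℂ fun n => ((√(μ n))⁻¹ : ℂ) • g n := by
  refine orthonormal_iff_ite.2 fun m n => ?_
  rw [inner_smul_left, inner_smul_right, hg', hg, ψ.inner_eq_ite]
  split_ifs with hmn
  · subst hmn
    have h1 := eigenvalue_pos hg hg' m
    rw [← Complex.ofReal_inv, Complex.conj_ofReal, mul_one, ← Complex.ofReal_mul,
      ← Complex.ofReal_mul]
    norm_cast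
    nth_rw 3 [← Real.mul_self_sqrt h1.le]
    have := (Real.sqrt_pos.2 h1).ne'
    field_simp
  · simp

theorem norm_inner_smul_sq (n : ℕ) (v : a.V) :
    ‖inner ℂ (((√(μ n))⁻¹ : ℂ) • g n) v‖ ^ 2 = μ n * ‖inner ℂ (ψ n) (a.incl v)‖ ^ 2 := by
  have h1 := eigenvalue_pos hg hg' n
  rw [inner_smul_left, ← inner_conj_symm, hg', ← Complex.ofReal_inv, Complex.conj_ofReal, map_mul,
    inner_conj_symm, Complex.conj_ofReal, norm_mul, norm_mul, Complex.norm_real, Complex.norm_real,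
    norm_inv, Real.norm_of_nonneg h1.le, Real.norm_of_nonneg (Real.sqrt_nonneg _), mul_pow, mul_pow,
    inv_pow, Real.sq_sqrt h1.le]
  field_simp

/-- Parseval's identity in `H` is compared with Bessel's inequality in `V`. Bessel is enough, and it
needs no completeness of `V`, which is itself derived from this bound. -/
theorem exists_norm_incl_le {c : ℝ} (hc : 0 < c) (hcμ : ∀ n, c ≤ μ n) :
    ∃ C, ∀ v, ‖a.incl v‖ ≤ C * ‖v‖ := by
  have key : ∀ v, c * ‖a.incl v‖ ^ 2 ≤ ‖v‖ ^ 2 := fun v => by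
    have h1 := (orthonormal_smul hg hg').tsum_inner_products_le v
    have h2 := (orthonormal_smul hg hg').inner_products_summable v
    have h3 := (ψ.hasSum_norm_inner_sq (a.incl v)).mul_left c
    refine le_trans ?_ h1
    rw [← h3.tsum_eq]
    refine h3.summable.tsum_le_tsum (fun n => ?_) h2
    rw [norm_inner_smul_sq hg hg']
    exact mul_le_mul_of_nonneg_right (hcμ n) (sq_nonneg _)
  refine ⟨(√c)⁻¹, fun v => ?_⟩
  rw [← div_eq_inv_mul, le_div_iff₀ (Real.sqrt_pos.2 hc), mul_comm]
  refine le_of_sq_le_sq ?_ (norm_nonneg v)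
  rw [mul_pow, Real.sq_sqrt hc.le]
  exact key v

theorem exists_hilbertBasis [CompleteSpace a.V] :
    ∃ e : HilbertBasis ℕ ℂ a.V, ∀ n, e n = ((√(μ n))⁻¹ : ℂ) • g n := by
  have hsp : (Submodule.span ℂ (Set.range fun n => ((√(μ n))⁻¹ : ℂ) • g n))ᗮ = ⊥ := by
    refine (Submodule.eq_bot_iff _).2 fun v hv => incl_injective ?_
    refine ψ.ext_inner fun n => ?_
    have h1 := (Submodule.mem_orthogonal _ _).1 hv _ (Submodule.subset_span ⟨n, rfl⟩)
    have h2 := norm_inner_smul_sq hg hg' n v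
    rw [h1, norm_zero, zero_pow two_ne_zero, eq_comm, mul_eq_zero,
      or_iff_right (eigenvalue_pos hg hg' n).ne', sq_eq_zero_iff, norm_eq_zero] at h2
    rw [h2, map_zero, inner_zero_right]
  exact ⟨HilbertBasis.mkOfOrthogonalEqBot (orthonormal_smul hg hg') hsp, fun n => by
    rw [HilbertBasis.coe_mkOfOrthogonalEqBot]⟩

end Eigenbasis

/-- The operator of a form `a + b` with `b` subordinate to the eigenbasis of `a`. -/
theorem exists_formOperator [CompleteSpace H] {μ p q₁ q₂ : ℕ → ℝ} {ψ : HilbertBasis ℕ ℂ H}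
    (hψ : ∀ k, (a.operator a.energy).SolvesEigen (μ k) (ψ k))
    (hw : (∀ n, 0 < μ n) → SeparatedWeights μ p q₁ q₂) {b : a.V →ₗ[ℂ] a.V →ₗ⋆[ℂ] ℂ}
    (hb₁ : ∀ v, Continuous fun u => b u v) (hb₂ : ∀ u, Continuous fun v => b u v)
    {M : ℝ} (hM : 0 < M) (hsub : ∀ (m n : ℕ) (u v : a.V), a.incl u = ψ m → a.incl v = ψ n →
      ‖b u v‖ ≤ M * (p m * p n)) :
    ∃ (_ : CompleteSpace a.V) (e : HilbertBasis ℕ ℂ a.V) (ι : a.V →L[ℂ] H) (K : a.V →L[ℂ] a.V),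
      (∀ v, ι v = a.incl v) ∧ FormOperator e ψ ι K μ p q₁ q₂ M (a.operator (a.energy + b)) := by
  choose g hg hg' using fun k => exists_lift (hψ k)
  have hμ := eigenvalue_pos hg hg'
  have hw := hw hμ
  obtain ⟨c, hc, hcμ⟩ := exists_pos_forall_le hμ hw.tendsto_atTop
  obtain ⟨C, hC⟩ := exists_norm_incl_le hg hg' hc hcμ
  have hV := completeSpace hC
  obtain ⟨e, he⟩ := exists_hilbertBasis hg hg'
  obtain ⟨K, hK⟩ := exists_operator_of_separately_continuous b hb₁ hb₂
  set ι : a.V →L[ℂ] H := a.incl.mkContinuous C hC with hι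
  have hιv : ∀ v, ι v = a.incl v := fun v => rfl
  have hincl : ∀ n, ι (e n) = ((√(μ n))⁻¹ : ℂ) • ψ n := fun n => by
    rw [he, map_smul, hιv, hg]
  refine ⟨hV, e, ι, K, hιv, { hw with
    M_pos := hM
    apply_J := fun n => ext_inner_left ℂ fun v => ?_
    norm_inner_K_le := fun m n => ?_
    incl_apply := hincl
    mem_graph_iff := fun x w => ?_ }⟩
  · have h1 : (μ n : ℂ) ≠ 0 := by exact_mod_cast (hμ n).ne'
    rw [ContinuousLinearMap.comp_apply, ContinuousLinearMap.adjoint_inner_right, hincl,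
      inner_smul_right, inner_smul_right, he, inner_smul_right, hg', hιv]
    field_simp
  · have h1 := hsub n m (g n) (g m) (hg n) (hg m)
    have h2 := hw.sqrt_pos m
    have h3 := hw.sqrt_pos n
    have h4 : inner ℂ (e m) (K (e n)) = ((√(μ m))⁻¹ : ℂ) * ((√(μ n))⁻¹ : ℂ) * b (g n) (g m) := by
      rw [hK, he, he, map_smulₛₗ, map_smul, LinearMap.smul_apply, ← Complex.ofReal_inv,
        Complex.conj_ofReal]
      simp [mul_assoc]
    rw [h4, norm_mul, norm_mul, norm_inv, norm_inv, Complex.norm_real, Complex.norm_real,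
      Real.norm_of_nonneg h2.le, Real.norm_of_nonneg h3.le]
    calc (√(μ m))⁻¹ * (√(μ n))⁻¹ * ‖b (g n) (g m)‖
        ≤ (√(μ m))⁻¹ * (√(μ n))⁻¹ * (M * (p n * p m)) := by gcongr
      _ = _ := by ring
  · rw [mem_graph_operator]
    refine exists_congr fun u => and_congr_right fun _ => ⟨fun h => ext_inner_left ℂ fun v => ?_,
      fun h v => ?_⟩
    · rw [inner_add_right, hK, inner_def, ContinuousLinearMap.adjoint_inner_right]
      exact h v
    · have h1 := congrArg (inner ℂ v) h
      rw [inner_add_right, hK, inner_def, ContinuousLinearMap.adjoint_inner_right] at h1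
      exact h1

end EnergyForm

theorem mainTheorem8 {H : Type*} [NormedAddCommGroup H] [InnerProductSpace ℂ H] [CompleteSpace H]
    (a : EnergyForm H)
    -- the eigenpairs of `A`; the index `k : ℕ` here is the pair number `k + 1`
    (μ : ℕ → ℝ) (ψ : HilbertBasis ℕ ℂ H)
    (hψ : ∀ k, (a.operator a.energy).SolvesEigen (μ k) (ψ k))
    -- eigenvalue separation
    (γ κ : ℝ) (hγ : 0 < γ) (hκ : 0 < κ) (N₀ : ℕ)
    (hsep : ∀ k ≥ N₀, κ * ((k : ℝ) + 1) ^ (γ - 1) ≤ μ (k + 1) - μ k)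
    -- the perturbation `b` and local form-subordination
    (b : a.V →ₗ[ℂ] a.V →ₗ⋆[ℂ] ℂ)
    (hb₁ : ∀ v, Continuous fun u => b u v) (hb₂ : ∀ u, Continuous fun v => b u v)
    (α M : ℝ) (hα : 1 < 2 * α + γ) (hM : 0 < M)
    (hsub : ∀ (m n : ℕ) (u v : a.V), a.incl u = ψ m → a.incl v = ψ n →
      ‖b u v‖ ≤ M / (((m : ℝ) + 1) ^ α * ((n : ℝ) + 1) ^ α)) :
    (∃ (l : ℕ → ℂ) (φ : ℕ → a.V),
      IsPerturbedRootSystem (a.operator (a.energy + b)) μ γ κ ψ l (fun n => a.incl (φ n))) ∧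
    ∀ (l : ℕ → ℂ) (φ : ℕ → a.V),
      IsPerturbedRootSystem (a.operator (a.energy + b)) μ γ κ ψ l (fun n => a.incl (φ n)) →
        IsRieszBasis (fun n => ((μ n ^ (-(1 / 2) : ℝ) : ℝ) : ℂ) • φ n) ∧
        IsRieszBasis (fun n => ((‖φ n‖⁻¹ : ℝ) : ℂ) • φ n) := by
  -- A larger `α` only strengthens subordination, so it may be lowered to 1/2; the sum estimates
  -- need `2α + γ - 1 ≤ γ`, and `γ > 0` preserves the strict inequality.
  have hα' : 1 < 2 * min α (1 / 2) + γ := by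
    rcases min_choice α (1 / 2) with h | h <;> rw [h] <;> linarith
  obtain ⟨hV, e, ι, K, hι, h⟩ := EnergyForm.exists_formOperator hψ
    (fun hμ => separatedWeights_of_gap hμ hγ hκ hsep hα' (min_le_right _ _)) hb₁ hb₂ hM
    fun m n u v hu hv => by
      refine (hsub m n u v hu hv).trans ?_
      have h1 : ∀ k : ℕ, ((k : ℝ) + 1) ^ (-α) ≤ ((k : ℝ) + 1) ^ (-min α (1 / 2)) := fun k =>
        Real.rpow_le_rpow_of_exponent_le (by simp) (neg_le_neg (min_le_left _ _))
      calc M / (((m : ℝ) + 1) ^ α * ((n : ℝ) + 1) ^ α)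
          = M * (((m : ℝ) + 1) ^ (-α) * ((n : ℝ) + 1) ^ (-α)) := by
            rw [Real.rpow_neg (by positivity), Real.rpow_neg (by positivity), ← mul_inv,
              div_eq_mul_inv]
        _ ≤ _ := by
            gcongr M * (?_ * ?_)
            exacts [h1 m, h1 n]
  simp only [IsPerturbedRootSystem, ← hι]
  refine ⟨?_, fun l φ hφ => ?_⟩
  · obtain ⟨l, φ, h1, h2⟩ := h.exists_isRootSystem
    exact ⟨l, φ, h1, h2⟩
  · obtain ⟨h1, N, h2⟩ := hφ
    have h3 := h.isRieszBasis h1 fun n hn => (h2 n hn).2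
    have h4 : ∀ n, ((μ n ^ (-(1 / 2) : ℝ) : ℝ) : ℂ) = ((√(μ n))⁻¹ : ℂ) := fun n => by
      rw [Real.rpow_neg (h.pos n).le, ← Real.sqrt_eq_rpow, Complex.ofReal_inv]
    simp only [h4]
    refine ⟨h3, ?_⟩
    -- The positive factor `μ_n^{-1/2}` cancels upon normalization, so the normalized vectors of
    -- both families agree.
    convert! h3.normalize using 2 with n
    have h5 := h.sqrt_pos n
    rw [norm_smul, norm_inv, Complex.norm_real, Real.norm_of_nonneg h5.le, smul_smul, mul_inv,
      inv_inv, Complex.ofReal_mul, mul_right_comm, mul_inv_cancel₀ (h.sqrt_ne_zero n), one_mul]
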